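/- There are universal constants $C,c>0$ such that the following holds. Let $m,n,r,T\ge 1$ be integers and let $M\in\mathbb{R}^{m\times n}$ have rank $r$, with singular value decomposition $M=U\Sigma V^\top$, where $U\in\mathbb{R}^{m\times r}$ and $V\in\mathbb{R}^{n\times r}$ have orthonormal columns and $\Sigma=\mathrm{diag}(\sigma_1,\dots,\sigma_r)$ with $\sigma_1\ge\dots\ge\sigma_r>0$. For a matrix $A$ let $\|A\|_{2\to\infty}=\max_i\big(\sum_j A_{i,j}^2\big)^{1/2}$ and $\|A\|_{\max}=\max_{i,j}|A_{i,j}|$. Put $\kappa=\sigma_1/\sigma_r$ and $\mu=\max\big(\sqrt{m/r}\,\|U\|_{2\to\infty},\ \sqrt{n/r}\,\|V\|_{2\to\infty}\big)$. Let $\omega=(\omega_{i,j})$ be a probability distribution on $[m]\times[n]$ with $\omega_{\min}=\min_{i,j}\omega_{i,j}>0$, and let $(i_1,j_1),\dots,(i_T,j_T)$ be i.i.d. with distribution $\omega$. Let $\xi_1,\dots,\xi_T$ be i.i.d., independent of the pairs $(i_t,j_t)$, and $\sigma$-subgaussian for some $\sigma\ge 0$, that is, $\mathbb{E}\,e^{a\xi_t}\le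 e^{\sigma^2a^2/2}$ for all $a\in\mathbb{R}$. One observes $r_t=M_{i_t,j_t}+\xi_t$, $1\le t\le T$. Put $L=\max(\|M\|_{\max},\sigma)$ and let $\widetilde M\in\mathbb{R}^{m\times n}$ be given by $$\widetilde M_{i,j}=\frac{1}{T\omega_{i,j}}\sum_{t=1}^T r_t\,\mathbf{1}\{(i_t,j_t)=(i,j)\}.$$ Let $\widehat M=\widehat U\widehat\Sigma\widehat V^\top$ be a singular value decomposition of a best approximation of $\widetilde M$, in Frobenius norm, by matrices of rank at most $r$; here $\widehat U\in\mathbb{R}^{m\times r}$ and $\widehat V\in\mathbb{R}^{n\times r}$ have orthonormal columns. Then for every $\delta\in(0,1)$: if $$T\ \ge\ c\,\frac{L^2(m+n)}{\sigma_r^2\,\omega_{\min}}\,\log^3\!\Big(\frac{(m+n)T}{\delta}\Big),$$ then, with probability at least $1-\delta$, $$\max\Big(\|UU^\top-\widehat U\widehat U^\top\|_{2\to\infty},\ \|VV^\top-\widehat V\widehat V^\top\|_{2\to\infty}\Big)\ \le\ C\,\frac{L}{\sigma_r}\sqrt{\frac{\mu^2\kappa^2 r(m+n)}{T\,\omega_{\min}\,(m\wedge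 n)}\,\log^3\!\Big(\frac{(m+n)T}{\delta}\Big)}.$$ -/

import Mathlib

open MeasureTheory ProbabilityTheory
open scoped NNReal Matrix

namespace LowRank

noncomputable section

/-- The norm `‖A‖_{2→∞}`: the largest Euclidean norm of a row of `A`. -/
def twoToInf {m n : ℕ} (A : Matrix (Fin m) (Fin n) ℝ) : ℝ :=
  ⨆ i, Real.sqrt (∑ j, A i j ^ 2)

/-- The norm `‖A‖_max`: the largest absolute value of an entry of `A`. -/
def maxNorm {m n : ℕ} (A : Matrix (Fin m) (Fin n) ℝ) : ℝ :=
  ⨆ p : Fin m × Fin n, |A p.1 p.2|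

/-- The square of the Frobenius norm. -/
def frobSq {m n : ℕ} (A : Matrix (Fin m) (Fin n) ℝ) : ℝ :=
  ∑ i, ∑ j, A i j ^ 2

/-- `A = U diag(s) Vᵀ` is a singular value decomposition of `A` with `r` singular triples:
`U` and `V` have orthonormal columns and `s` lists nonnegative numbers in nonincreasing order. -/
structure IsSVD {m n r : ℕ} (A : Matrix (Fin m) (Fin n) ℝ) (U : Matrix (Fin m) (Fin r) ℝ)
    (s : Fin r → ℝ) (V : Matrix (Fin n) (Fin r) ℝ) : Prop where
  orthonormal_left : Uᵀ * U = 1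
  orthonormal_right : Vᵀ * V = 1
  nonneg : ∀ k, 0 ≤ s k
  antitone : Antitone s
  eq : A = U * Matrix.diagonal s * Vᵀ

/-- `B` is a best approximation of `A`, in Frobenius norm, among the matrices of rank at most `r`. -/
def IsBestRankApprox {m n : ℕ} (r : ℕ) (A B : Matrix (Fin m) (Fin n) ℝ) : Prop :=
  B.rank ≤ r ∧ ∀ B' : Matrix (Fin m) (Fin n) ℝ, B'.rank ≤ r → frobSq (A - B) ≤ frobSq (A - B')

/-- `Û` and `V̂` hold the left and right singular vectors of a best rank-`r` approximation
of `A`. -/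
def IsSpectralEstimate {m n r : ℕ} (A : Matrix (Fin m) (Fin n) ℝ)
    (Uhat : Matrix (Fin m) (Fin r) ℝ) (Vhat : Matrix (Fin n) (Fin r) ℝ) : Prop :=
  ∃ (Mhat : Matrix (Fin m) (Fin n) ℝ) (shat : Fin r → ℝ),
    IsBestRankApprox r A Mhat ∧ IsSVD Mhat Uhat shat Vhat

/-- The incoherence parameter
`μ = max (√(m/r) ‖U‖_{2→∞}) (√(n/r) ‖V‖_{2→∞})`. -/
def incoherence {m n r : ℕ} (U : Matrix (Fin m) (Fin r) ℝ) (V : Matrix (Fin n) (Fin r) ℝ) : ℝ :=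
  max (Real.sqrt ((m : ℝ) / r) * twoToInf U) (Real.sqrt ((n : ℝ) / r) * twoToInf V)

/-- The smallest sampling probability. -/
def wmin {m n : ℕ} (w : Fin m × Fin n → ℝ) : ℝ := ⨅ p, w p

/-- The observation model. In round `t` the (context, arm) pair `X t` is drawn from the
distribution `w`, and the noise is `ξ t`; the pairs `(X t, ξ t)` are i.i.d., the noise is
independent of the sampled pair, and it is `σ`-subgaussian:
`E exp(a ξ) ≤ exp(σ² a² / 2)` for all real `a`. -/
structure IsSampling {Ω : Type*} [MeasurableSpace Ω] (P : Measure Ω) {m n T : ℕ}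
    (w : Fin m × Fin n → ℝ) (σ : ℝ≥0) (X : Fin T → Ω → Fin m × Fin n) (ξ : Fin T → Ω → ℝ) :
    Prop where
  measurable_X : ∀ t, Measurable (X t)
  measurable_noise : ∀ t, Measurable (ξ t)
  law_X : ∀ t p, P.real {ω | X t ω = p} = w p
  identDistrib_noise : ∀ t t', IdentDistrib (ξ t) (ξ t') P P
  subgaussian : ∀ t, HasSubgaussianMGF (ξ t) (σ ^ 2) P
  indep_noise : ∀ t, IndepFun (X t) (ξ t) P
  indep_rounds : iIndepFun (fun t ω => (X t ω, ξ t ω)) P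

/-- The importance-weighted empirical reward matrix
`M̃ i j = (T w(i,j))⁻¹ ∑_t 1{(i_t, j_t) = (i, j)} r_t`, with rewards `r_t = M (i_t) (j_t) + ξ_t`,
at fixed values `x` of the sampled pairs and `e` of the noise. -/
def empiricalReward {m n T : ℕ} (M : Matrix (Fin m) (Fin n) ℝ) (w : Fin m × Fin n → ℝ)
    (x : Fin T → Fin m × Fin n) (e : Fin T → ℝ) : Matrix (Fin m) (Fin n) ℝ :=
  Matrix.of fun i j =>
    1 / ((T : ℝ) * w (i, j)) * ∑ t, if x t = (i, j) then M (x t).1 (x t).2 + e t else 0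

end

end LowRank

open scoped Matrix.Norms.L2Operator

namespace LowRank

/-! ### Row norms, Frobenius norm and operator norm -/

section Norms

variable {ι κ l : Type*} [Fintype ι] [Fintype κ] [Fintype l]

/-! Everything takes place in the symmetric dilation H = `dil M`, a matrix of size m + n. Its
nonzero eigenvalues are ±σ_k, and the projection onto their eigenvectors is P = diag(UUᵀ, VVᵀ), so
one row-wise bound for symmetric matrices treats U and V together. The noise is E = `dil (M̃ - M)`.
A spectral projection across a gap is described by the algebraic data of `GapProj`, which determine
it (`GapProj.unique`). By exchange and dimension arguments, `IsSpectralEstimate.gapProj` shows that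
the singular vectors of any best rank-r approximation of M̃ give such a projection P' of H + E,
however ties are broken.

Perturbation of rows. Since H vanishes off P, one has exactly P' - P = P(P' - P) - P E W' + E W',
where W' inverts H + E on the range of P'. Terms led by P cost only a row norm of P, at most μ√(r/(m
∧ n)). There remains row i of E W' = (E P') W', where P' depends on row i of E. So P' is compared
with Q_i, the projection of H + E after row and column i of E are erased. Davis–Kahan, in the form
`GapProj.norm_sub_le`, controls P' - Q_i by (E - `erase i E`) Q_i, hence by row i of E Q_i and row i
of Q_i. Given entrywise concentration of row i of E Q_i, the largest of these row norms satisfies an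
inequality in which it reappears with a small coefficient; absorbing it yields
`rowNorm_sub_le_of_leaveOneOut`.

Two probabilistic inputs are needed. The first is ‖E‖ (`opNorm_noise_tail`). The summands are
unbounded, so a moment method is used: `integral_trace_pow_le` removes one summand at a time and,
through convexity of traces of even powers, bounds E tr S^(2p) by moments of the largest row or
column sum of squares, which has exponential moments. The second is row i of E Q_i
(`IsSampling.row_tail`). Row and column i of E are not independent of the rest, because the rounds
are shared. Conditionally on which rounds hit row or column i, however, their contents are
independent draws, independent of the other rounds and thus of Q_i; Bernstein's inequality applies
to the resulting linear form, and the number of such rounds concentrates.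

With ℓ the logarithm, the moment order and the Bernstein exponent are both about 8ℓ, and ε is of
order L√(ℓ(m+n)/(Tω_min)). The sample-size condition, together with rσ_r² ≤ mn‖M‖²_max, makes ε and
the Bernstein range term small against σ_r. The bound is first obtained without κ, which enters at
the end through κ ≥ 1. -/

/-- The Euclidean norm of the `i`-th row. -/
noncomputable def rowNorm (A : Matrix ι κ ℝ) (i : ι) : ℝ := √(∑ j, A i j ^ 2)

/-- The Frobenius norm. -/
noncomputable def frob (A : Matrix ι κ ℝ) : ℝ := √(∑ i, ∑ j, A i j ^ 2)

omit [Fintype ι] in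
theorem rowNorm_eq_norm (A : Matrix ι κ ℝ) (i : ι) : rowNorm A i = ‖WithLp.toLp 2 (A i)‖ := by
  simp [rowNorm, EuclideanSpace.norm_eq]

omit [Fintype ι] in
theorem rowNorm_nonneg (A : Matrix ι κ ℝ) (i : ι) : 0 ≤ rowNorm A i := Real.sqrt_nonneg _

omit [Fintype ι] in
theorem rowNorm_sq (A : Matrix ι κ ℝ) (i : ι) : rowNorm A i ^ 2 = ∑ j, A i j ^ 2 :=
  Real.sq_sqrt (Finset.sum_nonneg fun _ _ => sq_nonneg _)

theorem frob_nonneg (A : Matrix ι κ ℝ) : 0 ≤ frob A := Real.sqrt_nonneg _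

theorem frob_sq (A : Matrix ι κ ℝ) : frob A ^ 2 = ∑ i, ∑ j, A i j ^ 2 :=
  Real.sq_sqrt (Finset.sum_nonneg fun _ _ => Finset.sum_nonneg fun _ _ => sq_nonneg _)

theorem frob_sq_eq_sum_rowNorm (A : Matrix ι κ ℝ) : frob A ^ 2 = ∑ i, rowNorm A i ^ 2 := by
  simp [frob_sq, rowNorm_sq]

omit [Fintype ι] in
theorem rowNorm_add_le (A B : Matrix ι κ ℝ) (i : ι) :
    rowNorm (A + B) i ≤ rowNorm A i + rowNorm B i := by
  simp only [rowNorm_eq_norm]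
  exact norm_add_le (WithLp.toLp 2 (A i)) (WithLp.toLp 2 (B i))

omit [Fintype ι] in
theorem rowNorm_neg (A : Matrix ι κ ℝ) (i : ι) : rowNorm (-A) i = rowNorm A i := by
  simp [rowNorm]

omit [Fintype ι] in
theorem rowNorm_sub_le (A B : Matrix ι κ ℝ) (i : ι) :
    rowNorm (A - B) i ≤ rowNorm A i + rowNorm B i := by
  rw [sub_eq_add_neg, ← rowNorm_neg B]
  exact rowNorm_add_le A (-B) i

theorem l2_opNorm_transpose [DecidableEq ι] [DecidableEq κ] (A : Matrix ι κ ℝ) : ‖Aᵀ‖ = ‖A‖ := by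
  rw [← Matrix.conjTranspose_eq_transpose_of_trivial]
  exact Matrix.l2_opNorm_conjTranspose A

omit [Fintype ι] in
theorem rowNorm_mul_le [DecidableEq κ] [DecidableEq l] (A : Matrix ι κ ℝ) (B : Matrix κ l ℝ)
    (i : ι) : rowNorm (A * B) i ≤ rowNorm A i * ‖B‖ := by
  have h := Matrix.l2_opNorm_mulVec Bᵀ (WithLp.toLp 2 (A i))
  rw [l2_opNorm_transpose] at h
  rw [rowNorm_eq_norm, rowNorm_eq_norm, mul_comm]
  convert h using 3
  rw [Matrix.mulVec_transpose]
  rfl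

theorem frob_mul_le [DecidableEq κ] [DecidableEq l] (A : Matrix ι κ ℝ) (B : Matrix κ l ℝ) :
    frob (A * B) ≤ frob A * ‖B‖ := by
  refine le_of_sq_le_sq ?_ (mul_nonneg (frob_nonneg A) (norm_nonneg B))
  rw [mul_pow, frob_sq_eq_sum_rowNorm, frob_sq_eq_sum_rowNorm, Finset.sum_mul]
  refine Finset.sum_le_sum fun i _ => ?_
  rw [← mul_pow]
  exact pow_le_pow_left₀ (rowNorm_nonneg _ _) (rowNorm_mul_le A B i) 2

theorem frob_transpose (A : Matrix ι κ ℝ) : frob Aᵀ = frob A := by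
  unfold frob
  rw [Finset.sum_comm]
  rfl

theorem frob_mul_le' [DecidableEq ι] [DecidableEq κ] (A : Matrix ι κ ℝ) (B : Matrix κ l ℝ) :
    frob (A * B) ≤ ‖A‖ * frob B := by
  have h := frob_mul_le Bᵀ Aᵀ
  rwa [← Matrix.transpose_mul, frob_transpose, frob_transpose, l2_opNorm_transpose,
    mul_comm] at h

theorem norm_mulVec_sq (A : Matrix ι κ ℝ) (x : κ → ℝ) :
    ‖WithLp.toLp 2 (A *ᵥ x)‖ ^ 2 = ∑ i, (∑ j, A i j * x j) ^ 2 := by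
  simp [EuclideanSpace.norm_sq_eq, Matrix.mulVec, dotProduct]

theorem l2_opNorm_le_of_forall [DecidableEq κ] (A : Matrix ι κ ℝ) (C : ℝ) (hC : 0 ≤ C)
    (h : ∀ x : κ → ℝ, ‖WithLp.toLp 2 (A *ᵥ x)‖ ≤ C * ‖WithLp.toLp 2 x‖) : ‖A‖ ≤ C := by
  rw [Matrix.l2_opNorm_def]
  exact ContinuousLinearMap.opNorm_le_bound _ hC fun x => h x.ofLp

theorem l2_opNorm_le_frob [DecidableEq κ] (A : Matrix ι κ ℝ) : ‖A‖ ≤ frob A := by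
  refine l2_opNorm_le_of_forall A _ (frob_nonneg A) fun x => ?_
  refine le_of_sq_le_sq ?_ (mul_nonneg (frob_nonneg A) (norm_nonneg _))
  rw [norm_mulVec_sq, mul_pow, frob_sq, Finset.sum_mul]
  refine Finset.sum_le_sum fun i _ => ?_
  rw [EuclideanSpace.real_norm_sq_eq]
  exact Finset.sum_mul_sq_le_sq_mul_sq _ _ _

theorem mulVec_le_l2_opNorm [DecidableEq κ] (A : Matrix ι κ ℝ) (x : κ → ℝ) :
    ‖WithLp.toLp 2 (A *ᵥ x)‖ ≤ ‖A‖ * ‖WithLp.toLp 2 x‖ :=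
  Matrix.l2_opNorm_mulVec A (WithLp.toLp 2 x)

theorem rowNorm_le_l2_opNorm [DecidableEq ι] [DecidableEq κ] (A : Matrix ι κ ℝ) (i : ι) :
    rowNorm A i ≤ ‖A‖ := by
  have h := rowNorm_mul_le (1 : Matrix ι ι ℝ) A i
  have h1 : rowNorm (1 : Matrix ι ι ℝ) i = 1 := by
    simp [rowNorm, Matrix.one_apply]
  rwa [Matrix.one_mul, h1, one_mul] at h

end Norms

/-! ### Gapped spectral projections and their perturbation -/

section Gap

variable {ι : Type*} [Fintype ι] [DecidableEq ι]

/-- `P` is a spectral projection of the symmetric matrix `H`: the part of `H` off `P` has norm at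
most `a`, and `W` inverts `H` on the range of `P` with `b ‖W‖ ≤ 1`. -/
structure GapProj (H P W : Matrix ι ι ℝ) (a b : ℝ) : Prop where
  symm : Pᵀ = P
  idem : P * P = P
  comm : H * P = P * H
  off : ‖H * (1 - P)‖ ≤ a
  mul_inv : H * W = P
  proj_inv : P * W = W
  inv_norm : b * ‖W‖ ≤ 1

theorem norm_le_one_of_proj {P : Matrix ι ι ℝ} (hs : Pᵀ = P) (hi : P * P = P) : ‖P‖ ≤ 1 := by
  have h := Matrix.l2_opNorm_conjTranspose_mul_self P
  rw [Matrix.conjTranspose_eq_transpose_of_trivial, hs, hi] at h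
  nlinarith [norm_nonneg P]

variable {H H₁ H₂ P P₁ P₂ W W₁ W₂ E : Matrix ι ι ℝ} {a b : ℝ}

theorem GapProj.norm_le_one (h : GapProj H P W a b) : ‖P‖ ≤ 1 :=
  norm_le_one_of_proj h.symm h.idem

theorem GapProj.norm_compl_le_one (h : GapProj H P W a b) : ‖1 - P‖ ≤ 1 := by
  refine norm_le_one_of_proj (by simp [h.symm]) ?_
  rw [mul_sub, sub_mul, sub_mul, h.idem]
  simp

theorem GapProj.mono (h : GapProj H P W a b) {a' b' : ℝ} (ha : a ≤ a') (hb : b' ≤ b) :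
    GapProj H P W a' b' :=
  { h with
    off := h.off.trans ha
    inv_norm := (mul_le_mul_of_nonneg_right hb (norm_nonneg W)).trans h.inv_norm }

/-- Davis–Kahan through a Sylvester equation: X = (1 - P₁)P₂ satisfies X = H₁(1 - P₁) X W₂ - (1 -
P₁)(H₁ - H₂)P₂ W₂. The first term has norm at most a‖W₂‖‖X‖, with b‖W₂‖ ≤ 1, and moves to the
left-hand side. -/
theorem GapProj.norm_compl_mul_le (h₁ : GapProj H₁ P₁ W₁ a b) (h₂ : GapProj H₂ P₂ W₂ a b)
    (hb : 0 < b) : (b - a) * ‖(1 - P₁) * P₂‖ ≤ ‖(H₁ - H₂) * P₂‖ := by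
  have key : (1 - P₁) * P₂ =
      H₁ * (1 - P₁) * ((1 - P₁) * P₂) * W₂ - (1 - P₁) * ((H₁ - H₂) * P₂) * W₂ := by
    have e1 : H₁ * (1 - P₁) * ((1 - P₁) * P₂) * W₂ = (1 - P₁) * H₁ * W₂ := by
      have c : H₁ * (1 - P₁) = (1 - P₁) * H₁ := by rw [mul_sub, sub_mul, h₁.comm]; simp
      have d : (1 - P₁) * (1 - P₁) = 1 - P₁ := by
        rw [mul_sub, sub_mul, sub_mul, h₁.idem]; simp
      calc H₁ * (1 - P₁) * ((1 - P₁) * P₂) * W₂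
          = H₁ * ((1 - P₁) * (1 - P₁)) * (P₂ * W₂) := by simp only [Matrix.mul_assoc]
        _ = _ := by rw [d, h₂.proj_inv, c]
    have e2 : (1 - P₁) * ((H₁ - H₂) * P₂) * W₂ = (1 - P₁) * H₁ * W₂ - (1 - P₁) * P₂ := by
      calc (1 - P₁) * ((H₁ - H₂) * P₂) * W₂ = (1 - P₁) * (H₁ - H₂) * (P₂ * W₂) := by
            simp only [Matrix.mul_assoc]
        _ = (1 - P₁) * H₁ * W₂ - (1 - P₁) * (H₂ * W₂) := by
            rw [h₂.proj_inv, mul_sub, sub_mul]; simp only [Matrix.mul_assoc]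
        _ = _ := by rw [h₂.mul_inv]
    rw [e1, e2]; abel
  set X := (1 - P₁) * P₂ with hX
  have hn : ‖X‖ ≤ a * ‖X‖ * ‖W₂‖ + ‖(H₁ - H₂) * P₂‖ * ‖W₂‖ := by
    calc ‖X‖ = ‖H₁ * (1 - P₁) * X * W₂ - (1 - P₁) * ((H₁ - H₂) * P₂) * W₂‖ := by rw [← key]
      _ ≤ ‖H₁ * (1 - P₁) * X * W₂‖ + ‖(1 - P₁) * ((H₁ - H₂) * P₂) * W₂‖ := norm_sub_le _ _
      _ ≤ ‖H₁ * (1 - P₁)‖ * ‖X‖ * ‖W₂‖ + ‖1 - P₁‖ * ‖(H₁ - H₂) * P₂‖ * ‖W₂‖ := by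
          gcongr
          · exact (norm_mul_le _ _).trans (by gcongr; exact norm_mul_le _ _)
          · exact (norm_mul_le _ _).trans (by gcongr; exact norm_mul_le _ _)
      _ ≤ a * ‖X‖ * ‖W₂‖ + 1 * ‖(H₁ - H₂) * P₂‖ * ‖W₂‖ := by
          gcongr
          · exact h₁.off
          · exact h₁.norm_compl_le_one
      _ = _ := by ring
  have ha : 0 ≤ a := (norm_nonneg _).trans h₁.off
  have hW := h₂.inv_norm
  have h3 := mul_le_mul_of_nonneg_left hn hb.le
  have h4 : (a * ‖X‖ + ‖(H₁ - H₂) * P₂‖) * (b * ‖W₂‖) ≤ (a * ‖X‖ + ‖(H₁ - H₂) * P₂‖) * 1 := by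
    gcongr
  nlinarith

/-- The difference P₁ - P₂ splits into the two off-diagonal pieces (1 - P₂)P₁ and (1 - P₁)P₂. One of
their bounds involves (H₂ - H₁)P₁; passing to P₂ there costs at most half of the left-hand side.
Keeping the factor P₂ on the right, instead of ‖H₁ - H₂‖, is what makes leave-one-out comparisons
sharp. -/
theorem GapProj.norm_sub_le (h₁ : GapProj H₁ P₁ W₁ a b) (h₂ : GapProj H₂ P₂ W₂ a b)
    (hab : a < b) (hΔ : ‖H₁ - H₂‖ ≤ (b - a) / 2) :
    (b - a) * ‖P₁ - P₂‖ ≤ 4 * ‖(H₁ - H₂) * P₂‖ := by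
  have ha : 0 ≤ a := (norm_nonneg _).trans h₁.off
  have hb : 0 < b := ha.trans_lt hab
  have k1 := h₁.norm_compl_mul_le h₂ hb
  have k2 := h₂.norm_compl_mul_le h₁ hb
  have e : P₁ - P₂ = ((1 - P₂) * P₁)ᵀ - (1 - P₁) * P₂ := by
    rw [Matrix.transpose_mul, Matrix.transpose_sub, h₁.symm, h₂.symm]
    simp only [Matrix.transpose_one, mul_sub, sub_mul, mul_one, one_mul]
    abel
  have t1 : ‖P₁ - P₂‖ ≤ ‖(1 - P₂) * P₁‖ + ‖(1 - P₁) * P₂‖ := by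
    rw [e]
    refine (_root_.norm_sub_le _ _).trans ?_
    rw [l2_opNorm_transpose]
  have t2 : ‖(H₂ - H₁) * P₁‖ ≤ ‖(H₁ - H₂) * P₂‖ + (b - a) / 2 * ‖P₁ - P₂‖ := by
    have e' : (H₂ - H₁) * P₁ = -((H₁ - H₂) * P₂) - (H₁ - H₂) * (P₁ - P₂) := by
      simp only [mul_sub, sub_mul]; abel
    rw [e']
    refine (_root_.norm_sub_le _ _).trans ?_
    rw [norm_neg]
    gcongr
    exact (norm_mul_le _ _).trans (by gcongr)
  have h5 := mul_le_mul_of_nonneg_left t1 (sub_pos.2 hab).le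
  nlinarith

theorem GapProj.unique (h₁ : GapProj H P₁ W₁ a b) (h₂ : GapProj H P₂ W₂ a b) (hab : a < b) :
    P₁ = P₂ := by
  have h := h₁.norm_sub_le h₂ hab (by simp; linarith)
  simp only [sub_self, zero_mul, norm_zero, mul_zero] at h
  have : ‖P₁ - P₂‖ ≤ 0 := by
    by_contra hc
    have := mul_pos (sub_pos.2 hab) (not_le.1 hc)
    linarith
  exact sub_eq_zero.1 (norm_le_zero_iff.1 this)

/-- Exact expansion of the perturbation of a spectral projection of a matrix supported on `P`. -/
theorem GapProj.sub_eq (h : GapProj H P W 0 b) {P' W' : Matrix ι ι ℝ} {a' b' : ℝ}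
    (h' : GapProj (H + E) P' W' a' b') :
    P' - P = P * (P' - P) - P * (E * W') + E * W' := by
  have hH : H = P * H := by
    have := norm_le_zero_iff.1 h.off
    rw [mul_sub, mul_one, h.comm, sub_eq_zero] at this
    exact this
  have e1 : P' = H * W' + E * W' := by rw [← h'.mul_inv, add_mul]
  have e2 : H * W' = P * (P' - E * W') := by
    rw [← eq_sub_of_add_eq e1.symm, ← Matrix.mul_assoc, ← hH]
  rw [mul_sub, h.idem]
  calc P' - P = (H * W' + E * W') - P := by rw [← e1]
    _ = _ := by rw [e2, mul_sub]; abel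

/-- The matrix obtained by erasing row and column `i`. -/
def erase (i : ι) (E : Matrix ι ι ℝ) : Matrix ι ι ℝ :=
  Matrix.diagonal (fun j => if j = i then 0 else 1) * E *
    Matrix.diagonal (fun j => if j = i then 0 else 1)

omit [Fintype ι] in
theorem sum_ite_row {κ : Type*} [Fintype ι] [Fintype κ] (A : Matrix ι κ ℝ) (i : ι) :
    frob (Matrix.diagonal (fun j => if j = i then (1 : ℝ) else 0) * A) = rowNorm A i := by
  unfold frob rowNorm
  congr 1
  rw [Finset.sum_eq_single i]
  · simp
  · intro j _ hj
    simp [hj]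
  · simp

theorem norm_diag_erase_le (i : ι) :
    ‖(Matrix.diagonal (fun j => if j = i then (0 : ℝ) else 1) : Matrix ι ι ℝ)‖ ≤ 1 := by
  rw [Matrix.l2_opNorm_diagonal, pi_norm_le_iff_of_nonneg zero_le_one]
  intro j
  split_ifs <;> simp

theorem norm_erase_le (i : ι) (E : Matrix ι ι ℝ) : ‖erase i E‖ ≤ ‖E‖ := by
  have h := norm_diag_erase_le i
  calc ‖erase i E‖ ≤ _ * ‖E‖ * _ := (norm_mul_le _ _).trans (by gcongr; exact norm_mul_le _ _)
    _ ≤ 1 * ‖E‖ * 1 := by gcongr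
    _ = ‖E‖ := by ring

omit [Fintype ι] in
theorem diag_erase_add (i : ι) : (1 : Matrix ι ι ℝ) =
    Matrix.diagonal (fun j => if j = i then (0 : ℝ) else 1) +
      Matrix.diagonal (fun j => if j = i then (1 : ℝ) else 0) := by
  rw [Matrix.diagonal_add, ← Matrix.diagonal_one]
  congr 1
  funext j
  split_ifs <;> simp

/-- The part of `E` in row and column `i`, applied to `Q`. -/
theorem norm_sub_erase_mul_le (i : ι) (E Q : Matrix ι ι ℝ) :
    ‖(E - erase i E) * Q‖ ≤ rowNorm (E * Q) i + ‖E‖ * rowNorm Q i := by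
  set K : Matrix ι ι ℝ := Matrix.diagonal (fun j => if j = i then (0 : ℝ) else 1) with hK
  set D : Matrix ι ι ℝ := Matrix.diagonal (fun j => if j = i then (1 : ℝ) else 0) with hD
  have h1 : (1 : Matrix ι ι ℝ) = K + D := diag_erase_add i
  have e : (E - erase i E) * Q = D * (E * Q) + K * E * (D * Q) := by
    have : E - K * E * K = D * E + K * E * D := by
      have h2 : D = 1 - K := by rw [h1]; abel
      rw [h2]
      simp only [mul_sub, sub_mul, one_mul, mul_one]; abel
    unfold erase
    rw [← hK, this, add_mul]
    simp only [Matrix.mul_assoc]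
  rw [e]
  refine (norm_add_le _ _).trans (add_le_add ?_ ?_)
  · exact (l2_opNorm_le_frob _).trans (sum_ite_row _ i).le
  · calc ‖K * E * (D * Q)‖ ≤ ‖K‖ * ‖E‖ * ‖D * Q‖ :=
        (norm_mul_le _ _).trans (by gcongr; exact norm_mul_le _ _)
      _ ≤ 1 * ‖E‖ * rowNorm Q i := by
        gcongr
        · exact norm_diag_erase_le i
        · exact (l2_opNorm_le_frob _).trans (sum_ite_row _ i).le
      _ = _ := by ring

theorem rowNorm_erase_mul (i : ι) (E Q : Matrix ι ι ℝ) : rowNorm (erase i E * Q) i = 0 := by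
  have : ∀ j, (erase i E * Q) i j = 0 := by
    intro j
    simp [erase, Matrix.mul_apply, Matrix.diagonal_apply]
  simp [rowNorm, this]

end Gap

end LowRank

namespace LowRank

/-! ### Row-wise perturbation by leave-one-out -/

section LeaveOneOut

variable {ι : Type*} [Fintype ι] [DecidableEq ι]

/-- In the exact expansion, every term with P on the left has its i-th row controlled by that of P;
only E W' needs row information about the noise. -/
theorem GapProj.rowNorm_sub_le {H P W E P' W' : Matrix ι ι ℝ} {a' b b' : ℝ}
    (h : GapProj H P W 0 b) (h' : GapProj (H + E) P' W' a' b') (i : ι) :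
    rowNorm (P' - P) i ≤ rowNorm P i * (‖P' - P‖ + ‖E‖ * ‖W'‖) + rowNorm (E * W') i := by
  calc rowNorm (P' - P) i = rowNorm (P * (P' - P) - P * (E * W') + E * W') i := by
        rw [← h.sub_eq h']
    _ ≤ rowNorm (P * (P' - P)) i + rowNorm (P * (E * W')) i + rowNorm (E * W') i :=
        (rowNorm_add_le _ _ i).trans (by gcongr; exact LowRank.rowNorm_sub_le _ _ i)
    _ ≤ rowNorm P i * ‖P' - P‖ + rowNorm P i * (‖E‖ * ‖W'‖) + rowNorm (E * W') i := by
        gcongr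
        · exact rowNorm_mul_le _ _ _
        · refine (rowNorm_mul_le _ _ _).trans ?_
          have := rowNorm_nonneg P i
          gcongr
          exact norm_mul_le _ _
    _ = _ := by ring

omit [DecidableEq ι] in
-- Cauchy–Schwarz applied to P = P Pᵀ. It turns a uniform bound on the rows of a projection into an
-- entry bound proportional to a row norm.
theorem abs_proj_entry_le {P : Matrix ι ι ℝ} (hs : Pᵀ = P) (hi : P * P = P) (j k : ι) :
    |P j k| ≤ rowNorm P j * rowNorm P k := by
  have e : P j k = ∑ l, P j l * P k l := by
    conv_lhs => rw [← hi]
    rw [Matrix.mul_apply]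
    refine Finset.sum_congr rfl fun l _ => ?_
    conv_lhs => rw [← hs]
    rw [Matrix.transpose_apply, ← Matrix.transpose_apply P l k, hs]
    congr 1
    conv_rhs => rw [← hs]
    rfl
  rw [e]
  refine abs_le_of_sq_le_sq ?_ (mul_nonneg (rowNorm_nonneg _ _) (rowNorm_nonneg _ _))
  rw [mul_pow, rowNorm_sq, rowNorm_sq]
  exact Finset.sum_mul_sq_le_sq_mul_sq _ _ _

/-- Replaces stability of the rank: in Q = PQ + (Q - P)Q the second term is at most half of the
left-hand side in Frobenius norm. -/
theorem frob_le_of_norm_sub_le {P Q : Matrix ι ι ℝ} (hQ : ‖Q‖ ≤ 1) (hQi : Q * Q = Q)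
    (h : ‖Q - P‖ ≤ 1 / 2) : frob Q ≤ 2 * frob P := by
  have hadd : frob Q ≤ frob (P * Q) + frob ((Q - P) * Q) := by
    have e : Q = P * Q + (Q - P) * Q := by rw [sub_mul, hQi]; abel
    have htri : ∀ A B : Matrix ι ι ℝ, frob (A + B) ≤ frob A + frob B := by
      intro A B
      have hn : ∀ C : Matrix ι ι ℝ,
          frob C = ‖WithLp.toLp 2 (fun p : ι × ι => C p.1 p.2)‖ := by
        intro C
        simp [frob, EuclideanSpace.norm_eq, Fintype.sum_prod_type]
      simp only [hn]
      exact norm_add_le (WithLp.toLp 2 (fun p : ι × ι => A p.1 p.2))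
        (WithLp.toLp 2 (fun p : ι × ι => B p.1 p.2))
    calc frob Q = frob (P * Q + (Q - P) * Q) := by rw [← e]
      _ ≤ _ := htri _ _
  have h1 : frob (P * Q) ≤ frob P := by
    refine (frob_mul_le P Q).trans ?_
    nlinarith [frob_nonneg P]
  have h2 : frob ((Q - P) * Q) ≤ 1 / 2 * frob Q := by
    refine (frob_mul_le' _ _).trans ?_
    nlinarith [frob_nonneg Q]
  linarith

/-- Leave-one-out bound for the rows of a perturbed spectral projection. The leave-one-out
projections `Q i` enter through the hypothesis `hconc` on row `i` of `E * Q i`. -/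
theorem rowNorm_sub_le_of_leaveOneOut {H E P W P' W' : Matrix ι ι ℝ} {Q R : ι → Matrix ι ι ℝ}
    {σ ε α β p : ℝ} (hσ : 0 < σ) (hεσ : 20 * ε ≤ σ) (hα : 0 ≤ α) (hβ : 0 ≤ β)
    (hE : ‖E‖ ≤ ε) (h : GapProj H P W 0 σ) (h' : GapProj (H + E) P' W' ε (σ - ε))
    (hQ : ∀ i, GapProj (H + erase i E) (Q i) (R i) ε (σ - ε))
    (hp : ∀ i, rowNorm P i ≤ p)
    (hconc : ∀ i k, ∀ B, (∀ j, |Q i j k| ≤ B) → |(E * Q i) i k| ≤ α * rowNorm (Q i) k + β * B)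
    (hβσ : 28 * frob P * β ≤ σ) (i : ι) :
    rowNorm (P' - P) i ≤ (7 * ε * p + 8 * frob P * (α + 2 * β * p)) / σ := by
  have hε : 0 ≤ ε := (norm_nonneg E).trans hE
  have hb : 0 < σ - ε := by linarith
  have hgap : ε < σ - ε := by linarith
  have hP := h.mono hε (by linarith : σ - ε ≤ σ)
  have hρ := rowNorm_nonneg P
  have hp0 : 0 ≤ p := (hρ i).trans (hp i)
  -- the inverses
  have hinv : ∀ {w : ℝ}, (σ - ε) * w ≤ 1 → 0 ≤ w → σ * w ≤ 20 / 19 := by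
    intro w hw hw0
    nlinarith
  have hW' := hinv h'.inv_norm (norm_nonneg _)
  have hR := fun j => hinv (hQ j).inv_norm (norm_nonneg _)
  -- closeness to `P`
  have hcl : ∀ {E' P'' W'' : Matrix ι ι ℝ}, ‖E'‖ ≤ ε → GapProj (H + E') P'' W'' ε (σ - ε) →
      σ * ‖P'' - P‖ ≤ 40 / 9 * ε := by
    intro E' P'' W'' hE' hg
    -- The gap from ε to σ - ε has width at least 9σ/10, hence the factor 4 · 10/9.
    have k := hg.norm_sub_le hP hgap (by rw [add_sub_cancel_left]; linarith)
    rw [add_sub_cancel_left] at k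
    have k2 : ‖E' * P‖ ≤ ε := (norm_mul_le _ _).trans
      (by nlinarith [norm_nonneg E', norm_nonneg P, h.norm_le_one])
    nlinarith [norm_nonneg (P'' - P)]
  have hEi : ∀ j, ‖erase j E‖ ≤ ε := fun j => (norm_erase_le j E).trans hE
  have hclP' := hcl hE h'
  have hclQ := fun j => hcl (hEi j) (hQ j)
  -- row `j` of `Q j`
  have hQrow : ∀ j, rowNorm (Q j) j ≤ 2 * rowNorm P j := by
    intro j
    have k := h.rowNorm_sub_le (hQ j) j
    -- Row j of the erased noise is zero, so the expansion has no noise term and row j of Q j is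
    -- compared with row j of P alone.
    rw [rowNorm_erase_mul, add_zero] at k
    have k2 : rowNorm (Q j) j ≤ rowNorm (Q j - P) j + rowNorm P j := by
      have := rowNorm_add_le (Q j - P) P j
      rwa [sub_add_cancel] at this
    have k3 : ‖Q j - P‖ + ‖erase j E‖ * ‖R j‖ ≤ 1 := by
      have c1 := hclQ j
      have c2 := hR j
      have c3 : ‖erase j E‖ * ‖R j‖ ≤ ε * ‖R j‖ := by gcongr; exact hEi j
      have c4 : 0 ≤ ‖R j‖ := norm_nonneg _
      have c5 : ε * ‖R j‖ ≤ 1 / 19 := by nlinarith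
      have c6 : ‖Q j - P‖ ≤ 2 / 9 := by nlinarith
      linarith
    nlinarith [hρ j]
  set x : ι → ℝ := fun j => rowNorm (E * Q j) j with hx
  have hx0 : ∀ j, 0 ≤ x j := fun j => rowNorm_nonneg _ _
  -- Davis–Kahan with Q j on the right: the erased part of E meets Q j only through row j of E * Q j
  -- and row j of Q j, so the bound involves x j rather than ‖E‖ alone.
  have hPQ : ∀ j, σ * ‖P' - Q j‖ ≤ 5 * (x j + 2 * ε * rowNorm P j) := by
    intro j
    have k := h'.norm_sub_le (hQ j) hgap (by
      rw [add_sub_add_left_eq_sub]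
      have := _root_.norm_sub_le E (erase j E)
      have := hEi j
      linarith)
    rw [add_sub_add_left_eq_sub] at k
    have k2 := norm_sub_erase_mul_le j E (Q j)
    have k3 : ‖E‖ * rowNorm (Q j) j ≤ ε * (2 * rowNorm P j) :=
      mul_le_mul hE (hQrow j) (rowNorm_nonneg _ _) hε
    have k4 : ‖(E - erase j E) * Q j‖ ≤ x j + 2 * ε * rowNorm P j := by
      simp only [hx]; linarith
    have := norm_nonneg (P' - Q j)
    nlinarith
  have hrow : ∀ j, rowNorm (P' - P) j * σ ≤ 7 * ε * rowNorm P j + 2 * x j := by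
    intro j
    have k := h.rowNorm_sub_le h' j
    have k1 : rowNorm (E * P') j ≤ x j + ε * ‖P' - Q j‖ := by
      have e : E * P' = E * Q j + E * (P' - Q j) := by rw [mul_sub]; abel
      rw [e]
      refine (rowNorm_add_le _ _ j).trans ?_
      gcongr
      refine (rowNorm_mul_le _ _ _).trans ?_
      gcongr
      exact (rowNorm_le_l2_opNorm _ _).trans hE
    have k2 : rowNorm (E * W') j ≤ rowNorm (E * P') j * ‖W'‖ := by
      conv_lhs => rw [← h'.proj_inv, ← Matrix.mul_assoc]
      exact rowNorm_mul_le _ _ _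
    have k3 : ε * ‖P' - Q j‖ ≤ (x j + 2 * ε * rowNorm P j) / 4 := by
      have := hPQ j
      have := norm_nonneg (P' - Q j)
      nlinarith
    have k4 : rowNorm (E * P') j ≤ 5 / 4 * x j + 1 / 2 * ε * rowNorm P j := by linarith
    have k5 : rowNorm (E * W') j * σ ≤ (5 / 4 * x j + 1 / 2 * ε * rowNorm P j) * (20 / 19) := by
      calc rowNorm (E * W') j * σ ≤ (rowNorm (E * P') j * ‖W'‖) * σ := by gcongr
        _ = rowNorm (E * P') j * (σ * ‖W'‖) := by ring
        _ ≤ _ := by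
          gcongr
          exact (rowNorm_nonneg _ _).trans k4
    have k6 : σ * (‖P' - P‖ + ‖E‖ * ‖W'‖) ≤ 40 / 9 * ε + ε * (20 / 19) := by
      have : σ * (‖E‖ * ‖W'‖) ≤ ε * (20 / 19) := by
        calc σ * (‖E‖ * ‖W'‖) = ‖E‖ * (σ * ‖W'‖) := by ring
          _ ≤ _ := by gcongr
      linarith
    have k7 := mul_le_mul_of_nonneg_left k6 (hρ j)
    have k8 := mul_le_mul_of_nonneg_right k hσ.le
    have k9 : 0 ≤ ε * rowNorm P j := mul_nonneg hε (hρ j)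
    have := hx0 j
    nlinarith
  -- the largest `x j`
  obtain ⟨j₀, -, hj₀⟩ := Finset.exists_max_image Finset.univ x ⟨i, Finset.mem_univ i⟩
  have hmax : ∀ j, x j ≤ x j₀ := fun j => hj₀ j (Finset.mem_univ j)
  -- All rows of all Q j, through Q j = P + (P' - P) - (P' - Q j). The unknown largest x j enters
  -- here and is absorbed below.
  have hQall : ∀ j l, σ * rowNorm (Q j) l ≤ σ * (2 * p) + 7 * x j₀ := by
    intro j l
    have k1 : rowNorm (Q j) l ≤ rowNorm P l + rowNorm (P' - P) l + ‖P' - Q j‖ := by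
      have e : Q j = P + (P' - P) - (P' - Q j) := by abel
      calc rowNorm (Q j) l = rowNorm (P + (P' - P) - (P' - Q j)) l := by rw [← e]
        _ ≤ rowNorm P l + rowNorm (P' - P) l + rowNorm (P' - Q j) l :=
          (LowRank.rowNorm_sub_le _ _ l).trans (by gcongr; exact rowNorm_add_le _ _ l)
        _ ≤ _ := by gcongr; exact rowNorm_le_l2_opNorm _ _
    have k2 := hrow l
    have k3 := hPQ j
    have k4 := mul_le_mul_of_nonneg_left k1 hσ.le
    have k5 : ε * rowNorm P l ≤ ε * p := by gcongr; exact hp l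
    have k6 : ε * rowNorm P j ≤ ε * p := by gcongr; exact hp j
    have k7 : σ * rowNorm P l ≤ σ * p := by gcongr; exact hp l
    have k8 : 20 * (ε * p) ≤ σ * p := by nlinarith
    have := hmax l
    have := hmax j
    nlinarith
  have hxb : σ * x j₀ ≤ 2 * frob P * (σ * α + β * (σ * (2 * p) + 7 * x j₀)) := by
    -- A common bound for the rows of Q j₀. By `abs_proj_entry_le` the entries of column k are at
    -- most q times the row norm k, so the concentration bound becomes proportional to row norms and
    -- sums to the Frobenius norm.
    set q : ℝ := (σ * (2 * p) + 7 * x j₀) / σ with hq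
    have hqσ : σ * q = σ * (2 * p) + 7 * x j₀ := by rw [hq]; field_simp
    have hq0 : 0 ≤ q := div_nonneg (by have := hx0 j₀; positivity) hσ.le
    have hQq : ∀ l, rowNorm (Q j₀) l ≤ q := fun l => by
      rw [hq, le_div_iff₀ hσ, mul_comm]; exact hQall j₀ l
    have c1 : ∀ k, |(E * Q j₀) j₀ k| ≤ (α + β * q) * rowNorm (Q j₀) k := by
      intro k
      have := hconc j₀ k (q * rowNorm (Q j₀) k) (fun j =>
        (abs_proj_entry_le (hQ j₀).symm (hQ j₀).idem j k).trans
          (by gcongr; exacts [rowNorm_nonneg _ _, hQq j]))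
      linarith
    have c2 : x j₀ ≤ (α + β * q) * frob (Q j₀) := by
      refine Real.sqrt_le_iff.2 ⟨by have := frob_nonneg (Q j₀); positivity, ?_⟩
      rw [mul_pow, frob_sq_eq_sum_rowNorm, Finset.mul_sum]
      refine Finset.sum_le_sum fun k _ => ?_
      rw [← mul_pow, ← sq_abs]
      exact pow_le_pow_left₀ (abs_nonneg _) (c1 k) 2
    have c3 : frob (Q j₀) ≤ 2 * frob P := by
      refine frob_le_of_norm_sub_le (hQ j₀).norm_le_one (hQ j₀).idem ?_
      have := hclQ j₀
      nlinarith [norm_nonneg (Q j₀ - P)]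
    have c4 : x j₀ ≤ (α + β * q) * (2 * frob P) := c2.trans (by gcongr)
    calc σ * x j₀ ≤ σ * ((α + β * q) * (2 * frob P)) := by gcongr
      _ = 2 * frob P * (σ * α + β * (σ * q)) := by ring
      _ = _ := by rw [hqσ]
  -- The self-referring term is 14 * frob P * β * x j₀, at most σ * x j₀ / 2 by the hypothesis on β.
  have hxf : x j₀ ≤ 4 * frob P * (α + 2 * β * p) := by
    have c1 : 28 * frob P * β * x j₀ ≤ σ * x j₀ := by gcongr; exact hx0 j₀
    have c2 : σ * x j₀ ≤ σ * (4 * frob P * (α + 2 * β * p)) := by nlinarith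
    exact le_of_mul_le_mul_left c2 hσ
  rw [le_div_iff₀ hσ]
  have k1 := hrow i
  have k2 : ε * rowNorm P i ≤ ε * p := by gcongr; exact hp i
  have := hmax i
  linarith

end LeaveOneOut

end LowRank

namespace LowRank

/-! ### Existence of gapped projections after perturbation -/

section Spectral

variable {ι κ : Type*} [Fintype ι] [Fintype κ]

theorem norm_toLp_sq (v : ι → ℝ) : ‖WithLp.toLp 2 v‖ ^ 2 = v ⬝ᵥ v := by
  rw [EuclideanSpace.real_norm_sq_eq]
  simp [dotProduct, sq]

theorem norm_toLp_mulVec_sq (A : Matrix ι κ ℝ) (v : κ → ℝ) :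
    ‖WithLp.toLp 2 (A *ᵥ v)‖ ^ 2 = v ⬝ᵥ (Aᵀ * A) *ᵥ v := by
  rw [norm_toLp_sq, ← Matrix.mulVec_mulVec, Matrix.dotProduct_mulVec v, Matrix.vecMul_transpose]

theorem norm_toLp_mulVec_of_orthonormal [DecidableEq κ] {A : Matrix ι κ ℝ} (hA : Aᵀ * A = 1)
    (v : κ → ℝ) : ‖WithLp.toLp 2 (A *ᵥ v)‖ = ‖WithLp.toLp 2 v‖ := by
  rw [← sq_eq_sq₀ (norm_nonneg _) (norm_nonneg _), norm_toLp_mulVec_sq, hA, Matrix.one_mulVec,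
    norm_toLp_sq]

theorem norm_le_one_of_orthonormal [DecidableEq κ] {A : Matrix ι κ ℝ} (hA : Aᵀ * A = 1) :
    ‖A‖ ≤ 1 :=
  l2_opNorm_le_of_forall A 1 zero_le_one fun x => by
    rw [norm_toLp_mulVec_of_orthonormal hA, one_mul]

variable [DecidableEq ι]

theorem exists_orthogonal_diagonalization {S : Matrix ι ι ℝ} (hS : Sᵀ = S) :
    ∃ (O : Matrix ι ι ℝ) (d : ι → ℝ), Oᵀ * O = 1 ∧ O * Oᵀ = 1 ∧
      S = O * Matrix.diagonal d * Oᵀ := by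
  have hH : S.IsHermitian := by
    rw [Matrix.IsHermitian, Matrix.conjTranspose_eq_transpose_of_trivial, hS]
  have hu := (Matrix.mem_unitaryGroup_iff'.1 hH.eigenvectorUnitary.2)
  have hu' := (Matrix.mem_unitaryGroup_iff.1 hH.eigenvectorUnitary.2)
  rw [Matrix.star_eq_conjTranspose, Matrix.conjTranspose_eq_transpose_of_trivial] at hu hu'
  refine ⟨hH.eigenvectorUnitary, hH.eigenvalues, hu, hu', ?_⟩
  have := hH.spectral_theorem
  rw [Unitary.conjStarAlgAut_apply] at this
  simpa [Matrix.star_eq_conjTranspose, Matrix.conjTranspose_eq_transpose_of_trivial,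
    Function.comp_def] using this

theorem norm_sq_proj_add {P : Matrix ι ι ℝ} (hs : Pᵀ = P) (hi : P * P = P) (v : ι → ℝ) :
    ‖WithLp.toLp 2 (P *ᵥ v)‖ ^ 2 + ‖WithLp.toLp 2 ((1 - P) *ᵥ v)‖ ^ 2 =
      ‖WithLp.toLp 2 v‖ ^ 2 := by
  rw [norm_toLp_mulVec_sq, norm_toLp_mulVec_sq, norm_toLp_sq, ← dotProduct_add,
    ← Matrix.add_mulVec, hs, hi]
  have : (1 - P)ᵀ * (1 - P) = 1 - P := by
    rw [Matrix.transpose_sub, hs, Matrix.transpose_one, mul_sub, sub_mul, sub_mul, hi]; simp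
  rw [this, add_sub_cancel, Matrix.one_mulVec]

/-- Eigenvalues of a perturbation of a gapped symmetric matrix avoid the gap. -/
theorem GapProj.eigenvalue_gap {H P W E : Matrix ι ι ℝ} {σ ε lam : ℝ} (hσ : 0 < σ)
    (hH : Hᵀ = H) (h : GapProj H P W 0 σ)
    (hE : ‖E‖ ≤ ε) {x : ι → ℝ} (hx : ‖WithLp.toLp 2 x‖ = 1)
    (hlam : (H + E) *ᵥ x = lam • x) : |lam| ≤ ε ∨ σ - ε ≤ |lam| := by
  by_contra hcon
  push Not at hcon
  obtain ⟨h1, h2⟩ := hcon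
  have hε : 0 ≤ ε := (norm_nonneg E).trans hE
  have hHP : H = H * P := by
    have := norm_le_zero_iff.1 h.off
    rw [mul_sub, mul_one, sub_eq_zero] at this
    exact this
  have hEx : E *ᵥ x = lam • x - H *ᵥ x := by
    rw [← hlam, Matrix.add_mulVec, add_sub_cancel_left]
  -- The eigenvalue equation is split along P. Off P the matrix H vanishes, so E x has component of
  -- length |lam| ‖(1 - P)x‖; on P it stretches by at least σ, so E x has component at least (σ -
  -- |lam|) ‖Px‖. If both factors exceeded ε, Pythagoras would give ‖E x‖ > ε.
  have hz : (1 - P) *ᵥ (E *ᵥ x) = lam • ((1 - P) *ᵥ x) := by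
    rw [hEx, Matrix.mulVec_sub, Matrix.mulVec_smul, Matrix.mulVec_mulVec]
    have : (1 - P) * H = 0 := by
      rw [sub_mul, one_mul, ← h.comm, ← hHP, sub_self]
    rw [this, Matrix.zero_mulVec, sub_zero]
  have hy : P *ᵥ (E *ᵥ x) = lam • (P *ᵥ x) - H *ᵥ (P *ᵥ x) := by
    rw [hEx, Matrix.mulVec_sub, Matrix.mulVec_smul, Matrix.mulVec_mulVec, Matrix.mulVec_mulVec,
      h.comm]
  have hWH : Wᵀ * H = P := by
    have := congrArg Matrix.transpose h.mul_inv
    rwa [Matrix.transpose_mul, hH, h.symm] at this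
  have hlow : σ * ‖WithLp.toLp 2 (P *ᵥ x)‖ ≤ ‖WithLp.toLp 2 (H *ᵥ (P *ᵥ x))‖ := by
    have e : P *ᵥ x = Wᵀ *ᵥ (H *ᵥ (P *ᵥ x)) := by
      rw [Matrix.mulVec_mulVec, Matrix.mulVec_mulVec, hWH, h.idem]
    have k := mulVec_le_l2_opNorm Wᵀ (H *ᵥ (P *ᵥ x))
    rw [← e, l2_opNorm_transpose] at k
    have := h.inv_norm
    have hn := norm_nonneg (WithLp.toLp 2 (H *ᵥ (P *ᵥ x)))
    nlinarith
  have ny : (σ - |lam|) * ‖WithLp.toLp 2 (P *ᵥ x)‖ ≤ ‖WithLp.toLp 2 (P *ᵥ (E *ᵥ x))‖ := by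
    rw [hy]
    have := norm_sub_norm_le (WithLp.toLp 2 (H *ᵥ (P *ᵥ x))) (lam • WithLp.toLp 2 (P *ᵥ x))
    rw [norm_sub_rev, norm_smul, Real.norm_eq_abs] at this
    have e : WithLp.toLp 2 (lam • (P *ᵥ x) - H *ᵥ (P *ᵥ x)) =
      lam • WithLp.toLp 2 (P *ᵥ x) - WithLp.toLp 2 (H *ᵥ (P *ᵥ x)) := rfl
    rw [e]
    linarith
  have nz : |lam| * ‖WithLp.toLp 2 ((1 - P) *ᵥ x)‖ = ‖WithLp.toLp 2 ((1 - P) *ᵥ (E *ᵥ x))‖ := by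
    rw [hz, WithLp.toLp_smul, norm_smul, Real.norm_eq_abs]
  have p1 := norm_sq_proj_add h.symm h.idem x
  have p2 := norm_sq_proj_add h.symm h.idem (E *ᵥ x)
  have p3 : ‖WithLp.toLp 2 (E *ᵥ x)‖ ≤ ε := by
    have := mulVec_le_l2_opNorm E x
    rw [hx] at this
    linarith
  rw [← nz] at p2
  rw [hx] at p1
  set Y := ‖WithLp.toLp 2 (P *ᵥ x)‖
  set Z := ‖WithLp.toLp 2 ((1 - P) *ᵥ x)‖
  have q1 : ((σ - |lam|) * Y) ^ 2 ≤ ‖WithLp.toLp 2 (P *ᵥ (E *ᵥ x))‖ ^ 2 :=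
    pow_le_pow_left₀ (mul_nonneg (by linarith) (norm_nonneg _)) ny 2
  have q2 : ‖WithLp.toLp 2 (E *ᵥ x)‖ ^ 2 ≤ ε ^ 2 := pow_le_pow_left₀ (norm_nonneg _) p3 2
  have m1 : ε ^ 2 < (σ - |lam|) ^ 2 := by nlinarith
  have m2 : ε ^ 2 < |lam| ^ 2 := by nlinarith
  set A := (σ - |lam|) ^ 2
  set B := |lam| ^ 2
  rw [mul_pow] at q1 p2
  have hY : 0 ≤ Y ^ 2 := sq_nonneg _
  have hZ : 0 ≤ Z ^ 2 := sq_nonneg _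
  have hc : min A B * (Y ^ 2 + Z ^ 2) ≤ A * Y ^ 2 + B * Z ^ 2 := by
    rw [mul_add]
    gcongr
    · exact min_le_left _ _
    · exact min_le_right _ _
  have hmin : ε ^ 2 < min A B := lt_min m1 m2
  rw [p1] at hc
  linarith

theorem norm_conj_diagonal_le {O : Matrix ι ι ℝ} (hO : Oᵀ * O = 1) (d : ι → ℝ) {C : ℝ}
    (hC : 0 ≤ C) (hd : ∀ k, |d k| ≤ C) : ‖O * Matrix.diagonal d * Oᵀ‖ ≤ C := by
  have h1 := norm_le_one_of_orthonormal hO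
  have h2 : ‖Oᵀ‖ ≤ 1 := by rwa [l2_opNorm_transpose]
  have h3 : ‖(Matrix.diagonal d : Matrix ι ι ℝ)‖ ≤ C := by
    rw [Matrix.l2_opNorm_diagonal, pi_norm_le_iff_of_nonneg hC]
    exact hd
  calc ‖O * Matrix.diagonal d * Oᵀ‖ ≤ ‖O‖ * ‖(Matrix.diagonal d : Matrix ι ι ℝ)‖ * ‖Oᵀ‖ :=
        (norm_mul_le _ _).trans (by gcongr; exact norm_mul_le _ _)
    _ ≤ 1 * C * 1 := by gcongr
    _ = C := by ring

theorem conj_diagonal_mul {O : Matrix ι ι ℝ} (hO : Oᵀ * O = 1) (d e : ι → ℝ) :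
    O * Matrix.diagonal d * Oᵀ * (O * Matrix.diagonal e * Oᵀ) =
      O * Matrix.diagonal (fun k => d k * e k) * Oᵀ := by
  calc O * Matrix.diagonal d * Oᵀ * (O * Matrix.diagonal e * Oᵀ)
      = O * Matrix.diagonal d * (Oᵀ * O) * Matrix.diagonal e * Oᵀ := by
        simp only [Matrix.mul_assoc]
    _ = _ := by rw [hO, mul_one, Matrix.mul_assoc O, Matrix.diagonal_mul_diagonal]

/-- Functional calculus in an eigenbasis of H + E: Q is the indicator of |λ| > ε and R is 1/λ there.
By `GapProj.eigenvalue_gap`, the eigenvalues kept have modulus at least σ - ε. -/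
theorem GapProj.exists_of_perturbation {H P W E : Matrix ι ι ℝ} {σ ε : ℝ} (hσ : 2 * ε < σ)
    (hH : Hᵀ = H) (hEs : Eᵀ = E) (h : GapProj H P W 0 σ) (hE : ‖E‖ ≤ ε) :
    ∃ Q R, GapProj (H + E) Q R ε (σ - ε) := by
  have hε : 0 ≤ ε := (norm_nonneg E).trans hE
  obtain ⟨O, d, hO, hO', hS⟩ := exists_orthogonal_diagonalization
    (S := H + E) (by rw [Matrix.transpose_add, hH, hEs])
  have hgap : ∀ k, |d k| ≤ ε ∨ σ - ε ≤ |d k| := by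
    intro k
    refine h.eigenvalue_gap (by linarith) hH hE (x := O *ᵥ Pi.single k 1) ?_ ?_
    · rw [norm_toLp_mulVec_of_orthonormal hO]
      simp
    · rw [hS, Matrix.mulVec_mulVec, Matrix.mul_assoc, hO, mul_one, ← Matrix.mulVec_mulVec,
        ← Matrix.mulVec_smul]
      congr 1
      ext j
      simp only [Matrix.mulVec_diagonal, Pi.single_apply, Pi.smul_apply, smul_eq_mul, mul_ite,
        mul_one, mul_zero]
      split_ifs with hjk
      · rw [hjk]
      · rfl
  set f : ι → ℝ := fun k => if |d k| ≤ ε then 0 else 1 with hf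
  set g : ι → ℝ := fun k => if |d k| ≤ ε then 0 else (d k)⁻¹ with hg
  have hone : (1 : Matrix ι ι ℝ) = O * Matrix.diagonal (fun _ => (1 : ℝ)) * Oᵀ := by
    rw [Matrix.diagonal_one, mul_one, hO']
  have hd0 : ∀ k, ¬ |d k| ≤ ε → d k ≠ 0 := by
    intro k hk h0
    rw [h0, abs_zero] at hk
    exact hk hε
  refine ⟨O * Matrix.diagonal f * Oᵀ, O * Matrix.diagonal g * Oᵀ, ?_, ?_, ?_, ?_, ?_, ?_, ?_⟩
  · simp [Matrix.transpose_mul, Matrix.mul_assoc]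
  · rw [conj_diagonal_mul hO]
    congr 3
    funext k
    by_cases hk : |d k| ≤ ε <;> simp [hf, hk]
  · rw [hS, conj_diagonal_mul hO, conj_diagonal_mul hO]
    congr 3
    funext k
    exact mul_comm _ _
  · rw [hone, ← sub_mul, ← mul_sub, Matrix.diagonal_sub, hS, conj_diagonal_mul hO]
    refine norm_conj_diagonal_le hO _ hε fun k => ?_
    by_cases hk : |d k| ≤ ε <;> simp [hf, hk, hε]
  · rw [hS, conj_diagonal_mul hO]
    congr 3
    funext k
    by_cases hk : |d k| ≤ ε
    · simp [hf, hg, hk]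
    · simp [hf, hg, hk, hd0 k hk]
  · rw [conj_diagonal_mul hO]
    congr 3
    funext k
    by_cases hk : |d k| ≤ ε <;> simp [hf, hg, hk]
  · have hb : 0 < σ - ε := by linarith
    rw [mul_comm, ← le_div_iff₀ hb]
    refine norm_conj_diagonal_le hO _ (by positivity) fun k => ?_
    by_cases hk : |d k| ≤ ε
    · simp [hg, hk, hb.le]
    · simp only [hg, hk, if_false, abs_inv, one_div]
      exact inv_anti₀ hb ((hgap k).resolve_left hk)

end Spectral

/-! ### The symmetric dilation of a rectangular matrix -/

section Dilation

variable {m n r : ℕ}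

/-- The symmetric dilation of a rectangular matrix. -/
def dil (A : Matrix (Fin m) (Fin n) ℝ) : Matrix (Fin m ⊕ Fin n) (Fin m ⊕ Fin n) ℝ :=
  Matrix.fromBlocks 0 A Aᵀ 0

/-- The projection onto the column spaces of two frames. -/
def frameProj (U : Matrix (Fin m) (Fin r) ℝ) (V : Matrix (Fin n) (Fin r) ℝ) :
    Matrix (Fin m ⊕ Fin n) (Fin m ⊕ Fin n) ℝ :=
  Matrix.fromBlocks (U * Uᵀ) 0 0 (V * Vᵀ)

theorem dil_transpose (A : Matrix (Fin m) (Fin n) ℝ) : (dil A)ᵀ = dil A := by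
  simp [dil, Matrix.fromBlocks_transpose]

theorem dil_add (A B : Matrix (Fin m) (Fin n) ℝ) : dil (A + B) = dil A + dil B := by
  simp [dil, Matrix.fromBlocks_add]

theorem norm_dil_le (A : Matrix (Fin m) (Fin n) ℝ) : ‖dil A‖ ≤ ‖A‖ := by
  refine l2_opNorm_le_of_forall _ _ (norm_nonneg A) fun x => ?_
  refine le_of_sq_le_sq ?_ (by positivity)
  have h1 := pow_le_pow_left₀ (norm_nonneg _) (mulVec_le_l2_opNorm A (x ∘ Sum.inr)) 2
  have h2 := pow_le_pow_left₀ (norm_nonneg _) (mulVec_le_l2_opNorm Aᵀ (x ∘ Sum.inl)) 2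
  rw [l2_opNorm_transpose] at h2
  rw [mul_pow, norm_toLp_sq, norm_toLp_sq] at h1 h2
  rw [mul_pow, norm_toLp_sq, norm_toLp_sq, dil, Matrix.fromBlocks_mulVec]
  simp only [dotProduct, Fintype.sum_sum_type, Sum.elim_inl, Sum.elim_inr, Matrix.zero_mulVec,
    zero_add, add_zero, Function.comp_apply] at h1 h2 ⊢
  linarith

theorem norm_le_norm_dil (A : Matrix (Fin m) (Fin n) ℝ) : ‖A‖ ≤ ‖dil A‖ := by
  refine l2_opNorm_le_of_forall _ _ (norm_nonneg _) fun x => ?_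
  refine le_of_sq_le_sq ?_ (by positivity)
  have h1 := pow_le_pow_left₀ (norm_nonneg _)
    (mulVec_le_l2_opNorm (dil A) (Sum.elim (0 : Fin m → ℝ) x)) 2
  rw [mul_pow, norm_toLp_sq, norm_toLp_sq, dil, Matrix.fromBlocks_mulVec] at h1
  rw [mul_pow, norm_toLp_sq, norm_toLp_sq]
  simpa [dotProduct, Fintype.sum_sum_type, dil] using h1

/-- The pairs (u_k, ±v_k) are eigenvectors for ±d_k, and the projection onto all of them is block
diagonal, free of signs. Orthogonality of R to both frames makes the dilation commute with this
projection and leaves `dil R` off it. -/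
theorem gapProj_dil {A R : Matrix (Fin m) (Fin n) ℝ} {U : Matrix (Fin m) (Fin r) ℝ}
    {V : Matrix (Fin n) (Fin r) ℝ} {d : Fin r → ℝ} {a b : ℝ} (hb : 0 < b)
    (hU : Uᵀ * U = 1) (hV : Vᵀ * V = 1) (hd : ∀ k, b ≤ d k)
    (hA : A = U * Matrix.diagonal d * Vᵀ + R) (hUR : Uᵀ * R = 0) (hRV : R * V = 0)
    (hR : ‖R‖ ≤ a) :
    GapProj (dil A) (frameProj U V) (dil (U * Matrix.diagonal (fun k => (d k)⁻¹) * Vᵀ)) a b := by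
  have hd0 : ∀ k, d k ≠ 0 := fun k => (hb.trans_le (hd k)).ne'
  have hAV : A * V = U * Matrix.diagonal d := by
    rw [hA, Matrix.add_mul, hRV, add_zero, Matrix.mul_assoc, hV, Matrix.mul_one]
  have hUA : Uᵀ * A = Matrix.diagonal d * Vᵀ := by
    rw [hA, Matrix.mul_add, hUR, add_zero, ← Matrix.mul_assoc, ← Matrix.mul_assoc, hU, Matrix.one_mul]
  have hAU : Aᵀ * U = V * Matrix.diagonal d := by
    have := congrArg Matrix.transpose hUA
    simpa [Matrix.transpose_mul] using this
  have hVA : Vᵀ * Aᵀ = Matrix.diagonal d * Uᵀ := by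
    have := congrArg Matrix.transpose hAV
    simpa [Matrix.transpose_mul] using this
  have hdd : Matrix.diagonal d * Matrix.diagonal (fun k => (d k)⁻¹) =
      (1 : Matrix (Fin r) (Fin r) ℝ) := by
    rw [Matrix.diagonal_mul_diagonal, ← Matrix.diagonal_one]
    congr 1
    funext k
    exact mul_inv_cancel₀ (hd0 k)
  have hAVV : A * (V * Vᵀ) = U * Matrix.diagonal d * Vᵀ := by rw [← Matrix.mul_assoc, hAV]
  have hAUU : Aᵀ * (U * Uᵀ) = V * Matrix.diagonal d * Uᵀ := by rw [← Matrix.mul_assoc, hAU]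
  have hUUA : U * Uᵀ * A = U * Matrix.diagonal d * Vᵀ := by
    rw [Matrix.mul_assoc, hUA, ← Matrix.mul_assoc]
  have hVVA : V * Vᵀ * Aᵀ = V * Matrix.diagonal d * Uᵀ := by
    rw [Matrix.mul_assoc, hVA, ← Matrix.mul_assoc]
  refine ⟨?_, ?_, ?_, ?_, ?_, ?_, ?_⟩
  · simp [frameProj, Matrix.fromBlocks_transpose, Matrix.transpose_mul]
  · have e1 : U * Uᵀ * (U * Uᵀ) = U * Uᵀ := by
      rw [Matrix.mul_assoc, ← Matrix.mul_assoc Uᵀ, hU, Matrix.one_mul]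
    have e2 : V * Vᵀ * (V * Vᵀ) = V * Vᵀ := by
      rw [Matrix.mul_assoc, ← Matrix.mul_assoc Vᵀ, hV, Matrix.one_mul]
    simp [frameProj, Matrix.fromBlocks_multiply, e1, e2]
  · simp [dil, frameProj, Matrix.fromBlocks_multiply, hAVV, hAUU, hUUA, hVVA]
  · have : dil A * (1 - frameProj U V) = dil R := by
      have eR : A - U * Matrix.diagonal d * Vᵀ = R := by rw [hA]; abel
      have eR' : Aᵀ - V * Matrix.diagonal d * Uᵀ = Rᵀ := by
        rw [← eR, Matrix.transpose_sub]
        simp [Matrix.transpose_mul, Matrix.mul_assoc]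
      rw [Matrix.mul_sub, Matrix.mul_one, sub_eq_iff_eq_add]
      simp [dil, frameProj, Matrix.fromBlocks_multiply, hAVV, hAUU, Matrix.fromBlocks_add, ← eR,
        Matrix.mul_assoc]
    rw [this]
    exact (norm_dil_le R).trans hR
  · have e1 : A * (V * (Matrix.diagonal (fun k => (d k)⁻¹) * Uᵀ)) = U * Uᵀ := by
      rw [← Matrix.mul_assoc, hAV, Matrix.mul_assoc, ← Matrix.mul_assoc (Matrix.diagonal d), hdd,
        Matrix.one_mul]
    have e2 : Aᵀ * (U * (Matrix.diagonal (fun k => (d k)⁻¹) * Vᵀ)) = V * Vᵀ := by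
      rw [← Matrix.mul_assoc, hAU, Matrix.mul_assoc, ← Matrix.mul_assoc (Matrix.diagonal d), hdd,
        Matrix.one_mul]
    simp [dil, frameProj, Matrix.fromBlocks_multiply, Matrix.transpose_mul, Matrix.mul_assoc, e1,
      e2]
  · have e1 : ∀ (X : Matrix (Fin r) (Fin n) ℝ), U * (Uᵀ * (U * X)) = U * X := by
      intro X; rw [← Matrix.mul_assoc Uᵀ, hU, Matrix.one_mul]
    have e2 : ∀ (X : Matrix (Fin r) (Fin m) ℝ), V * (Vᵀ * (V * X)) = V * X := by
      intro X; rw [← Matrix.mul_assoc Vᵀ, hV, Matrix.one_mul]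
    simp [dil, frameProj, Matrix.fromBlocks_multiply, Matrix.transpose_mul, Matrix.mul_assoc, e1,
      e2]
  · rw [mul_comm, ← le_div_iff₀ hb]
    refine (norm_dil_le _).trans ?_
    have h1 := norm_le_one_of_orthonormal hU
    have h2 : ‖Vᵀ‖ ≤ 1 := by rw [l2_opNorm_transpose]; exact norm_le_one_of_orthonormal hV
    have h3 : ‖(Matrix.diagonal (fun k => (d k)⁻¹) : Matrix (Fin r) (Fin r) ℝ)‖ ≤ 1 / b := by
      rw [Matrix.l2_opNorm_diagonal, pi_norm_le_iff_of_nonneg (by positivity)]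
      intro k
      rw [Real.norm_eq_abs, abs_inv, abs_of_pos (hb.trans_le (hd k)), one_div]
      exact inv_anti₀ hb (hd k)
    calc _ ≤ ‖U‖ * ‖(Matrix.diagonal (fun k => (d k)⁻¹) : Matrix (Fin r) (Fin r) ℝ)‖ * ‖Vᵀ‖ :=
          (Matrix.l2_opNorm_mul _ _).trans (by gcongr; exact Matrix.l2_opNorm_mul _ _)
      _ ≤ 1 * (1 / b) * 1 := by gcongr
      _ = 1 / b := by ring

end Dilation

end LowRank

namespace LowRank

/-! ### Best approximations of low rank in Frobenius norm -/

section EckartYoung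

variable {m n r : ℕ}

theorem frobSq_eq_trace (A : Matrix (Fin m) (Fin n) ℝ) : frobSq A = (Aᵀ * A).trace := by
  simp only [frobSq, Matrix.trace, Matrix.diag_apply, Matrix.mul_apply, Matrix.transpose_apply]
  rw [Finset.sum_comm]
  simp [sq]

theorem frobSq_transpose (A : Matrix (Fin m) (Fin n) ℝ) : frobSq Aᵀ = frobSq A := by
  unfold frobSq
  rw [Finset.sum_comm]
  rfl

theorem frobSq_add (A B : Matrix (Fin m) (Fin n) ℝ) :
    frobSq (A + B) = frobSq A + 2 * (Aᵀ * B).trace + frobSq B := by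
  have h : (Bᵀ * A).trace = (Aᵀ * B).trace := by
    rw [← Matrix.trace_transpose, Matrix.transpose_mul, Matrix.transpose_transpose]
  rw [frobSq_eq_trace, frobSq_eq_trace, frobSq_eq_trace, Matrix.transpose_add, Matrix.add_mul,
    Matrix.mul_add, Matrix.mul_add, Matrix.trace_add, Matrix.trace_add, Matrix.trace_add, h]
  ring

theorem eq_zero_of_frobSq_le_zero {A : Matrix (Fin m) (Fin n) ℝ} (h : frobSq A ≤ 0) : A = 0 := by
  ext i j
  have h1 : A i j ^ 2 ≤ frobSq A :=
    (Finset.single_le_sum (f := fun j => A i j ^ 2) (fun _ _ => sq_nonneg _)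
      (Finset.mem_univ j)).trans
      (Finset.single_le_sum (f := fun i => ∑ j, A i j ^ 2)
        (fun _ _ => Finset.sum_nonneg fun _ _ => sq_nonneg _) (Finset.mem_univ i))
  have : A i j ^ 2 ≤ 0 := h1.trans h
  simpa using pow_eq_zero_iff (two_ne_zero) |>.1 (le_antisymm this (sq_nonneg _))

theorem rank_mul_le_width (X : Matrix (Fin m) (Fin r) ℝ) (Y : Matrix (Fin r) (Fin n) ℝ) :
    (X * Y).rank ≤ r :=
  (Matrix.rank_mul_le_left X Y).trans ((Matrix.rank_le_width X))

variable {A B : Matrix (Fin m) (Fin n) ℝ} {U : Matrix (Fin m) (Fin r) ℝ}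
  {V : Matrix (Fin n) (Fin r) ℝ} {s : Fin r → ℝ}

theorem IsBestRankApprox.transpose (h : IsBestRankApprox r A B) : IsBestRankApprox r Aᵀ Bᵀ := by
  refine ⟨by rw [Matrix.rank_transpose]; exact h.1, fun B' hB' => ?_⟩
  have := h.2 B'ᵀ (by rw [Matrix.rank_transpose]; exact hB')
  rwa [← frobSq_transpose, ← frobSq_transpose (A - B'ᵀ), Matrix.transpose_sub,
    Matrix.transpose_sub, Matrix.transpose_transpose] at this

/-- The residual of a best approximation is orthogonal to its left factor. -/
theorem IsBestRankApprox.left_mul_residual (h : IsBestRankApprox r A B) (hU : Uᵀ * U = 1)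
    {Y : Matrix (Fin r) (Fin n) ℝ} (hB : B = U * Y) : Uᵀ * (A - B) = 0 := by
  set X := A - U * (Uᵀ * A) with hX
  set Z := Uᵀ * (A - B) with hZ
  have e : A - B = X + U * Z := by
    rw [hX, hZ, Matrix.mul_sub, Matrix.mul_sub, hB, ← Matrix.mul_assoc Uᵀ U, hU, Matrix.one_mul]
    abel
  have hUX : Xᵀ * U = 0 := by
    have : Uᵀ * X = 0 := by
      rw [hX, Matrix.mul_sub, ← Matrix.mul_assoc Uᵀ U, hU, Matrix.one_mul, sub_self]
    have := congrArg Matrix.transpose this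
    rwa [Matrix.transpose_mul, Matrix.transpose_transpose, Matrix.transpose_zero] at this
  -- The competitor U Uᵀ A has residual X, which is orthogonal to U Z; minimality therefore forces Z
  -- = 0.
  have h1 := h.2 (U * (Uᵀ * A)) (rank_mul_le_width _ _)
  rw [e, frobSq_add, ← Matrix.mul_assoc, hUX, Matrix.zero_mul, Matrix.trace_zero, mul_zero,
    add_zero] at h1
  have h2 : frobSq (U * Z) = frobSq Z := by
    rw [frobSq_eq_trace, frobSq_eq_trace, Matrix.transpose_mul, Matrix.mul_assoc,
      ← Matrix.mul_assoc Uᵀ U, hU, Matrix.one_mul]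
  rw [h2] at h1
  exact eq_zero_of_frobSq_le_zero (by linarith)

theorem IsBestRankApprox.residual_mul_right (h : IsBestRankApprox r A B) (hV : Vᵀ * V = 1)
    {Y : Matrix (Fin m) (Fin r) ℝ} (hB : B = Y * Vᵀ) : (A - B) * V = 0 := by
  have := h.transpose.left_mul_residual hV (Y := Yᵀ) (by rw [hB, Matrix.transpose_mul]; simp)
  have := congrArg Matrix.transpose this
  simpa [Matrix.transpose_mul] using this

/-- The residual of a best approximation is dominated by each singular value kept. -/
theorem IsBestRankApprox.norm_residual_mulVec_le (h : IsBestRankApprox r A B)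
    (hB : IsSVD B U s V) (k : Fin r) (y : Fin n → ℝ) :
    ‖WithLp.toLp 2 ((A - B) *ᵥ y)‖ ≤ s k * ‖WithLp.toLp 2 y‖ := by
  set R := A - B with hR
  have hUR : Uᵀ * R = 0 := h.left_mul_residual hB.orthonormal_left
    (by rw [hB.eq, Matrix.mul_assoc])
  -- unit vectors suffice
  suffices hunit : ∀ y : Fin n → ℝ, y ⬝ᵥ y = 1 → (R *ᵥ y) ⬝ᵥ (R *ᵥ y) ≤ s k ^ 2 by
    by_cases hy : ‖WithLp.toLp 2 y‖ = 0
    · have : y = 0 := by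
        have := norm_eq_zero.1 hy
        exact congrArg WithLp.ofLp this
      simp [this]
    · have hpos : 0 < ‖WithLp.toLp 2 y‖ := lt_of_le_of_ne (norm_nonneg _) (Ne.symm hy)
      set t := ‖WithLp.toLp 2 y‖ with ht
      have h1 : (t⁻¹ • y) ⬝ᵥ (t⁻¹ • y) = 1 := by
        rw [smul_dotProduct, dotProduct_smul, ← norm_toLp_sq, ← ht, smul_eq_mul, smul_eq_mul]
        field_simp
      have h2 := hunit _ h1
      rw [Matrix.mulVec_smul, smul_dotProduct, dotProduct_smul, ← norm_toLp_sq, smul_eq_mul,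
        smul_eq_mul] at h2
      refine le_of_sq_le_sq ?_ (mul_nonneg (hB.nonneg k) hpos.le)
      field_simp at h2
      rw [mul_pow]
      linarith
  intro y hy
  set x := R *ᵥ y with hx
  set u : Fin m → ℝ := fun a => U a k with hu
  set v : Fin n → ℝ := fun b => V b k with hv
  -- exchange the `k`-th singular triple for the rank-one matrix `x yᵀ`
  set B' := B + (Matrix.vecMulVec x y - s k • Matrix.vecMulVec u v) with hB'
  have hrank : B'.rank ≤ r := by
    -- B' is still a product of two factors of width r: the k-th column of each is replaced.
    have e : B' = (U * Matrix.diagonal s).updateCol k x * (V.updateCol k y)ᵀ := by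
      ext a b
      have hsum : ∀ l, (U * Matrix.diagonal s).updateCol k x a l * V.updateCol k y b l =
          U a l * s l * V b l + if l = k then x a * y b - s k * (U a k * V b k) else 0 := by
        intro l
        by_cases hl : l = k
        · subst hl
          simp
          ring
        · simp [hl]
      have hBab : B a b = ∑ l, U a l * s l * V b l := by
        rw [hB.eq, Matrix.mul_apply]
        simp [Matrix.mul_diagonal]
      rw [hB', Matrix.mul_apply]
      simp only [Matrix.add_apply, Matrix.sub_apply, Matrix.smul_apply, Matrix.vecMulVec_apply,
        smul_eq_mul, Matrix.transpose_apply, hsum, Finset.sum_add_distrib,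
        Finset.sum_ite_eq', Finset.mem_univ, if_true, hBab]
      rfl
    rw [e]
    exact rank_mul_le_width _ _
  have hmin := h.2 B' hrank
  have e : A - B' = R + (s k • Matrix.vecMulVec u v - Matrix.vecMulVec x y) := by
    rw [hB', hR]; abel
  have htr : ∀ (C : Matrix (Fin m) (Fin n) ℝ) (a : Fin m → ℝ) (b : Fin n → ℝ),
      (Cᵀ * Matrix.vecMulVec a b).trace = a ⬝ᵥ (C *ᵥ b) := by
    intro C a b
    rw [Matrix.mul_vecMulVec, Matrix.trace_vecMulVec, Matrix.mulVec_transpose,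
      ← Matrix.dotProduct_mulVec]
  have hvm : ∀ (a c : Fin m → ℝ) (b d : Fin n → ℝ),
      ((Matrix.vecMulVec a b)ᵀ * Matrix.vecMulVec c d).trace = (c ⬝ᵥ a) * (b ⬝ᵥ d) := by
    intro a c b d
    rw [htr, Matrix.vecMulVec_mulVec]
    simp only [dotProduct_smul, op_smul_eq_smul, smul_eq_mul]
    ring
  have huR : ∀ b, u ⬝ᵥ (R *ᵥ b) = 0 := by
    intro b
    rw [Matrix.dotProduct_mulVec]
    have : u ᵥ* R = 0 := by
      ext c
      have := congrFun (congrFun hUR k) c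
      simpa [Matrix.mul_apply, Matrix.vecMul, dotProduct] using this
    rw [this, zero_dotProduct]
  have huu : u ⬝ᵥ u = 1 := by
    have := congrFun (congrFun hB.orthonormal_left k) k
    simpa [Matrix.mul_apply, dotProduct] using this
  have hvv : v ⬝ᵥ v = 1 := by
    have := congrFun (congrFun hB.orthonormal_right k) k
    simpa [Matrix.mul_apply, dotProduct] using this
  have hux : u ⬝ᵥ x = 0 := huR y
  have hxu : x ⬝ᵥ u = 0 := by rw [dotProduct_comm, hux]
  have f1 : (Rᵀ * (s k • Matrix.vecMulVec u v - Matrix.vecMulVec x y)).trace = - (x ⬝ᵥ x) := by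
    rw [Matrix.mul_sub, Matrix.mul_smul, Matrix.trace_sub, Matrix.trace_smul, htr, htr, huR, ← hx]
    simp
  have f2 : frobSq (s k • Matrix.vecMulVec u v - Matrix.vecMulVec x y) = s k ^ 2 + x ⬝ᵥ x := by
    rw [frobSq_eq_trace, Matrix.transpose_sub, Matrix.transpose_smul, Matrix.sub_mul,
      Matrix.mul_sub, Matrix.mul_sub]
    simp only [Matrix.smul_mul, Matrix.mul_smul, Matrix.trace_sub, Matrix.trace_smul, hvm, huu,
      hvv, hux, hxu, hy, smul_eq_mul]
    ring
  -- The exchange changes the squared error by -2‖x‖² + s_k² + ‖x‖², and minimality makes this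
  -- nonnegative.
  rw [e, frobSq_add, f1, f2] at hmin
  linarith

theorem toLp_pos_of_ne_zero {ι : Type*} [Fintype ι] {v : ι → ℝ} (hv : v ≠ 0) :
    0 < ‖WithLp.toLp 2 v‖ := by
  rw [norm_pos_iff]
  intro h0
  exact hv (congrArg WithLp.ofLp h0)

/-- A best rank-`r` approximation of a small perturbation of a matrix with `r` singular values at
least `σ`: bounds for the residual and for the singular values. -/
theorem IsBestRankApprox.gap {M : Matrix (Fin m) (Fin n) ℝ} {U₀ : Matrix (Fin m) (Fin r) ℝ}
    {V₀ : Matrix (Fin n) (Fin r) ℝ} {s₀ : Fin r → ℝ} {σ ε : ℝ}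
    (hσ : 0 < σ) (h : IsBestRankApprox r A B) (hB : IsSVD B U s V) (hM : IsSVD M U₀ s₀ V₀)
    (hs₀ : ∀ k, σ ≤ s₀ k) (hE : ‖A - M‖ ≤ ε) : ‖A - B‖ ≤ ε ∧ ∀ k, σ - ε ≤ s k := by
  have hε : 0 ≤ ε := (norm_nonneg _).trans hE
  set R := A - B with hR
  have hUR : Uᵀ * R = 0 := h.left_mul_residual hB.orthonormal_left
    (by rw [hB.eq, Matrix.mul_assoc])
  have hRV : R * V = 0 := h.residual_mul_right hB.orthonormal_right hB.eq
  have hRs := fun k y => h.norm_residual_mulVec_le hB k y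
  rw [← hR] at hRs
  have hAR : A = B + R := by rw [hR]; abel
  -- values of `A`
  have hAz : ∀ z, A *ᵥ z = U *ᵥ (Matrix.diagonal s *ᵥ (Vᵀ *ᵥ z)) + R *ᵥ z := by
    intro z
    conv_lhs => rw [hAR, Matrix.add_mulVec, hB.eq]
    rw [← Matrix.mulVec_mulVec, ← Matrix.mulVec_mulVec]
  have hAzn : ∀ z, ‖WithLp.toLp 2 (A *ᵥ z)‖ ^ 2 =
      (∑ k, (s k * (Vᵀ *ᵥ z) k) ^ 2) + ‖WithLp.toLp 2 (R *ᵥ z)‖ ^ 2 := by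
    intro z
    have hc : (U *ᵥ (Matrix.diagonal s *ᵥ (Vᵀ *ᵥ z))) ⬝ᵥ (R *ᵥ z) = 0 := by
      rw [Matrix.dotProduct_mulVec, ← Matrix.mulVec_transpose, Matrix.mulVec_mulVec]
      have : Rᵀ * U = 0 := by
        have := congrArg Matrix.transpose hUR
        simpa [Matrix.transpose_mul] using this
      rw [this, Matrix.zero_mulVec, zero_dotProduct]
    rw [hAz, norm_toLp_sq, add_dotProduct, dotProduct_add, dotProduct_add, hc,
      dotProduct_comm (R *ᵥ z), hc, ← norm_toLp_sq, ← norm_toLp_sq,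
      norm_toLp_mulVec_of_orthonormal hB.orthonormal_left, norm_toLp_sq]
    simp [dotProduct, Matrix.mulVec_diagonal, sq]
  have hVV : ∀ z : Fin n → ℝ, ‖WithLp.toLp 2 (V *ᵥ (Vᵀ *ᵥ z))‖ ^ 2 +
      ‖WithLp.toLp 2 (z - V *ᵥ (Vᵀ *ᵥ z))‖ ^ 2 = ‖WithLp.toLp 2 z‖ ^ 2 := by
    intro z
    have := norm_sq_proj_add (P := V * Vᵀ) (by simp [Matrix.transpose_mul]) (by
      rw [Matrix.mul_assoc, ← Matrix.mul_assoc Vᵀ, hB.orthonormal_right, Matrix.one_mul]) z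
    rwa [Matrix.sub_mulVec, Matrix.one_mulVec, ← Matrix.mulVec_mulVec] at this
  have hVn : ∀ c, ‖WithLp.toLp 2 (V *ᵥ c)‖ = ‖WithLp.toLp 2 c‖ :=
    norm_toLp_mulVec_of_orthonormal hB.orthonormal_right
  have hRV' : ∀ c, R *ᵥ (V *ᵥ c) = 0 := fun c => by
    rw [Matrix.mulVec_mulVec, hRV, Matrix.zero_mulVec]
  have hVc : ∀ c, Vᵀ *ᵥ (V *ᵥ c) = c := fun c => by
    rw [Matrix.mulVec_mulVec, hB.orthonormal_right, Matrix.one_mulVec]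
  constructor
  · refine l2_opNorm_le_of_forall R ε hε fun y => ?_
    set y' := y - V *ᵥ (Vᵀ *ᵥ y) with hy'
    have hRy : R *ᵥ y = R *ᵥ y' := by rw [hy', Matrix.mulVec_sub, hRV', sub_zero]
    have hy'n : ‖WithLp.toLp 2 y'‖ ≤ ‖WithLp.toLp 2 y‖ := by
      refine le_of_sq_le_sq ?_ (norm_nonneg _)
      have := hVV y
      nlinarith [sq_nonneg ‖WithLp.toLp 2 (V *ᵥ (Vᵀ *ᵥ y))‖]
    have hVy' : Vᵀ *ᵥ y' = 0 := by rw [hy', Matrix.mulVec_sub, hVc, sub_self]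
    rw [hRy]
    refine le_trans ?_ (mul_le_mul_of_nonneg_left hy'n hε)
    by_cases hy0 : y' = 0
    · simp [hy0]
    have hy0' := toLp_pos_of_ne_zero hy0
    -- a nonzero vector in `span (V, y')` annihilated by `M`
    let φ : ((Fin r → ℝ) × ℝ) →ₗ[ℝ] (Fin r → ℝ) :=
      (Matrix.mulVecLin V₀ᵀ).comp
        ((Matrix.mulVecLin V).coprod ((LinearMap.id : ℝ →ₗ[ℝ] ℝ).smulRight y'))
    obtain ⟨⟨c, d⟩, hker, hne⟩ := (Submodule.ne_bot_iff _).1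
      (LinearMap.ker_ne_bot_of_finrank_lt (f := φ) (by simp))
    set z := V *ᵥ c + d • y' with hz
    have hz0 : V₀ᵀ *ᵥ z = 0 := hker
    have hVz : Vᵀ *ᵥ z = c := by
      rw [hz, Matrix.mulVec_add, hVc, Matrix.mulVec_smul, hVy', smul_zero, add_zero]
    have hRz : R *ᵥ z = d • (R *ᵥ y') := by
      rw [hz, Matrix.mulVec_add, hRV', zero_add, Matrix.mulVec_smul]
    have hzn : ‖WithLp.toLp 2 z‖ ^ 2 = (∑ k, c k ^ 2) + d ^ 2 * ‖WithLp.toLp 2 y'‖ ^ 2 := by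
      rw [← hVV z, hVz, hVn, hz, add_sub_cancel_left, WithLp.toLp_smul, norm_smul, mul_pow,
        Real.norm_eq_abs, sq_abs, EuclideanSpace.real_norm_sq_eq]
    have hzpos : 0 < ‖WithLp.toLp 2 z‖ := by
      refine toLp_pos_of_ne_zero fun h0 => hne ?_
      have hc : c = 0 := by rw [← hVz, h0, Matrix.mulVec_zero]
      have hd : d • y' = 0 := by rw [← h0, hz, hc, Matrix.mulVec_zero, zero_add]
      rw [hc, (smul_eq_zero.1 hd).resolve_right hy0]
      rfl
    have hMz : M *ᵥ z = 0 := by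
      rw [hM.eq, ← Matrix.mulVec_mulVec, hz0, Matrix.mulVec_zero]
    have hup : ‖WithLp.toLp 2 (A *ᵥ z)‖ ≤ ε * ‖WithLp.toLp 2 z‖ := by
      have : A *ᵥ z = (A - M) *ᵥ z := by rw [Matrix.sub_mulVec, hMz, sub_zero]
      rw [this]
      exact (mulVec_le_l2_opNorm _ _).trans (by gcongr)
    have hup2 := pow_le_pow_left₀ (norm_nonneg _) hup 2
    rw [hAzn, hVz, hRz, mul_pow, WithLp.toLp_smul, norm_smul, mul_pow, Real.norm_eq_abs,
      sq_abs] at hup2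
    set ρ := ‖WithLp.toLp 2 (R *ᵥ y')‖ with hρ
    set η := ‖WithLp.toLp 2 y'‖ with hη
    -- Each kept singular value dominates the residual, so s k ≥ ρ / η. Hence A stretches the whole
    -- of z by at least ρ / η, while it stretches z by at most ε because M z = 0.
    have hs2 : ∑ k, ρ ^ 2 * c k ^ 2 ≤ η ^ 2 * ∑ k, (s k * c k) ^ 2 := by
      rw [Finset.mul_sum]
      refine Finset.sum_le_sum fun k _ => ?_
      have := pow_le_pow_left₀ (norm_nonneg _) (hRs k y') 2
      rw [← hρ, ← hη, mul_pow] at this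
      nlinarith [sq_nonneg (c k)]
    rw [← Finset.mul_sum] at hs2
    have hfin : ρ ^ 2 * ‖WithLp.toLp 2 z‖ ^ 2 ≤ (ε * η) ^ 2 * ‖WithLp.toLp 2 z‖ ^ 2 := by
      have := mul_le_mul_of_nonneg_left hup2 (sq_nonneg η)
      rw [hzn] at this ⊢
      nlinarith
    have hfin2 := le_of_mul_le_mul_right hfin (by positivity)
    exact le_of_sq_le_sq hfin2 (by positivity)
  · intro k
    -- There are r unknowns and r - 1 equations: some V₀ c ≠ 0 is orthogonal to every right singular
    -- vector of B except the k-th. On it M stretches by at least σ and A by at most s k.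
    let ψ : (Fin r → ℝ) →ₗ[ℝ] ({l : Fin r // l ≠ k} → ℝ) :=
      (LinearMap.funLeft ℝ ℝ Subtype.val).comp (Matrix.mulVecLin (Vᵀ * V₀))
    obtain ⟨c, hker, hne⟩ := (Submodule.ne_bot_iff _).1
      (LinearMap.ker_ne_bot_of_finrank_lt (f := ψ) (by
        have : 0 < r := k.pos
        simp [Fintype.card_subtype_compl]
        omega))
    set z := V₀ *ᵥ c with hz
    have hzk : ∀ l, l ≠ k → (Vᵀ *ᵥ z) l = 0 := by
      intro l hl
      have h1 : ψ c = 0 := hker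
      have h2 := congrFun h1 ⟨l, hl⟩
      rw [hz, Matrix.mulVec_mulVec]
      exact h2
    have hzc : ‖WithLp.toLp 2 z‖ = ‖WithLp.toLp 2 c‖ :=
      norm_toLp_mulVec_of_orthonormal hM.orthonormal_right c
    have hcpos := toLp_pos_of_ne_zero hne
    have hMz : σ * ‖WithLp.toLp 2 z‖ ≤ ‖WithLp.toLp 2 (M *ᵥ z)‖ := by
      have e : M *ᵥ z = U₀ *ᵥ (Matrix.diagonal s₀ *ᵥ c) := by
        conv_lhs => rw [hM.eq, hz, Matrix.mulVec_mulVec, Matrix.mul_assoc, hM.orthonormal_right,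
          Matrix.mul_one, ← Matrix.mulVec_mulVec]
      rw [e, norm_toLp_mulVec_of_orthonormal hM.orthonormal_left, hzc]
      refine le_of_sq_le_sq ?_ (norm_nonneg _)
      rw [mul_pow, EuclideanSpace.real_norm_sq_eq, EuclideanSpace.real_norm_sq_eq, Finset.mul_sum]
      refine Finset.sum_le_sum fun l _ => ?_
      simp only [Matrix.mulVec_diagonal]
      rw [← mul_pow, mul_pow, mul_pow]
      gcongr
      exact hs₀ l
    have hAup : ‖WithLp.toLp 2 (A *ᵥ z)‖ ≤ s k * ‖WithLp.toLp 2 z‖ := by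
      refine le_of_sq_le_sq ?_ (mul_nonneg (hB.nonneg k) (norm_nonneg _))
      rw [hAzn, mul_pow, ← hVV z, hVn,
        EuclideanSpace.real_norm_sq_eq (WithLp.toLp 2 (Vᵀ *ᵥ z)), mul_add]
      have e1 : ∑ l, (s l * (Vᵀ *ᵥ z) l) ^ 2 = s k ^ 2 * ∑ l, (Vᵀ *ᵥ z) l ^ 2 := by
        rw [Finset.sum_eq_single k, Finset.sum_eq_single k, mul_pow]
        · intro l _ hl; rw [hzk l hl]; simp
        · simp
        · intro l _ hl; rw [hzk l hl]; simp
        · simp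
      have e2 : R *ᵥ z = R *ᵥ (z - V *ᵥ (Vᵀ *ᵥ z)) := by rw [Matrix.mulVec_sub, hRV', sub_zero]
      rw [e1, e2]
      gcongr
      rw [← mul_pow]
      exact pow_le_pow_left₀ (norm_nonneg _) (hRs k _) 2
    have hdiff : ‖WithLp.toLp 2 (M *ᵥ z)‖ ≤
        ‖WithLp.toLp 2 (A *ᵥ z)‖ + ε * ‖WithLp.toLp 2 z‖ := by
      have e : WithLp.toLp 2 (M *ᵥ z) =
          WithLp.toLp 2 (A *ᵥ z) - WithLp.toLp 2 ((A - M) *ᵥ z) := by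
        rw [Matrix.sub_mulVec, WithLp.toLp_sub, sub_sub_cancel]
      rw [e]
      refine (norm_sub_le _ _).trans ?_
      gcongr
      exact (mulVec_le_l2_opNorm _ _).trans (by gcongr)
    have hpos : 0 < ‖WithLp.toLp 2 z‖ := by rw [hzc]; exact hcpos
    have : (σ - ε) * ‖WithLp.toLp 2 z‖ ≤ s k * ‖WithLp.toLp 2 z‖ := by linarith
    exact le_of_mul_le_mul_right this hpos

/-- The spectral estimate of a perturbed low-rank matrix yields a gapped spectral projection of
the dilation. -/
theorem IsSpectralEstimate.gapProj {M : Matrix (Fin m) (Fin n) ℝ} {U₀ : Matrix (Fin m) (Fin r) ℝ}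
    {V₀ : Matrix (Fin n) (Fin r) ℝ} {s₀ : Fin r → ℝ} {σ ε : ℝ}
    (h : IsSpectralEstimate A U V) (hM : IsSVD M U₀ s₀ V₀)
    (hs₀ : ∀ k, σ ≤ s₀ k) (hE : ‖A - M‖ ≤ ε) (hεσ : ε < σ) :
    ∃ W, GapProj (dil A) (frameProj U V) W ε (σ - ε) := by
  obtain ⟨B, s, hbest, hB⟩ := h
  have hε : 0 ≤ ε := (norm_nonneg _).trans hE
  obtain ⟨h1, h2⟩ := hbest.gap (by linarith) hB hM hs₀ hE
  exact ⟨_, gapProj_dil (R := A - B) (by linarith) hB.orthonormal_left hB.orthonormal_right h2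
    (by rw [← hB.eq]; abel)
    (hbest.left_mul_residual hB.orthonormal_left (by rw [hB.eq, Matrix.mul_assoc]))
    (hbest.residual_mul_right hB.orthonormal_right hB.eq) h1⟩

end EckartYoung

end LowRank

namespace LowRank

/-! ### Trace inequalities for powers of symmetric matrices -/

/-- Young's inequality for integer exponents. The inductive step multiplies by y and adds the
nonnegative quantity (n + 1) x^n (x - y)². -/
theorem succ_mul_pow_mul_le {x y : ℝ} (hx : 0 ≤ x) (hy : 0 ≤ y) (n : ℕ) :
    (n + 1 : ℝ) * x ^ n * y ≤ n * x ^ (n + 1) + y ^ (n + 1) := by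
  induction n with
  | zero => simp
  | succ n ih =>
    have h1 := mul_le_mul_of_nonneg_right ih hy
    have h2 : 0 ≤ (n + 1 : ℝ) * x ^ n * (x - y) ^ 2 := by positivity
    push_cast
    ring_nf at h1 h2 ⊢
    linarith

/-- An even power is convex, hence lies above its tangent at a. -/
theorem pow_tangent_le (s a : ℝ) (q : ℕ) :
    a ^ (2 * (q + 1)) + (2 * (q + 1) : ℝ) * ((s - a) * a ^ (2 * q + 1)) ≤ s ^ (2 * (q + 1)) := by
  have h := succ_mul_pow_mul_le (abs_nonneg a) (abs_nonneg s) (2 * q + 1)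
  have e1 : |a| ^ (2 * q + 1 + 1) = a ^ (2 * (q + 1)) := by
    rw [show 2 * q + 1 + 1 = 2 * (q + 1) by ring, pow_mul, sq_abs, ← pow_mul]
  have e2 : |s| ^ (2 * q + 1 + 1) = s ^ (2 * (q + 1)) := by
    rw [show 2 * q + 1 + 1 = 2 * (q + 1) by ring, pow_mul, sq_abs, ← pow_mul]
  rw [e1, e2] at h
  have h2 : s * a ^ (2 * q + 1) ≤ |a| ^ (2 * q + 1) * |s| := by
    rw [← abs_pow, ← abs_mul, mul_comm s]
    exact le_abs_self _
  have e3 : a * a ^ (2 * q + 1) = a ^ (2 * (q + 1)) := by ring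
  push_cast at h
  have h3 : (2 * (q : ℝ) + 1 + 1) * (s * a ^ (2 * q + 1)) ≤
      (2 * (q : ℝ) + 1 + 1) * (|a| ^ (2 * q + 1) * |s|) := by gcongr
  rw [sub_mul, e3]
  linarith

/-- Factor out x - y. In the remaining geometric sum the terms of index i and 2q - i are paired, and
each pair is at most x^(2q) + y^(2q) because |x|^i - |y|^i and |x|^(2q-i) - |y|^(2q-i) have the same
sign. -/
theorem sub_mul_pow_sub_pow_le (x y : ℝ) (q : ℕ) :
    (x - y) * (x ^ (2 * q + 1) - y ^ (2 * q + 1)) ≤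
      (2 * q + 1 : ℝ) / 2 * ((x - y) ^ 2 * (x ^ (2 * q) + y ^ (2 * q))) := by
  have hg := (Commute.all x y).geom_sum₂_mul (2 * q + 1)
  set G := ∑ i ∈ Finset.range (2 * q + 1), x ^ i * y ^ (2 * q + 1 - 1 - i) with hG
  have hpair : ∀ i ∈ Finset.range (2 * q + 1),
      x ^ i * y ^ (2 * q + 1 - 1 - i) + x ^ (2 * q + 1 - 1 - i) * y ^ i ≤
        x ^ (2 * q) + y ^ (2 * q) := by
    intro i hi
    have hi' : i ≤ 2 * q := by have := Finset.mem_range.1 hi; omega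
    have ex : ∀ z : ℝ, z ^ (2 * q) = |z| ^ i * |z| ^ (2 * q - i) := by
      intro z
      rw [← pow_add, Nat.add_sub_cancel' hi', pow_mul, pow_mul, sq_abs]
    have b1 : x ^ i * y ^ (2 * q - i) ≤ |x| ^ i * |y| ^ (2 * q - i) := by
      rw [← abs_pow, ← abs_pow, ← abs_mul]; exact le_abs_self _
    have b2 : x ^ (2 * q - i) * y ^ i ≤ |x| ^ (2 * q - i) * |y| ^ i := by
      rw [← abs_pow, ← abs_pow, ← abs_mul]; exact le_abs_self _
    have b3 : 0 ≤ (|x| ^ i - |y| ^ i) * (|x| ^ (2 * q - i) - |y| ^ (2 * q - i)) := by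
      rcases le_total |x| |y| with hxy | hxy
      · exact mul_nonneg_of_nonpos_of_nonpos
          (sub_nonpos.2 (pow_le_pow_left₀ (abs_nonneg _) hxy _))
          (sub_nonpos.2 (pow_le_pow_left₀ (abs_nonneg _) hxy _))
      · exact mul_nonneg
          (sub_nonneg.2 (pow_le_pow_left₀ (abs_nonneg _) hxy _))
          (sub_nonneg.2 (pow_le_pow_left₀ (abs_nonneg _) hxy _))
    rw [Nat.add_sub_cancel, ex x, ex y]
    nlinarith
  have hrefl : G = ∑ i ∈ Finset.range (2 * q + 1), x ^ (2 * q + 1 - 1 - i) * y ^ i := by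
    rw [hG, ← Finset.sum_range_reflect]
    refine Finset.sum_congr rfl fun i hi => ?_
    have hi' : i ≤ 2 * q := by have := Finset.mem_range.1 hi; omega
    congr 2
    omega
  have h2G : G + G ≤ (2 * q + 1 : ℝ) * (x ^ (2 * q) + y ^ (2 * q)) := by
    conv_lhs => rw [hrefl]
    rw [← hrefl]
    nth_rewrite 2 [hrefl]
    rw [hG, ← Finset.sum_add_distrib]
    refine (Finset.sum_le_sum hpair).trans ?_
    rw [Finset.sum_const, Finset.card_range, nsmul_eq_mul]
    push_cast
    exact le_refl _
  rw [← hg]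
  have : (x - y) * (G * (x - y)) = (x - y) ^ 2 * G := by ring
  rw [this]
  nlinarith [sq_nonneg (x - y)]

section Trace

variable {ι : Type*} [Fintype ι] [DecidableEq ι]

theorem conj_diagonal_pow {O : Matrix ι ι ℝ} (hO : Oᵀ * O = 1) (hO' : O * Oᵀ = 1) (d : ι → ℝ)
    (k : ℕ) : (O * Matrix.diagonal d * Oᵀ) ^ k = O * Matrix.diagonal (fun i => d i ^ k) * Oᵀ := by
  induction k with
  | zero => simp [hO']
  | succ k ih =>
    rw [pow_succ, ih, conj_diagonal_mul hO]
    simp only [pow_succ]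

/-- Joint spectral representation of the traces `tr (S ^ k * A ^ l)`. -/
theorem exists_trace_pow_mul_pow {S A : Matrix ι ι ℝ} (hS : Sᵀ = S) (hA : Aᵀ = A) :
    ∃ (c : ι → ι → ℝ) (s a : ι → ℝ), (∀ i j, 0 ≤ c i j) ∧
      ∀ k l : ℕ, (S ^ k * A ^ l).trace = ∑ i, ∑ j, c i j * (s i ^ k * a j ^ l) := by
  obtain ⟨O, s, hO, hO', eS⟩ := exists_orthogonal_diagonalization hS
  obtain ⟨Q, a, hQ, hQ', eA⟩ := exists_orthogonal_diagonalization hA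
  refine ⟨fun i j => (Oᵀ * Q) i j ^ 2, s, a, fun i j => sq_nonneg _, fun k l => ?_⟩
  rw [eS, eA, conj_diagonal_pow hO hO', conj_diagonal_pow hQ hQ']
  set D := (Matrix.diagonal fun i => s i ^ k : Matrix ι ι ℝ)
  set D' := (Matrix.diagonal fun i => a i ^ l : Matrix ι ι ℝ)
  have e : (O * D * Oᵀ * (Q * D' * Qᵀ)).trace = (D * (Oᵀ * Q) * D' * (Oᵀ * Q)ᵀ).trace := by
    rw [Matrix.transpose_mul, Matrix.transpose_transpose]
    calc (O * D * Oᵀ * (Q * D' * Qᵀ)).trace = (O * (D * Oᵀ * (Q * D' * Qᵀ))).trace := by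
          simp only [Matrix.mul_assoc]
      _ = ((D * Oᵀ * (Q * D' * Qᵀ)) * O).trace := Matrix.trace_mul_comm _ _
      _ = _ := by simp only [Matrix.mul_assoc]
  rw [e]
  simp only [Matrix.trace, Matrix.diag_apply]
  refine Finset.sum_congr rfl fun i _ => ?_
  rw [Matrix.mul_apply]
  refine Finset.sum_congr rfl fun j _ => ?_
  rw [Matrix.mul_diagonal, Matrix.diagonal_mul, Matrix.transpose_apply]
  ring

/-- Although S and A need not commute, cyclicity reduces every trace here to the form tr(S^k A^l).
With the nonnegative weights of `exists_trace_pow_mul_pow`, the scalar inequality can then be summed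
over pairs of eigenvalues. -/
theorem trace_sub_mul_pow_sub_pow_le {S A : Matrix ι ι ℝ} (hS : Sᵀ = S) (hA : Aᵀ = A) (q : ℕ) :
    ((S - A) * (S ^ (2 * q + 1) - A ^ (2 * q + 1))).trace ≤
      (2 * q + 1 : ℝ) / 2 * (((S - A) * (S - A) * S ^ (2 * q)).trace +
        ((S - A) * (S - A) * A ^ (2 * q)).trace) := by
  obtain ⟨c, s, a, hc, htr⟩ := exists_trace_pow_mul_pow hS hA
  have htr' : ∀ k l : ℕ, (A ^ l * S ^ k).trace = ∑ i, ∑ j, c i j * (s i ^ k * a j ^ l) :=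
    fun k l => by rw [Matrix.trace_mul_comm, htr]
  have e1 : ((S - A) * (S ^ (2 * q + 1) - A ^ (2 * q + 1))).trace =
      ∑ i, ∑ j, c i j * ((s i - a j) * (s i ^ (2 * q + 1) - a j ^ (2 * q + 1))) := by
    have : (S - A) * (S ^ (2 * q + 1) - A ^ (2 * q + 1)) =
        S ^ (2 * q + 2) * A ^ 0 - S ^ 1 * A ^ (2 * q + 1) - A ^ 1 * S ^ (2 * q + 1) +
          S ^ 0 * A ^ (2 * q + 2) := by
      rw [sub_mul, mul_sub, mul_sub, pow_zero, pow_zero, mul_one, one_mul, pow_one, pow_one,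
        ← pow_succ', ← pow_succ']
      abel
    rw [this, Matrix.trace_add, Matrix.trace_sub, Matrix.trace_sub, htr, htr, htr', htr]
    simp only [← Finset.sum_add_distrib, ← Finset.sum_sub_distrib]
    refine Finset.sum_congr rfl fun i _ => Finset.sum_congr rfl fun j _ => by ring
  have e2 : ((S - A) * (S - A) * S ^ (2 * q)).trace =
      ∑ i, ∑ j, c i j * ((s i - a j) ^ 2 * s i ^ (2 * q)) := by
    have : ((S - A) * (S - A) * S ^ (2 * q)).trace = (S ^ (2 * q + 2) * A ^ 0).trace -
        (S ^ (2 * q + 1) * A ^ 1).trace - (A ^ 1 * S ^ (2 * q + 1)).trace +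
          (A ^ 2 * S ^ (2 * q)).trace := by
      have h1 : (S * A * S ^ (2 * q)).trace = (S ^ (2 * q + 1) * A ^ 1).trace := by
        rw [Matrix.trace_mul_comm, ← mul_assoc, ← pow_succ, pow_one]
      have h2 : (S - A) * (S - A) * S ^ (2 * q) = S ^ (2 * q + 2) * A ^ 0 - S * A * S ^ (2 * q) -
          A ^ 1 * S ^ (2 * q + 1) + A ^ 2 * S ^ (2 * q) := by
        rw [sub_mul, mul_sub, mul_sub, sub_mul, sub_mul, sub_mul, pow_zero, mul_one, pow_one,
          pow_succ' S (2 * q + 1), pow_succ' S (2 * q), sq]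
        simp only [mul_assoc]
        abel
      rw [h2, Matrix.trace_add, Matrix.trace_sub, Matrix.trace_sub, h1]
    rw [this, htr, htr, htr', htr']
    simp only [← Finset.sum_add_distrib, ← Finset.sum_sub_distrib]
    refine Finset.sum_congr rfl fun i _ => Finset.sum_congr rfl fun j _ => by ring
  have e3 : ((S - A) * (S - A) * A ^ (2 * q)).trace =
      ∑ i, ∑ j, c i j * ((s i - a j) ^ 2 * a j ^ (2 * q)) := by
    have : ((S - A) * (S - A) * A ^ (2 * q)).trace = (S ^ 2 * A ^ (2 * q)).trace -
        (S ^ 1 * A ^ (2 * q + 1)).trace - (A ^ (2 * q + 1) * S ^ 1).trace +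
          (S ^ 0 * A ^ (2 * q + 2)).trace := by
      have h1 : (A * S * A ^ (2 * q)).trace = (A ^ (2 * q + 1) * S ^ 1).trace := by
        rw [Matrix.trace_mul_comm, ← mul_assoc, ← pow_succ, pow_one]
      have h2 : (S - A) * (S - A) * A ^ (2 * q) = S ^ 2 * A ^ (2 * q) - S ^ 1 * A ^ (2 * q + 1) -
          A * S * A ^ (2 * q) + S ^ 0 * A ^ (2 * q + 2) := by
        rw [sub_mul, mul_sub, mul_sub, sub_mul, sub_mul, sub_mul, pow_zero, one_mul, pow_one,
          pow_succ' A (2 * q + 1), pow_succ' A (2 * q), sq]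
        simp only [mul_assoc]
        abel
      rw [h2, Matrix.trace_add, Matrix.trace_sub, Matrix.trace_sub, h1]
    rw [this, htr, htr, htr', htr]
    simp only [← Finset.sum_add_distrib, ← Finset.sum_sub_distrib]
    refine Finset.sum_congr rfl fun i _ => Finset.sum_congr rfl fun j _ => by ring
  rw [e1, e2, e3, ← Finset.sum_add_distrib, Finset.mul_sum]
  refine Finset.sum_le_sum fun i _ => ?_
  rw [← Finset.sum_add_distrib, Finset.mul_sum]
  refine Finset.sum_le_sum fun j _ => ?_
  have := mul_le_mul_of_nonneg_left (sub_mul_pow_sub_pow_le (s i) (a j) q) (hc i j)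
  linarith

/-- Convexity of the trace of an even power, again by summing the scalar tangent inequality. After
integration it shows that removing an independent centred summand does not increase the moment. -/
theorem trace_pow_add_le {S A : Matrix ι ι ℝ} (hS : Sᵀ = S) (hA : Aᵀ = A) (q : ℕ) :
    (A ^ (2 * (q + 1))).trace + (2 * (q + 1) : ℝ) * ((S - A) * A ^ (2 * q + 1)).trace ≤
      (S ^ (2 * (q + 1))).trace := by
  obtain ⟨c, s, a, hc, htr⟩ := exists_trace_pow_mul_pow hS hA
  have e1 : (A ^ (2 * (q + 1))).trace = (S ^ 0 * A ^ (2 * (q + 1))).trace := by simp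
  have e2 : (S ^ (2 * (q + 1))).trace = (S ^ (2 * (q + 1)) * A ^ 0).trace := by simp
  have e3 : (S - A) * A ^ (2 * q + 1) = S ^ 1 * A ^ (2 * q + 1) - S ^ 0 * A ^ (2 * (q + 1)) := by
    rw [sub_mul, pow_one, pow_zero, one_mul, ← pow_succ']
    congr 1
  rw [e3, e1, e2, Matrix.trace_sub, htr, htr, htr, ← Finset.sum_sub_distrib, Finset.mul_sum,
    ← Finset.sum_add_distrib]
  refine Finset.sum_le_sum fun i _ => ?_
  rw [← Finset.sum_sub_distrib, Finset.mul_sum, ← Finset.sum_add_distrib]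
  refine Finset.sum_le_sum fun j _ => ?_
  have := mul_le_mul_of_nonneg_left (pow_tangent_le (s i) (a j) q) (hc i j)
  have e : a j ^ (2 * (q + 1)) = a j * a j ^ (2 * q + 1) := by ring
  rw [sub_mul, ← e] at this
  simp only [pow_zero, one_mul, mul_one, pow_one]
  linarith

theorem trace_pow_eq_sum {S : Matrix ι ι ℝ} (hS : Sᵀ = S) :
    ∃ d : ι → ℝ, (∀ k : ℕ, (S ^ k).trace = ∑ i, d i ^ k) ∧
      ∀ C, 0 ≤ C → (∀ i, |d i| ≤ C) → ‖S‖ ≤ C := by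
  obtain ⟨O, d, hO, hO', eS⟩ := exists_orthogonal_diagonalization hS
  refine ⟨d, fun k => ?_, fun C hC hd => by rw [eS]; exact norm_conj_diagonal_le hO d hC hd⟩
  rw [eS, conj_diagonal_pow hO hO', Matrix.trace_mul_comm, ← Matrix.mul_assoc, hO,
    Matrix.one_mul, Matrix.trace_diagonal]

/-- Young's inequality on eigenvalues; it exchanges a lower trace moment with a random weight for
the top moment, which can be absorbed, and a power of the weight. -/
theorem mul_trace_pow_le {S : Matrix ι ι ℝ} (hS : Sᵀ = S) (q : ℕ) {c : ℝ} (hc : 0 ≤ c) :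
    (q + 1 : ℝ) * (c * (S ^ (2 * q)).trace) ≤
      q * (S ^ (2 * (q + 1))).trace + Fintype.card ι * c ^ (q + 1) := by
  obtain ⟨d, htr, -⟩ := trace_pow_eq_sum hS
  rw [htr, htr, Finset.mul_sum, Finset.mul_sum, Finset.mul_sum, ← nsmul_eq_mul,
    ← Finset.card_univ, ← Finset.sum_const, ← Finset.sum_add_distrib]
  refine Finset.sum_le_sum fun i _ => ?_
  have := succ_mul_pow_mul_le (sq_nonneg (d i)) hc q
  rw [← pow_mul, ← pow_mul] at this
  linarith

theorem norm_pow_le_trace {S : Matrix ι ι ℝ} (hS : Sᵀ = S) (p : ℕ) (hp : p ≠ 0) :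
    ‖S‖ ^ (2 * p) ≤ (S ^ (2 * p)).trace := by
  obtain ⟨d, htr, hn⟩ := trace_pow_eq_sum hS
  rcases isEmpty_or_nonempty ι with hι | hι
  · have : S = 0 := by ext i; exact isEmptyElim i
    subst this
    simp [hp]
  obtain ⟨i, -, hi⟩ := Finset.exists_max_image Finset.univ (fun i => |d i|)
    Finset.univ_nonempty
  have h1 := hn |d i| (abs_nonneg _) (fun j => hi j (Finset.mem_univ j))
  rw [htr]
  calc ‖S‖ ^ (2 * p) ≤ |d i| ^ (2 * p) := pow_le_pow_left₀ (norm_nonneg _) h1 _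
    _ = d i ^ (2 * p) := by rw [pow_mul, sq_abs, ← pow_mul]
    _ ≤ _ := Finset.single_le_sum (f := fun i => d i ^ (2 * p))
        (fun j _ => by rw [pow_mul]; positivity) (Finset.mem_univ i)

theorem pow_even_diag_nonneg {S : Matrix ι ι ℝ} (hS : Sᵀ = S) (q : ℕ) (i : ι) :
    0 ≤ (S ^ (2 * q)) i i := by
  have hq : (S ^ q)ᵀ = S ^ q := by rw [Matrix.transpose_pow, hS]
  have : S ^ (2 * q) = S ^ q * (S ^ q)ᵀ := by rw [hq, ← pow_add, two_mul]
  rw [this, Matrix.mul_apply]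
  exact Finset.sum_nonneg fun j _ => by rw [Matrix.transpose_apply]; exact mul_self_nonneg _

theorem trace_pow_even_nonneg {S : Matrix ι ι ℝ} (hS : Sᵀ = S) (q : ℕ) :
    0 ≤ (S ^ (2 * q)).trace :=
  Finset.sum_nonneg fun i _ => pow_even_diag_nonneg hS q i

theorem trace_sq_mul_pow_even {S B : Matrix ι ι ℝ} (hS : Sᵀ = S) (hB : Bᵀ = B) (q : ℕ) :
    (B * B * S ^ (2 * q)).trace = frob (B * S ^ q) ^ 2 := by
  have hq : (S ^ q)ᵀ = S ^ q := by rw [Matrix.transpose_pow, hS]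
  have e : (B * B * S ^ (2 * q)).trace = ((B * S ^ q) * (B * S ^ q)ᵀ).trace := by
    rw [Matrix.transpose_mul, hq, hB, Matrix.trace_mul_comm (B * S ^ q),
      Matrix.trace_mul_comm (B * B), two_mul, pow_add]
    calc (S ^ q * S ^ q * (B * B)).trace = (S ^ q * (S ^ q * (B * B))).trace := by
          rw [Matrix.mul_assoc]
      _ = ((S ^ q * (B * B)) * S ^ q).trace := Matrix.trace_mul_comm _ _
      _ = _ := by simp only [Matrix.mul_assoc]
  rw [e, frob_sq]
  generalize B * S ^ q = C
  simp [Matrix.trace, Matrix.mul_apply, sq]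

/-- Both sides are squared Frobenius norms after multiplication by S^q. Separating F from Y
preserves the diagonal form of Y², which Y - F does not share. -/
theorem trace_sub_sq_mul_le {S Y F : Matrix ι ι ℝ} (hS : Sᵀ = S) (hY : Yᵀ = Y) (hF : Fᵀ = F)
    (q : ℕ) : ((Y - F) * (Y - F) * S ^ (2 * q)).trace ≤
      2 * (Y * Y * S ^ (2 * q)).trace + 2 * ‖F‖ ^ 2 * (S ^ (2 * q)).trace := by
  have h1 := trace_sq_mul_pow_even hS (B := Y - F) (by rw [Matrix.transpose_sub, hY, hF]) q
  have h2 := trace_sq_mul_pow_even hS hY q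
  have h3 := trace_sq_mul_pow_even hS (B := 1) Matrix.transpose_one q
  rw [one_mul, one_mul, one_mul] at h3
  rw [h1, h2, h3, mul_assoc, ← mul_pow]
  have h4 : frob (F * S ^ q) ^ 2 ≤ (‖F‖ * frob (S ^ q)) ^ 2 :=
    pow_le_pow_left₀ (frob_nonneg _) (frob_mul_le' _ _) 2
  have h5 : frob ((Y - F) * S ^ q) ^ 2 ≤ 2 * frob (Y * S ^ q) ^ 2 + 2 * frob (F * S ^ q) ^ 2 := by
    rw [sub_mul]
    simp only [frob_sq, Finset.mul_sum, ← Finset.sum_add_distrib]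
    refine Finset.sum_le_sum fun i _ => Finset.sum_le_sum fun j _ => ?_
    rw [Matrix.sub_apply]
    nlinarith [sq_nonneg ((Y * S ^ q) i j + (F * S ^ q) i j)]
  linarith

theorem trace_diagonal_mul_pow_le {S : Matrix ι ι ℝ} (hS : Sᵀ = S) (q : ℕ) {d : ι → ℝ} {c : ℝ}
    (hd : ∀ i, d i ≤ c) :
    (Matrix.diagonal d * S ^ (2 * q)).trace ≤ c * (S ^ (2 * q)).trace := by
  simp only [Matrix.trace, Matrix.diag_apply, Matrix.diagonal_mul, Finset.mul_sum]
  exact Finset.sum_le_sum fun i _ =>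
    mul_le_mul_of_nonneg_right (hd i) (pow_even_diag_nonneg hS q i)

end Trace

end LowRank

namespace LowRank

/-! ### Random variables with moments of all orders -/

section Moments

variable {Ω : Type*} [MeasurableSpace Ω] {P : Measure Ω}

/-- The random variable `f` has moments of all orders. -/
structure AllMoments (f : Ω → ℝ) (P : Measure Ω) : Prop where
  aesm : AEStronglyMeasurable f P
  integrable_pow : ∀ q : ℕ, Integrable (fun ω => |f ω| ^ q) P

theorem AllMoments.integrable {f : Ω → ℝ} (hf : AllMoments f P) : Integrable f P := by
  refine (hf.integrable_pow 1).mono' hf.aesm (Filter.Eventually.of_forall fun ω => ?_)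
  simp

theorem AllMoments.mono {f g : Ω → ℝ} (hg : AllMoments g P) (hf : AEStronglyMeasurable f P)
    (h : ∀ ω, |f ω| ≤ |g ω|) : AllMoments f P := by
  refine ⟨hf, fun q => (hg.integrable_pow q).mono' (hf.norm.pow q)
    (Filter.Eventually.of_forall fun ω => ?_)⟩
  rw [Real.norm_eq_abs, abs_pow, abs_abs]
  exact pow_le_pow_left₀ (abs_nonneg _) (h ω) q

theorem AllMoments.mul {f g : Ω → ℝ} (hf : AllMoments f P) (hg : AllMoments g P) :
    AllMoments (fun ω => f ω * g ω) P := by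
  refine ⟨hf.aesm.mul hg.aesm, fun q => ?_⟩
  refine ((hf.integrable_pow (2 * q)).add (hg.integrable_pow (2 * q))).mono'
    ((hf.aesm.mul hg.aesm).norm.pow q) (Filter.Eventually.of_forall fun ω => ?_)
  simp only [Pi.add_apply, Real.norm_eq_abs, abs_pow, abs_abs, abs_mul, mul_pow]
  rw [mul_comm 2 q, pow_mul, pow_mul]
  nlinarith [sq_nonneg (|f ω| ^ q - |g ω| ^ q), sq_nonneg (|f ω| ^ q), sq_nonneg (|g ω| ^ q)]

theorem AllMoments.add {f g : Ω → ℝ} (hf : AllMoments f P) (hg : AllMoments g P) :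
    AllMoments (fun ω => f ω + g ω) P := by
  refine ⟨hf.aesm.add hg.aesm, fun q => ?_⟩
  refine (((hf.integrable_pow q).add (hg.integrable_pow q)).const_mul (2 ^ q)).mono'
    ((hf.aesm.add hg.aesm).norm.pow q) (Filter.Eventually.of_forall fun ω => ?_)
  simp only [Pi.add_apply, Real.norm_eq_abs, abs_pow, abs_abs]
  have h1 : |f ω + g ω| ≤ 2 * max |f ω| |g ω| := by
    have := abs_add_le (f ω) (g ω)
    have := le_max_left |f ω| |g ω|
    have := le_max_right |f ω| |g ω|
    linarith
  refine (pow_le_pow_left₀ (abs_nonneg _) h1 q).trans ?_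
  rw [mul_pow]
  gcongr
  rcases max_choice |f ω| |g ω| with h | h <;> rw [h]
  · linarith [pow_nonneg (abs_nonneg (g ω)) q]
  · linarith [pow_nonneg (abs_nonneg (f ω)) q]

theorem AllMoments.const [IsFiniteMeasure P] (c : ℝ) : AllMoments (fun _ : Ω => c) P :=
  ⟨aestronglyMeasurable_const, fun _ => integrable_const _⟩

theorem AllMoments.neg {f : Ω → ℝ} (hf : AllMoments f P) : AllMoments (fun ω => - f ω) P :=
  hf.mono hf.aesm.neg fun ω => by rw [abs_neg]

theorem AllMoments.sub {f g : Ω → ℝ} (hf : AllMoments f P) (hg : AllMoments g P) :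
    AllMoments (fun ω => f ω - g ω) P := by
  simpa only [sub_eq_add_neg] using hf.add hg.neg

theorem AllMoments.sum [IsFiniteMeasure P] {κ : Type*} (s : Finset κ) {f : κ → Ω → ℝ}
    (hf : ∀ k ∈ s, AllMoments (f k) P) : AllMoments (fun ω => ∑ k ∈ s, f k ω) P := by
  classical
  induction s using Finset.induction_on with
  | empty => simpa using AllMoments.const (P := P) (0 : ℝ)
  | insert a s ha ih =>
    simp only [Finset.sum_insert ha]
    exact (hf a (Finset.mem_insert_self a s)).add
      (ih fun k hk => hf k (Finset.mem_insert_of_mem hk))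

theorem AllMoments.pow [IsFiniteMeasure P] {f : Ω → ℝ} (hf : AllMoments f P) (k : ℕ) :
    AllMoments (fun ω => f ω ^ k) P := by
  induction k with
  | zero => simpa using AllMoments.const (P := P) (1 : ℝ)
  | succ k ih => simpa only [pow_succ] using ih.mul hf

variable {ι : Type*} [Fintype ι] [DecidableEq ι]

/-- All entries of the random matrix `A` have moments of all orders. -/
def MatMoments (A : Ω → Matrix ι ι ℝ) (P : Measure Ω) : Prop :=
  ∀ i j, AllMoments (fun ω => A ω i j) P

omit [DecidableEq ι] in
theorem MatMoments.mul [IsFiniteMeasure P] {A B : Ω → Matrix ι ι ℝ} (hA : MatMoments A P)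
    (hB : MatMoments B P) : MatMoments (fun ω => A ω * B ω) P := fun i j => by
  simp only [Matrix.mul_apply]
  exact AllMoments.sum _ fun k _ => (hA i k).mul (hB k j)

theorem MatMoments.pow [IsFiniteMeasure P] {A : Ω → Matrix ι ι ℝ} (hA : MatMoments A P) (k : ℕ) :
    MatMoments (fun ω => A ω ^ k) P := by
  induction k with
  | zero => intro i j; simpa using AllMoments.const (P := P) ((1 : Matrix ι ι ℝ) i j)
  | succ k ih => simpa only [pow_succ] using ih.mul hA

omit [DecidableEq ι] in
theorem MatMoments.trace [IsFiniteMeasure P] {A : Ω → Matrix ι ι ℝ} (hA : MatMoments A P) :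
    AllMoments (fun ω => (A ω).trace) P := by
  simp only [Matrix.trace, Matrix.diag_apply]
  exact AllMoments.sum _ fun i _ => hA i i

omit [Fintype ι] [DecidableEq ι] in
theorem MatMoments.sum [IsFiniteMeasure P] {κ : Type*} (s : Finset κ) {A : κ → Ω → Matrix ι ι ℝ}
    (hA : ∀ k ∈ s, MatMoments (A k) P) : MatMoments (fun ω => ∑ k ∈ s, A k ω) P := fun i j => by
  simp only [Matrix.sum_apply]
  exact AllMoments.sum _ fun k hk => hA k hk i j

end Moments

/-! ### Moments of sums of independent symmetric random matrices -/

section MatrixMoments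

variable {Ω : Type*} [MeasurableSpace Ω] {P : Measure Ω} [IsProbabilityMeasure P]
  {ι : Type*} [Fintype ι] [DecidableEq ι] {𝒵 : Type*} [MeasurableSpace 𝒵] {T : ℕ}

theorem measurable_matrix_pow {β : Type*} [MeasurableSpace β] {A : β → Matrix ι ι ℝ}
    (hA : ∀ i j, Measurable fun b => A b i j) (k : ℕ) (i j : ι) :
    Measurable fun b => (A b ^ k) i j := by
  induction k generalizing i j with
  | zero => simp
  | succ k ih =>
    simp only [pow_succ, Matrix.mul_apply]
    exact Finset.measurable_sum _ fun l _ => (ih i l).mul (hA l j)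

/-- A moment inequality for a sum of independent centered symmetric random matrices
`g t (ζ t) - F`, in the case that the squares of the matrices `g t z` are diagonal. -/
theorem integral_trace_pow_le {ζ : Fin T → Ω → 𝒵} (hζ : iIndepFun ζ P)
    (hζm : ∀ t, Measurable (ζ t)) {g : Fin T → 𝒵 → Matrix ι ι ℝ} {y : Fin T → 𝒵 → ι → ℝ}
    {F : Matrix ι ι ℝ} (hgm : ∀ t i j, Measurable fun z => g t z i j)
    (hgs : ∀ t z, (g t z)ᵀ = g t z) (hsq : ∀ t z, g t z * g t z = Matrix.diagonal (y t z))
    (hFs : Fᵀ = F) (hmean : ∀ t i j, ∫ ω, g t (ζ t ω) i j ∂P = F i j)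
    (hmom : ∀ t, MatMoments (fun ω => g t (ζ t ω)) P) {v : ℝ} (hv0 : 0 ≤ v)
    (hv : ∀ t i, ∫ ω, y t (ζ t ω) i ∂P ≤ v) {d : Ω → ℝ} (hd : AllMoments d P)
    (hd0 : ∀ ω, 0 ≤ d ω) (hdb : ∀ ω i, ∑ t, y t (ζ t ω) i ≤ d ω) (q : ℕ) :
    ∫ ω, ((∑ t, (g t (ζ t ω) - F)) ^ (2 * (q + 1))).trace ∂P ≤
      Fintype.card ι *
        ∫ ω, (2 * (q + 1) * (d ω + T * v + 2 * T * ‖F‖ ^ 2)) ^ (q + 1) ∂P := by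
  set Z : Fin T → Ω → Matrix ι ι ℝ := fun t ω => g t (ζ t ω) - F with hZ
  set S : Ω → Matrix ι ι ℝ := fun ω => ∑ t, Z t ω with hS
  set S' : Fin T → Ω → Matrix ι ι ℝ := fun t ω => ∑ u ∈ Finset.univ.erase t, Z u ω with hS'
  set f := ‖F‖ ^ 2 with hf
  have hf0 : 0 ≤ f := sq_nonneg _
  have hZs : ∀ t ω, (Z t ω)ᵀ = Z t ω := fun t ω => by
    simp only [hZ]; rw [Matrix.transpose_sub, hgs, hFs]
  have hSs : ∀ ω, (S ω)ᵀ = S ω := fun ω => by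
    simp only [hS, Matrix.transpose_sum, hZs]
  have hS's : ∀ t ω, (S' t ω)ᵀ = S' t ω := fun t ω => by
    simp only [hS', Matrix.transpose_sum, hZs]
  have hSZ : ∀ t ω, S ω - S' t ω = Z t ω := fun t ω => by
    simp only [hS, hS']
    rw [← Finset.add_sum_erase _ _ (Finset.mem_univ t), add_sub_cancel_right]
  have mZ : ∀ t, MatMoments (Z t) P := fun t i j => by
    simp only [hZ, Matrix.sub_apply]
    exact (hmom t i j).sub (AllMoments.const _)
  have mS : MatMoments S P := MatMoments.sum _ fun t _ => mZ t
  have mS' : ∀ t, MatMoments (S' t) P := fun t => MatMoments.sum _ fun u _ => mZ u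
  have my : ∀ t i, AllMoments (fun ω => y t (ζ t ω) i) P := fun t i => by
    have := ((hmom t).mul (hmom t)) i i
    simpa only [hsq, Matrix.diagonal_apply_eq] using this
  have hym : ∀ t i, Measurable fun z => y t z i := fun t i => by
    have h : (fun z => y t z i) = fun z => ∑ k, g t z i k * g t z k i := by
      funext z
      have := congrFun (congrFun (hsq t z) i) i
      rw [Matrix.diagonal_apply_eq, Matrix.mul_apply] at this
      exact this.symm
    rw [h]
    exact Finset.measurable_sum _ fun k _ => (hgm t i k).mul (hgm t k i)
  -- independence of round `t` and the other rounds
  have hind : ∀ (t : Fin T) (φ : 𝒵 → ℝ) (k : ℕ) (i j : ι), Measurable φ →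
      IndepFun (fun ω => φ (ζ t ω)) (fun ω => (S' t ω ^ k) i j) P := by
    intro t φ k i j hφ
    have h := hζ.indepFun_finset {t} (Finset.univ.erase t) (by simp) hζm
    have h2 := h.comp (φ := fun x : ((↥({t} : Finset (Fin T))) → 𝒵) =>
        φ (x ⟨t, Finset.mem_singleton_self t⟩))
      (ψ := fun x : ((↥(Finset.univ.erase t)) → 𝒵) =>
        ((∑ u, (g u.1 (x u) - F)) ^ k) i j)
      (hφ.comp (measurable_pi_apply _))
      (measurable_matrix_pow (fun a b => by
        simp only [Matrix.sum_apply, Matrix.sub_apply]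
        exact Finset.measurable_sum _ fun u _ =>
          ((hgm u.1 a b).comp (measurable_pi_apply u)).sub_const _) k i j)
    have e : (fun ω => (S' t ω ^ k) i j) =
        fun ω => ((∑ u : ↥(Finset.univ.erase t), (g u.1 (ζ u.1 ω) - F)) ^ k) i j := by
      funext ω
      simp only [hS', hZ]
      rw [← Finset.sum_coe_sort (Finset.univ.erase t) (fun u => g u (ζ u ω) - F)]
    rw [e]
    exact h2
  -- vanishing of the first order terms
  have hzero : ∀ (t : Fin T) (k : ℕ), ∫ ω, (Z t ω * S' t ω ^ k).trace ∂P = 0 := by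
    intro t k
    simp only [Matrix.trace, Matrix.diag_apply, Matrix.mul_apply]
    have hint : ∀ i j, Integrable (fun ω => Z t ω i j * (S' t ω ^ k) j i) P := fun i j =>
      ((mZ t i j).mul ((mS' t).pow k j i)).integrable
    rw [integral_finsetSum _ fun i _ => integrable_finsetSum _ fun j _ => hint i j]
    refine Finset.sum_eq_zero fun i _ => ?_
    rw [integral_finsetSum _ fun j _ => hint i j]
    refine Finset.sum_eq_zero fun j _ => ?_
    have hi := hind t (fun z => g t z i j - F i j) k j i ((hgm t i j).sub_const _)
    have hz : ∫ ω, Z t ω i j ∂P = 0 := by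
      simp only [hZ, Matrix.sub_apply]
      rw [integral_sub (hmom t i j).integrable (integrable_const _), hmean]
      simp
    have := hi.integral_fun_mul_eq_mul_integral (mZ t i j).aesm ((mS' t).pow k j i).aesm
    simp only [hZ, Matrix.sub_apply] at this hz ⊢
    rw [this, hz, zero_mul]
  -- removing one round decreases the moments
  have hmono : ∀ t, ∫ ω, (S' t ω ^ (2 * q)).trace ∂P ≤ ∫ ω, (S ω ^ (2 * q)).trace ∂P := by
    intro t
    rcases q with _ | q
    · simp
    have hk : ∀ ω, (S' t ω ^ (2 * (q + 1))).trace +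
        (2 * (q + 1) : ℝ) * (Z t ω * S' t ω ^ (2 * q + 1)).trace ≤
          (S ω ^ (2 * (q + 1))).trace := fun ω => by
      rw [← hSZ t ω]
      exact trace_pow_add_le (hSs ω) (hS's t ω) q
    have h1 := integral_mono (μ := P)
      (((mS' t).pow (2 * (q + 1))).trace.integrable.add
        ((((mZ t).mul ((mS' t).pow (2 * q + 1))).trace.integrable).const_mul _))
      (mS.pow (2 * (q + 1))).trace.integrable hk
    simp only [Pi.add_apply] at h1
    rw [integral_add ((mS' t).pow (2 * (q + 1))).trace.integrable
      ((((mZ t).mul ((mS' t).pow (2 * q + 1))).trace.integrable).const_mul _),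
      integral_const_mul, hzero, mul_zero, add_zero] at h1
    exact h1
  have mdiag : ∀ t, AllMoments
      (fun ω => (Matrix.diagonal (y t (ζ t ω)) * S' t ω ^ (2 * q)).trace) P := fun t => by
    simp only [Matrix.trace, Matrix.diag_apply, Matrix.diagonal_mul]
    exact AllMoments.sum _ fun i _ => (my t i).mul ((mS' t).pow _ i i)
  have hdiag : ∀ t, ∫ ω, (Matrix.diagonal (y t (ζ t ω)) * S' t ω ^ (2 * q)).trace ∂P ≤
      v * ∫ ω, (S' t ω ^ (2 * q)).trace ∂P := by
    intro t
    simp only [Matrix.trace, Matrix.diag_apply, Matrix.diagonal_mul]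
    rw [integral_finsetSum _ fun i _ => ((my t i).mul ((mS' t).pow _ i i)).integrable,
      integral_finsetSum _ fun i _ => ((mS' t).pow _ i i).integrable, Finset.mul_sum]
    refine Finset.sum_le_sum fun i _ => ?_
    rw [(hind t (fun z => y t z i) (2 * q) i i (hym t i)).integral_fun_mul_eq_mul_integral
      (my t i).aesm ((mS' t).pow _ i i).aesm]
    exact mul_le_mul_of_nonneg_right (hv t i)
      (integral_nonneg fun ω => pow_even_diag_nonneg (hS's t ω) q i)
  -- pointwise expansion
  have hpoint : ∀ ω, (S ω ^ (2 * (q + 1))).trace ≤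
      ∑ t, (Z t ω * S' t ω ^ (2 * q + 1)).trace + (2 * q + 1 : ℝ) *
        ((d ω + T * f) * (S ω ^ (2 * q)).trace +
          ∑ t, ((Matrix.diagonal (y t (ζ t ω)) * S' t ω ^ (2 * q)).trace +
            f * (S' t ω ^ (2 * q)).trace)) := by
    intro ω
    have e1 : (S ω ^ (2 * (q + 1))).trace = ∑ t, (Z t ω * S ω ^ (2 * q + 1)).trace := by
      rw [← Matrix.trace_sum, ← Finset.sum_mul, show 2 * (q + 1) = 2 * q + 1 + 1 by ring, pow_succ']
    have e2 : ∀ t, (Z t ω * S ω ^ (2 * q + 1)).trace ≤ (Z t ω * S' t ω ^ (2 * q + 1)).trace +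
        (2 * q + 1 : ℝ) * ((Matrix.diagonal (y t (ζ t ω)) * S ω ^ (2 * q)).trace +
          f * (S ω ^ (2 * q)).trace + ((Matrix.diagonal (y t (ζ t ω)) * S' t ω ^ (2 * q)).trace +
            f * (S' t ω ^ (2 * q)).trace)) := by
      intro t
      have k1 := trace_sub_mul_pow_sub_pow_le (hSs ω) (hS's t ω) q
      rw [hSZ, mul_sub, Matrix.trace_sub] at k1
      have k2 := trace_sub_sq_mul_le (hSs ω) (hgs t (ζ t ω)) hFs q
      have k3 := trace_sub_sq_mul_le (hS's t ω) (hgs t (ζ t ω)) hFs q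
      rw [hsq, ← hf] at k2 k3
      change ((Z t ω) * (Z t ω) * S ω ^ (2 * q)).trace ≤ _ at k2
      change ((Z t ω) * (Z t ω) * S' t ω ^ (2 * q)).trace ≤ _ at k3
      -- The factor 2 lost in separating F from g cancels the 1/2 of the trace inequality.
      have k4 : (0 : ℝ) ≤ (2 * q + 1) / 2 := by positivity
      have k5 := mul_le_mul_of_nonneg_left (add_le_add k2 k3) k4
      linarith
    have e3 : ∑ t, (Matrix.diagonal (y t (ζ t ω)) * S ω ^ (2 * q)).trace ≤
        d ω * (S ω ^ (2 * q)).trace := by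
      rw [← Matrix.trace_sum, ← Finset.sum_mul]
      have : ∑ t, Matrix.diagonal (y t (ζ t ω)) =
          Matrix.diagonal (fun i => ∑ t, y t (ζ t ω) i) := by
        ext i j
        rw [Matrix.sum_apply]
        by_cases hij : i = j
        · subst hij; simp
        · simp [hij]
      rw [this]
      exact trace_diagonal_mul_pow_le (hSs ω) q (hdb ω)
    rw [e1]
    refine (Finset.sum_le_sum fun t _ => e2 t).trans ?_
    rw [Finset.sum_add_distrib, ← Finset.mul_sum, Finset.sum_add_distrib, Finset.sum_add_distrib]
    gcongr
    rw [add_mul]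
    gcongr
    rw [Finset.sum_const, Finset.card_univ, Fintype.card_fin, nsmul_eq_mul, mul_assoc]
  have mtr := (mS.pow (2 * q)).trace
  have mtr' := fun t => ((mS' t).pow (2 * q)).trace
  have mfirst := fun t => ((mZ t).mul ((mS' t).pow (2 * q + 1))).trace
  have mdf : AllMoments (fun ω => (d ω + T * f) * (S ω ^ (2 * q)).trace) P :=
    (hd.add (AllMoments.const _)).mul mtr
  have msec : ∀ t, AllMoments (fun ω => (Matrix.diagonal (y t (ζ t ω)) * S' t ω ^ (2 * q)).trace +
      f * (S' t ω ^ (2 * q)).trace) P := fun t =>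
    (mdiag t).add ((AllMoments.const f).mul (mtr' t))
  have hmain : ∫ ω, (S ω ^ (2 * (q + 1))).trace ∂P ≤ (2 * q + 1 : ℝ) *
      ∫ ω, (d ω + T * v + 2 * T * f) * (S ω ^ (2 * q)).trace ∂P := by
    have h1 := integral_mono (μ := P) (mS.pow (2 * (q + 1))).trace.integrable
      ((AllMoments.sum Finset.univ fun t _ => mfirst t).add ((AllMoments.const (2 * q + 1 : ℝ)).mul
        (mdf.add (AllMoments.sum Finset.univ fun t _ => msec t)))).integrable hpoint
    refine h1.trans ?_
    rw [integral_add (AllMoments.sum Finset.univ fun t _ => mfirst t).integrable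
      ((AllMoments.const (2 * q + 1 : ℝ)).mul
        (mdf.add (AllMoments.sum Finset.univ fun t _ => msec t))).integrable,
      integral_finsetSum _ fun t _ => (mfirst t).integrable,
      Finset.sum_eq_zero fun t _ => hzero t _, zero_add, integral_const_mul,
      integral_add mdf.integrable (AllMoments.sum Finset.univ fun t _ => msec t).integrable,
      integral_finsetSum _ fun t _ => (msec t).integrable]
    gcongr
    have hsec : ∀ t, ∫ ω, ((Matrix.diagonal (y t (ζ t ω)) * S' t ω ^ (2 * q)).trace +
        f * (S' t ω ^ (2 * q)).trace) ∂P ≤ (v + f) * ∫ ω, (S ω ^ (2 * q)).trace ∂P := by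
      intro t
      rw [integral_add (mdiag t).integrable ((AllMoments.const f).mul (mtr' t)).integrable,
        integral_const_mul]
      have := hdiag t
      have h3 := mul_le_mul_of_nonneg_left (hmono t) (add_nonneg hv0 hf0)
      linarith
    refine (add_le_add le_rfl (Finset.sum_le_sum fun t _ => hsec t)).trans ?_
    rw [Finset.sum_const, Finset.card_univ, Fintype.card_fin, nsmul_eq_mul, ← mul_assoc,
      ← integral_const_mul, ← integral_add mdf.integrable (mtr.integrable.const_mul _)]
    refine le_of_eq (integral_congr_ae (Filter.Eventually.of_forall fun ω => ?_))
    ring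
  -- Young's inequality
  set c : Ω → ℝ := fun ω => 2 * (q + 1) * (d ω + T * v + 2 * T * f) with hc
  have hd' : ∀ ω, 0 ≤ d ω + T * v + 2 * T * f := fun ω => by have := hd0 ω; positivity
  have hc0 : ∀ ω, 0 ≤ c ω := fun ω => by have := hd' ω; simp only [hc]; positivity
  have mc : AllMoments c P :=
    (AllMoments.const _).mul ((hd.add (AllMoments.const _)).add (AllMoments.const _))
  have hyoung := integral_mono (μ := P)
    ((AllMoments.const (q + 1 : ℝ)).mul (mc.mul mtr)).integrable
    (((AllMoments.const (q : ℝ)).mul (mS.pow (2 * (q + 1))).trace).add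
      ((AllMoments.const (Fintype.card ι : ℝ)).mul (mc.pow (q + 1)))).integrable
    (fun ω => mul_trace_pow_le (hSs ω) q (hc0 ω))
  rw [integral_add ((AllMoments.const (q : ℝ)).mul (mS.pow (2 * (q + 1))).trace).integrable
    ((AllMoments.const (Fintype.card ι : ℝ)).mul (mc.pow (q + 1))).integrable,
    integral_const_mul, integral_const_mul, integral_const_mul] at hyoung
  have hcd : ∫ ω, c ω * (S ω ^ (2 * q)).trace ∂P =
      2 * (q + 1) * ∫ ω, (d ω + T * v + 2 * T * f) * (S ω ^ (2 * q)).trace ∂P := by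
    rw [← integral_const_mul]
    refine integral_congr_ae (Filter.Eventually.of_forall fun ω => ?_)
    simp only [hc]; ring
  have hI : 0 ≤ ∫ ω, (d ω + T * v + 2 * T * f) * (S ω ^ (2 * q)).trace ∂P :=
    integral_nonneg fun ω => mul_nonneg (hd' ω) (trace_pow_even_nonneg (hSs ω) q)
  have hq : (0 : ℝ) ≤ q := Nat.cast_nonneg q
  rw [hcd] at hyoung
  -- The weight c is chosen so that the top moment is at most the integral of c times the lower
  -- trace; then q of the q + 1 copies of the top moment cancel in Young's inequality.
  have h6 : ∫ ω, (S ω ^ (2 * (q + 1))).trace ∂P ≤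
      2 * (q + 1) * ∫ ω, (d ω + T * v + 2 * T * f) * (S ω ^ (2 * q)).trace ∂P := by
    refine hmain.trans ?_
    gcongr
    linarith
  have h7 := mul_le_mul_of_nonneg_left h6 (by positivity : (0 : ℝ) ≤ q + 1)
  linarith

end MatrixMoments

end LowRank

namespace LowRank

/-! ### Scalar estimates for one round of sampling -/

section Round

variable {Ω : Type*} [MeasurableSpace Ω] {P : Measure Ω} [IsProbabilityMeasure P]
  {𝒞 : Type*} [Fintype 𝒞] [MeasurableSpace 𝒞] [MeasurableSingletonClass 𝒞]

/-- As X takes finitely many values, the variable is split along the events X = p and independence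
is used on each cell. -/
theorem integrable_and_integral_of_indep {X : Ω → 𝒞} {ξ : Ω → ℝ} {w : 𝒞 → ℝ} (hX : Measurable X)
    (hw : ∀ p, P.real {ω | X ω = p} = w p) (hind : IndepFun X ξ P)
    {φ : 𝒞 → ℝ → ℝ} (hφ : ∀ p, Measurable (φ p)) (hint : ∀ p, Integrable (fun ω => φ p (ξ ω)) P) :
    Integrable (fun ω => φ (X ω) (ξ ω)) P ∧
      ∫ ω, φ (X ω) (ξ ω) ∂P = ∑ p, w p * ∫ ω, φ p (ξ ω) ∂P := by
  classical
  have e : (fun ω => φ (X ω) (ξ ω)) =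
      fun ω => ∑ p, ({p} : Set 𝒞).indicator (fun _ => (1 : ℝ)) (X ω) * φ p (ξ ω) := by
    funext ω
    rw [Finset.sum_eq_single (X ω)]
    · simp
    · intro p _ hp
      have : X ω ∉ ({p} : Set 𝒞) := fun h => hp (by simpa using h.symm)
      simp [Set.indicator_of_notMem this]
    · simp
  have hindm : ∀ p : 𝒞, Measurable (({p} : Set 𝒞).indicator (fun _ => (1 : ℝ))) := fun p =>
    measurable_const.indicator (measurableSet_singleton p)
  have hI : ∀ p, Integrable (fun ω => ({p} : Set 𝒞).indicator (fun _ => (1 : ℝ)) (X ω)) P := by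
    intro p
    refine (integrable_const (1 : ℝ)).mono' ((hindm p).comp hX).aestronglyMeasurable
      (Filter.Eventually.of_forall fun ω => ?_)
    by_cases h : X ω ∈ ({p} : Set 𝒞)
    · simp [Set.indicator_of_mem h]
    · simp [Set.indicator_of_notMem h]
  have hind' : ∀ p, IndepFun (fun ω => ({p} : Set 𝒞).indicator (fun _ => (1 : ℝ)) (X ω))
      (fun ω => φ p (ξ ω)) P := fun p => hind.comp (hindm p) (hφ p)
  have hmul : ∀ p, Integrable
      (fun ω => ({p} : Set 𝒞).indicator (fun _ => (1 : ℝ)) (X ω) * φ p (ξ ω)) P :=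
    fun p => (hind' p).integrable_mul (hI p) (hint p)
  rw [e]
  refine ⟨integrable_finsetSum _ fun p _ => hmul p, ?_⟩
  rw [integral_finsetSum _ fun p _ => hmul p]
  refine Finset.sum_congr rfl fun p _ => ?_
  rw [(hind' p).integral_fun_mul_eq_mul_integral (hI p).1 (hint p).1]
  congr 1
  rw [← hw p]
  have e2 : (fun ω => ({p} : Set 𝒞).indicator (fun _ => (1 : ℝ)) (X ω)) =
      {ω | X ω = p}.indicator (fun _ => (1 : ℝ)) := by
    funext ω
    simp [Set.indicator_apply]
  have hs : MeasurableSet {ω | X ω = p} := hX (measurableSet_singleton p)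
  rw [e2, integral_indicator hs]
  simp

omit [IsProbabilityMeasure P] in
theorem integral_exp_sq_gaussian {a : ℝ} (ha : a < 1 / 2) :
    ∫⁻ x, ENNReal.ofReal (Real.exp (a * x ^ 2)) ∂(gaussianReal 0 1) =
      ENNReal.ofReal (√(1 - 2 * a))⁻¹ := by
  rw [gaussianReal_of_var_ne_zero 0 one_ne_zero,
    lintegral_withDensity_eq_lintegral_mul _ (measurable_gaussianPDF 0 1) (by fun_prop)]
  have e : ∀ x : ℝ, (gaussianPDF 0 1 * fun x => ENNReal.ofReal (Real.exp (a * x ^ 2))) x =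
      ENNReal.ofReal ((√(2 * Real.pi))⁻¹ * Real.exp (-(1 / 2 - a) * x ^ 2)) := by
    intro x
    rw [Pi.mul_apply, gaussianPDF, ← ENNReal.ofReal_mul (gaussianPDFReal_nonneg _ _ _),
      gaussianPDFReal, mul_assoc, ← Real.exp_add]
    congr 3
    · simp
    · push_cast
      ring
  simp_rw [e]
  rw [← ofReal_integral_eq_lintegral_ofReal
    ((integrable_exp_neg_mul_sq (by linarith)).const_mul _)
    (Filter.Eventually.of_forall fun x => by positivity), integral_const_mul, integral_gaussian]
  congr 1
  have h1 : 0 < 1 / 2 - a := by linarith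
  rw [← Real.sqrt_inv, ← Real.sqrt_mul (by positivity), ← Real.sqrt_inv]
  congr 1
  have := Real.pi_pos.ne'
  have h2 : 1 - 2 * a ≠ 0 := by linarith
  have h3 : 1 / 2 - a ≠ 0 := h1.ne'
  field_simp

/-- Linearization by an auxiliary standard Gaussian g: exp(lam ξ²) is the mean over g of exp(√(2
lam) ξ g). Exchanging the integrals brings in the moment generating function of ξ, and what remains
is a Gaussian integral equal to (1 - 2 lam c)^(-1/2). -/
theorem HasSubgaussianMGF.integrable_exp_sq {ξ : Ω → ℝ} {c : ℝ≥0} (hξm : Measurable ξ)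
    (hξ : HasSubgaussianMGF ξ c P) {lam : ℝ} (hlam : 0 ≤ lam) (hc : 4 * lam * c ≤ 1) :
    Integrable (fun ω => Real.exp (lam * ξ ω ^ 2)) P ∧
      ∫ ω, Real.exp (lam * ξ ω ^ 2) ∂P ≤ 1 + 2 * lam * c := by
  have hc0 : (0 : ℝ) ≤ c := c.2
  have key : ∫⁻ ω, ENNReal.ofReal (Real.exp (lam * ξ ω ^ 2)) ∂P ≤
      ENNReal.ofReal (1 + 2 * lam * c) := by
    have h1 : ∀ x : ℝ, ENNReal.ofReal (Real.exp (lam * x ^ 2)) =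
        ∫⁻ g, ENNReal.ofReal (Real.exp (√(2 * lam) * x * g)) ∂(gaussianReal 0 1) := by
      intro x
      have h := congrFun (mgf_id_gaussianReal (μ := 0) (v := 1)) (√(2 * lam) * x)
      have hi := integrable_exp_mul_gaussianReal (μ := 0) (v := 1) (√(2 * lam) * x)
      rw [← ofReal_integral_eq_lintegral_ofReal hi
        (Filter.Eventually.of_forall fun g => (Real.exp_pos _).le)]
      congr 1
      simp only [mgf, id_eq] at h
      rw [h, zero_mul, zero_add, mul_pow, Real.sq_sqrt (by positivity)]
      congr 1
      push_cast
      ring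
    simp_rw [h1]
    rw [lintegral_lintegral_swap (by fun_prop)]
    have h2 : ∀ g : ℝ, ∫⁻ ω, ENNReal.ofReal (Real.exp (√(2 * lam) * ξ ω * g)) ∂P ≤
        ENNReal.ofReal (Real.exp ((lam * c) * g ^ 2)) := by
      intro g
      have hi := hξ.integrable_exp_mul (√(2 * lam) * g)
      have hle := hξ.mgf_le (√(2 * lam) * g)
      have e : ∀ ω, √(2 * lam) * ξ ω * g = √(2 * lam) * g * ξ ω := fun ω => by ring
      simp_rw [e]
      rw [← ofReal_integral_eq_lintegral_ofReal hi
        (Filter.Eventually.of_forall fun g => (Real.exp_pos _).le)]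
      refine ENNReal.ofReal_le_ofReal (hle.trans (le_of_eq ?_))
      rw [mul_pow, Real.sq_sqrt (by positivity)]
      congr 1
      ring
    refine (lintegral_mono h2).trans ?_
    rw [integral_exp_sq_gaussian (by nlinarith)]
    refine ENNReal.ofReal_le_ofReal ?_
    set z := lam * c with hz
    have hz0 : 0 ≤ z := mul_nonneg hlam hc0
    have hz1 : 4 * z ≤ 1 := by rw [hz]; linarith
    have e : 1 + 2 * lam * c = 1 + 2 * z := by rw [hz]; ring
    rw [e, inv_le_comm₀ (Real.sqrt_pos.2 (by linarith)) (by linarith)]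
    refine Real.le_sqrt_of_sq_le ?_
    rw [inv_pow, inv_le_comm₀ (by positivity) (by linarith), inv_le_iff_one_le_mul₀ (by linarith)]
    nlinarith [mul_nonneg hz0 hz0]
  have hint : Integrable (fun ω => Real.exp (lam * ξ ω ^ 2)) P := by
    refine ⟨(by fun_prop : Measurable fun ω => Real.exp (lam * ξ ω ^ 2)).aestronglyMeasurable, ?_⟩
    rw [hasFiniteIntegral_iff_ofReal (Filter.Eventually.of_forall fun ω => (Real.exp_pos _).le)]
    exact key.trans_lt ENNReal.ofReal_lt_top
  refine ⟨hint, ?_⟩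
  rw [← ofReal_integral_eq_lintegral_ofReal hint
    (Filter.Eventually.of_forall fun ω => (Real.exp_pos _).le)] at key
  exact (ENNReal.ofReal_le_ofReal_iff (by positivity)).1 key

/-- The linear function a ↦ aμ lies below exp(ca²/2) - 1, which is quadratic near 0; hence the slope
μ vanishes. -/
theorem HasSubgaussianMGF.integral_eq_zero {ξ : Ω → ℝ} {c : ℝ≥0}
    (hξ : HasSubgaussianMGF ξ c P) : ∫ ω, ξ ω ∂P = 0 := by
  have hc0 : (0 : ℝ) ≤ c := c.2
  have key : ∀ a : ℝ, a * ∫ ω, ξ ω ∂P ≤ Real.exp (c * a ^ 2 / 2) - 1 := by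
    intro a
    have h1 : ∫ ω, (a * ξ ω + 1) ∂P ≤ ∫ ω, Real.exp (a * ξ ω) ∂P :=
      integral_mono ((hξ.integrable.const_mul a).add (integrable_const 1))
        (hξ.integrable_exp_mul a) fun ω => Real.add_one_le_exp _
    rw [integral_add (hξ.integrable.const_mul a) (integrable_const 1), integral_const_mul] at h1
    simp only [integral_const, probReal_univ, smul_eq_mul, mul_one] at h1
    have := hξ.mgf_le a
    simp only [mgf] at this
    linarith
  set μ := ∫ ω, ξ ω ∂P with hμ
  have hsmall : ∀ a : ℝ, c * a ^ 2 ≤ 2 → a * μ ≤ c * a ^ 2 := by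
    intro a ha
    have h0 : 0 ≤ c * a ^ 2 / 2 := by positivity
    have h := Real.abs_exp_sub_one_sub_id_le (x := c * a ^ 2 / 2)
      (by rw [abs_of_nonneg h0]; linarith)
    have h2 := (abs_le.1 h).2
    have h3 := key a
    nlinarith
  by_contra hne
  have hμ2 : 0 < μ ^ 2 := by positivity
  -- The test point is a = sμ, with s so small that ca² ≤ 2 and cs < 1. Then sμ² ≤ (cs)(sμ²) is
  -- impossible unless μ = 0.
  set s : ℝ := 1 / (c * (1 + μ ^ 2) + 1) with hs
  have hden : 0 < c * (1 + μ ^ 2) + 1 := by positivity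
  have hs0 : 0 < s := by positivity
  have hs1 : s * (c * (1 + μ ^ 2) + 1) = 1 := by rw [hs]; field_simp
  have hcs : c * s < 1 := by nlinarith [mul_nonneg hc0 hs0.le, mul_nonneg (mul_nonneg hc0 hs0.le) hμ2.le]
  have hsle : s ≤ 1 := by nlinarith [mul_nonneg hc0 hs0.le, mul_nonneg (mul_nonneg hc0 hs0.le) hμ2.le]
  have hcsm : c * s * μ ^ 2 ≤ 1 := by nlinarith [mul_nonneg hc0 hs0.le]
  have h := hsmall (s * μ) (by
    have : c * (s * μ) ^ 2 = s * (c * s * μ ^ 2) := by ring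
    rw [this]; nlinarith)
  have e1 : s * μ * μ = s * μ ^ 2 := by ring
  have e2 : c * (s * μ) ^ 2 = (c * s) * (s * μ ^ 2) := by ring
  rw [e1, e2] at h
  have : 0 < s * μ ^ 2 := by positivity
  nlinarith

end Round

theorem exp_le_one_add_two_mul {z : ℝ} (h0 : 0 ≤ z) (h1 : z ≤ 1) : Real.exp z ≤ 1 + 2 * z := by
  have h := (abs_le.1 (Real.abs_exp_sub_one_sub_id_le (x := z)
    (by rw [abs_of_nonneg h0]; exact h1))).2
  nlinarith

/-- The scalar estimate behind Bernstein's inequality. -/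
theorem exp_add_sq_le {x y : ℝ} (hxy : |x| ≤ y) (hy : y ≤ 1 / 2) :
    Real.exp (x + y ^ 2 / 2) ≤ 1 + x + 3 * y ^ 2 := by
  obtain ⟨h1, h2⟩ := abs_le.1 hxy
  have hy0 : 0 ≤ y := (abs_nonneg x).trans hxy
  have hy2 : y ^ 2 ≤ y / 2 := by nlinarith
  have hz : |x + y ^ 2 / 2| ≤ 5 / 4 * y := by
    rw [abs_le]
    constructor <;> nlinarith
  have h := (abs_le.1 (Real.abs_exp_sub_one_sub_id_le (x := x + y ^ 2 / 2)
    (hz.trans (by linarith)))).2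
  have hsq : (x + y ^ 2 / 2) ^ 2 ≤ (5 / 4 * y) ^ 2 := by
    rw [← sq_abs]
    exact pow_le_pow_left₀ (abs_nonneg _) hz 2
  nlinarith

end LowRank

namespace LowRank

/-! ### The operator norm of the sampling noise -/

section Blocks

variable {m n : ℕ}

/-- The cells in the row or column indexed by `k`. -/
def block : Fin m ⊕ Fin n → Finset (Fin m × Fin n)
  | Sum.inl i => Finset.univ.filter fun p => p.1 = i
  | Sum.inr j => Finset.univ.filter fun p => p.2 = j

theorem mem_block_inl (p : Fin m × Fin n) (i : Fin m) :
    p ∈ block (Sum.inl i : Fin m ⊕ Fin n) ↔ p.1 = i := by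
  simp [block]

theorem mem_block_inr (p : Fin m × Fin n) (j : Fin n) :
    p ∈ block (Sum.inr j : Fin m ⊕ Fin n) ↔ p.2 = j := by
  simp [block]

theorem card_block_le (k : Fin m ⊕ Fin n) : (block k).card ≤ m + n := by
  rcases k with i | j
  · have : block (Sum.inl i : Fin m ⊕ Fin n) ⊆ ({i} : Finset (Fin m)) ×ˢ Finset.univ := by
      intro p hp
      rw [mem_block_inl] at hp
      rw [Finset.mem_product]
      simp [hp]
    refine (Finset.card_le_card this).trans ?_
    simp
  · have : block (Sum.inr j : Fin m ⊕ Fin n) ⊆ Finset.univ ×ˢ ({j} : Finset (Fin n)) := by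
      intro p hp
      rw [mem_block_inr] at hp
      rw [Finset.mem_product]
      simp [hp]
    refine (Finset.card_le_card this).trans ?_
    simp

/-- The dilated contribution of one observation to the empirical reward matrix. -/
noncomputable def sampleMat (T : ℕ) (M : Matrix (Fin m) (Fin n) ℝ) (w : Fin m × Fin n → ℝ)
    (z : (Fin m × Fin n) × ℝ) : Matrix (Fin m ⊕ Fin n) (Fin m ⊕ Fin n) ℝ :=
  dil (Matrix.single z.1.1 z.1.2 ((M z.1.1 z.1.2 + z.2) / (T * w z.1)))

/-- The diagonal of the square of `sampleMat`. -/
noncomputable def sampleSq (T : ℕ) (M : Matrix (Fin m) (Fin n) ℝ) (w : Fin m × Fin n → ℝ)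
    (z : (Fin m × Fin n) × ℝ) (k : Fin m ⊕ Fin n) : ℝ :=
  if z.1 ∈ block k then ((M z.1.1 z.1.2 + z.2) / (T * w z.1)) ^ 2 else 0

theorem dil_mul_dil (A : Matrix (Fin m) (Fin n) ℝ) :
    dil A * dil A = Matrix.fromBlocks (A * Aᵀ) 0 0 (Aᵀ * A) := by
  simp [dil, Matrix.fromBlocks_multiply]

/-- The dilation of a single entry exchanges two coordinates up to scale, so its square is diagonal.
This is the structure `integral_trace_pow_le` requires. -/
theorem sampleMat_mul_self (T : ℕ) (M : Matrix (Fin m) (Fin n) ℝ) (w : Fin m × Fin n → ℝ)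
    (z : (Fin m × Fin n) × ℝ) :
    sampleMat T M w z * sampleMat T M w z = Matrix.diagonal (sampleSq T M w z) := by
  obtain ⟨⟨i, j⟩, x⟩ := z
  rw [sampleMat, dil_mul_dil]
  set a := (M i j + x) / (T * w (i, j)) with ha
  simp only [Matrix.transpose_single]
  rw [Matrix.single_mul_single_same, Matrix.single_mul_single_same]
  ext k l
  rcases k with k | k <;> rcases l with l | l
  · simp only [Matrix.fromBlocks_apply₁₁, Matrix.single_apply, Matrix.diagonal_apply, sampleSq,
      mem_block_inl, Sum.inl.injEq, ← ha]
    by_cases h1 : i = k <;> by_cases h2 : k = l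
    · subst h1; subst h2; simp [sq]
    · subst h1; simp [h2]
    · subst h2; simp [h1]
    · simp [h1, h2]
  · simp
  · simp
  · simp only [Matrix.fromBlocks_apply₂₂, Matrix.single_apply, Matrix.diagonal_apply, sampleSq,
      mem_block_inr, Sum.inr.injEq, ← ha]
    by_cases h1 : j = k <;> by_cases h2 : k = l
    · subst h1; subst h2; simp [sq]
    · subst h1; simp [h2]
    · subst h2; simp [h1]
    · simp [h1, h2]

theorem abs_sampleMat_le (T : ℕ) (M : Matrix (Fin m) (Fin n) ℝ) (w : Fin m × Fin n → ℝ)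
    (z : (Fin m × Fin n) × ℝ) (k l : Fin m ⊕ Fin n) :
    |sampleMat T M w z k l| ≤ |(M z.1.1 z.1.2 + z.2) / (T * w z.1)| := by
  rcases k with k | k <;> rcases l with l | l <;>
    simp only [sampleMat, dil, Matrix.fromBlocks_apply₁₁, Matrix.fromBlocks_apply₁₂,
      Matrix.fromBlocks_apply₂₁, Matrix.fromBlocks_apply₂₂, Matrix.zero_apply, abs_zero,
      abs_nonneg, Matrix.transpose_apply, Matrix.single_apply]
  all_goals
    split_ifs
    · exact le_refl _
    · rw [abs_zero]; exact abs_nonneg _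

theorem measurable_sampleMat (T : ℕ) (M : Matrix (Fin m) (Fin n) ℝ) (w : Fin m × Fin n → ℝ)
    (k l : Fin m ⊕ Fin n) : Measurable fun z => sampleMat T M w z k l := by
  refine measurable_from_prod_countable_right fun p => ?_
  rcases k with k | k <;> rcases l with l | l <;>
    simp only [sampleMat, dil, Matrix.fromBlocks_apply₁₁, Matrix.fromBlocks_apply₁₂,
      Matrix.fromBlocks_apply₂₁, Matrix.fromBlocks_apply₂₂, Matrix.zero_apply,
      Matrix.transpose_apply, Matrix.single_apply]
  · exact measurable_const
  · split_ifs <;> fun_prop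
  · split_ifs <;> fun_prop
  · exact measurable_const

theorem measurable_sampleSq (T : ℕ) (M : Matrix (Fin m) (Fin n) ℝ) (w : Fin m × Fin n → ℝ)
    (k : Fin m ⊕ Fin n) : Measurable fun z => sampleSq T M w z k := by
  refine measurable_from_prod_countable_right fun p => ?_
  simp only [sampleSq]
  split_ifs <;> fun_prop

theorem sum_sampleMat_sub {T : ℕ} (hT : 0 < T) (M : Matrix (Fin m) (Fin n) ℝ)
    (w : Fin m × Fin n → ℝ) (x : Fin T → Fin m × Fin n) (e : Fin T → ℝ) :
    ∑ t, (sampleMat T M w (x t, e t) - dil ((1 / T : ℝ) • M)) =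
      dil (empiricalReward M w x e - M) := by
  have hT' : (T : ℝ) ≠ 0 := by positivity
  have key : ∀ i j, ∑ t, (Matrix.single (x t).1 (x t).2
      ((M (x t).1 (x t).2 + e t) / (T * w (x t))) i j - (1 / T : ℝ) * M i j) =
      empiricalReward M w x e i j - M i j := by
    intro i j
    rw [Finset.sum_sub_distrib, Finset.sum_const, Finset.card_univ, Fintype.card_fin, nsmul_eq_mul]
    congr 1
    · simp only [empiricalReward, Matrix.of_apply, Finset.mul_sum]
      refine Finset.sum_congr rfl fun t _ => ?_
      by_cases h : x t = (i, j)
      · simp [h]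
        ring
      · have : ¬ ((x t).1 = i ∧ (x t).2 = j) := fun h' => h (Prod.ext h'.1 h'.2)
        simp [h, this]
    · field_simp
  ext k l
  rw [Matrix.sum_apply]
  rcases k with k | k <;> rcases l with l | l
  · simp [sampleMat, dil]
  · simpa [sampleMat, dil] using key k l
  · simpa [sampleMat, dil, -Matrix.transpose_single] using key l k
  · simp [sampleMat, dil]

end Blocks

section OpNorm

variable {Ω : Type*} [MeasurableSpace Ω] {P : Measure Ω} [IsProbabilityMeasure P]
  {m n T : ℕ} {M : Matrix (Fin m) (Fin n) ℝ} {w : Fin m × Fin n → ℝ} {σ : ℝ≥0}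
  {X : Fin T → Ω → Fin m × Fin n} {ξ : Fin T → Ω → ℝ} {B w₀ : ℝ}

omit [IsProbabilityMeasure P] in
theorem HasSubgaussianMGF.allMoments [IsFiniteMeasure P] {ξ : Ω → ℝ} {c : ℝ≥0}
    (h : HasSubgaussianMGF ξ c P) : AllMoments ξ P := by
  refine ⟨h.aestronglyMeasurable, fun q => ?_⟩
  rcases q with _ | q
  · simp
  · exact (h.memLp ((q + 1 : ℕ) : ℝ≥0)).integrable_norm_pow (p := q + 1) (Nat.succ_ne_zero q)

theorem allMoments_sampleMat (hX : IsSampling P w σ X ξ) (hT : 0 < T)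
    (hM : ∀ p : Fin m × Fin n, |M p.1 p.2| ≤ B) (hw₀ : 0 < w₀) (hw : ∀ p, w₀ ≤ w p) (t : Fin T) :
    MatMoments (fun ω => sampleMat T M w (X t ω, ξ t ω)) P := by
  intro k l
  have hT' : (0 : ℝ) < T := by exact_mod_cast hT
  have habs : AllMoments (fun ω => |ξ t ω|) P :=
    (HasSubgaussianMGF.allMoments (hX.subgaussian t)).mono
      (hX.subgaussian t).aestronglyMeasurable.norm fun ω => by rw [abs_abs]
  refine (((AllMoments.const B).add habs).mul (AllMoments.const (T * w₀)⁻¹)).mono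
    ((measurable_sampleMat T M w k l).comp
      ((hX.measurable_X t).prodMk (hX.measurable_noise t))).aestronglyMeasurable fun ω => ?_
  refine (abs_sampleMat_le _ _ _ _ _ _).trans ?_
  have hB : 0 ≤ B := (abs_nonneg _).trans (hM (X t ω))
  have hwp := hw (X t ω)
  rw [abs_div, abs_of_nonneg (a := (B + |ξ t ω|) * (T * w₀)⁻¹) (by positivity), ← div_eq_mul_inv,
    abs_of_pos (a := (T : ℝ) * w (X t ω)) (mul_pos hT' (hw₀.trans_le hwp))]
  have h1 : |M (X t ω).1 (X t ω).2 + ξ t ω| ≤ B + |ξ t ω| :=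
    (abs_add_le _ _).trans (add_le_add (hM _) le_rfl)
  gcongr

theorem integral_sampleMat (hX : IsSampling P w σ X ξ) (hT : 0 < T) (hw : ∀ p, 0 < w p)
    (t : Fin T) (k l : Fin m ⊕ Fin n) :
    ∫ ω, sampleMat T M w (X t ω, ξ t ω) k l ∂P = dil ((1 / T : ℝ) • M) k l := by
  have hT' : (T : ℝ) ≠ 0 := by positivity
  have hξ0 := HasSubgaussianMGF.integral_eq_zero (hX.subgaussian t)
  have key : ∀ i j, ∫ ω, Matrix.single (X t ω).1 (X t ω).2
      ((M (X t ω).1 (X t ω).2 + ξ t ω) / (T * w (X t ω))) i j ∂P = (1 / T : ℝ) * M i j := by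
    intro i j
    have h := (integrable_and_integral_of_indep (hX.measurable_X t) (hX.law_X t)
      (hX.indep_noise t)
      (φ := fun p x => Matrix.single p.1 p.2 ((M p.1 p.2 + x) / (T * w p)) i j)
      (fun p => by simp only [Matrix.single_apply]; split_ifs <;> fun_prop)
      (fun p => by
        simp only [Matrix.single_apply]
        split_ifs
        · exact ((integrable_const _).add (hX.subgaussian t).integrable).div_const _
        · exact integrable_zero _ _ _)).2
    rw [h, Finset.sum_eq_single (i, j)]
    · have hw' := (hw (i, j)).ne'
      simp only [Matrix.single_apply, and_self, if_true]
      rw [integral_div, integral_add (integrable_const _) (hX.subgaussian t).integrable, hξ0]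
      simp
      field_simp
    · intro p _ hp
      have : ¬ (p.1 = i ∧ p.2 = j) := fun h' => hp (Prod.ext h'.1 h'.2)
      simp [this]
    · simp
  rcases k with k | k <;> rcases l with l | l
  · simp [sampleMat, dil]
  · simpa [sampleMat, dil] using key k l
  · simpa [sampleMat, dil, -Matrix.transpose_single] using key l k
  · simp [sampleMat, dil]

/-- Given cell p of the block, the exponent is at most 2γ_p + lam ξ², so its exponential has mean at
most exp(6γ_p) ≤ 1 + 12γ_p. The cell has probability w_p, and w_p γ_p is inversely proportional to
w_p, hence at most its value at w₀; a block has at most m + n cells. -/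
theorem integral_exp_sampleSq_le (hX : IsSampling P w σ X ξ) (hT : 0 < T)
    (hM : ∀ p : Fin m × Fin n, |M p.1 p.2| ≤ B) (hσ : (σ : ℝ) ≤ B) (hw₀ : 0 < w₀)
    (hw : ∀ p, w₀ ≤ w p) (hw1 : ∑ p, w p = 1) (t : Fin T) (k : Fin m ⊕ Fin n) {θ : ℝ}
    (hθ : 0 ≤ θ) (hθB : 8 * θ * B ^ 2 ≤ (T * w₀) ^ 2) :
    Integrable (fun ω => Real.exp (θ * sampleSq T M w (X t ω, ξ t ω) k)) P ∧
      ∫ ω, Real.exp (θ * sampleSq T M w (X t ω, ξ t ω) k) ∂P ≤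
        1 + 12 * θ * (B ^ 2 * (m + n) / (T ^ 2 * w₀)) := by
  have hT' : (0 : ℝ) < T := by exact_mod_cast hT
  have hσ0 : (0 : ℝ) ≤ σ := σ.2
  have hwpos : ∀ p, 0 < w p := fun p => hw₀.trans_le (hw p)
  set γ : Fin m × Fin n → ℝ := fun p => θ * B ^ 2 / (T * w p) ^ 2 with hγ
  have hγ0 : ∀ p, 0 ≤ γ p := fun p => by have := hwpos p; simp only [hγ]; positivity
  have hγ8 : ∀ p, 8 * γ p ≤ 1 := by
    intro p
    have h1 : (T * w₀) ^ 2 ≤ (T * w p) ^ 2 := by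
      have := hw p
      gcongr
    have h2 : 0 < (T * w p) ^ 2 := by have := hwpos p; positivity
    simp only [hγ]
    rw [← mul_div_assoc, div_le_one h2]
    linarith
  have hcell : ∀ p : Fin m × Fin n,
      Integrable (fun ω => Real.exp (θ * ((M p.1 p.2 + ξ t ω) / (T * w p)) ^ 2)) P ∧
        ∫ ω, Real.exp (θ * ((M p.1 p.2 + ξ t ω) / (T * w p)) ^ 2) ∂P ≤ 1 + 12 * γ p := by
    intro p
    have hwp := hwpos p
    set lam := 2 * θ / (T * w p) ^ 2 with hlam
    have hlam0 : 0 ≤ lam := by positivity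
    have hσ2 : (σ : ℝ) ^ 2 ≤ B ^ 2 := pow_le_pow_left₀ hσ0 hσ 2
    have hlσ : lam * (σ : ℝ) ^ 2 ≤ 2 * γ p := by
      have : 2 * γ p = lam * B ^ 2 := by simp only [hγ, hlam]; ring
      rw [this]
      gcongr
    have hsub := HasSubgaussianMGF.integrable_exp_sq (hX.measurable_noise t) (hX.subgaussian t)
      hlam0 (by push_cast; have := hγ8 p; linarith)
    have hpt : ∀ ω, Real.exp (θ * ((M p.1 p.2 + ξ t ω) / (T * w p)) ^ 2) ≤
        Real.exp (2 * γ p) * Real.exp (lam * ξ t ω ^ 2) := by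
      intro ω
      rw [← Real.exp_add]
      refine Real.exp_le_exp.2 ?_
      have h1 : (M p.1 p.2 + ξ t ω) ^ 2 ≤ 2 * B ^ 2 + 2 * ξ t ω ^ 2 := by
        have : M p.1 p.2 ^ 2 ≤ B ^ 2 := by
          rw [← sq_abs]
          exact pow_le_pow_left₀ (abs_nonneg _) (hM p) 2
        nlinarith [sq_nonneg (M p.1 p.2 - ξ t ω)]
      have h2 : 2 * γ p + lam * ξ t ω ^ 2 =
          θ / (T * w p) ^ 2 * (2 * B ^ 2 + 2 * ξ t ω ^ 2) := by
        simp only [hγ, hlam]; ring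
      rw [h2, div_pow, mul_div_assoc', mul_comm θ, mul_div_assoc, mul_comm]
      gcongr
    have hint : Integrable (fun ω => Real.exp (θ * ((M p.1 p.2 + ξ t ω) / (T * w p)) ^ 2)) P := by
      refine (hsub.1.const_mul (Real.exp (2 * γ p))).mono' ?_
        (Filter.Eventually.of_forall fun ω => ?_)
      · have := hX.measurable_noise t
        exact Measurable.aestronglyMeasurable (by fun_prop)
      · rw [Real.norm_eq_abs, abs_of_pos (Real.exp_pos _)]
        exact hpt ω
    refine ⟨hint, (integral_mono hint (hsub.1.const_mul _) hpt).trans ?_⟩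
    rw [integral_const_mul]
    have h3 : ∫ ω, Real.exp (lam * ξ t ω ^ 2) ∂P ≤ Real.exp (4 * γ p) := by
      refine hsub.2.trans ?_
      push_cast
      have := Real.add_one_le_exp (4 * γ p)
      linarith
    calc Real.exp (2 * γ p) * ∫ ω, Real.exp (lam * ξ t ω ^ 2) ∂P
        ≤ Real.exp (2 * γ p) * Real.exp (4 * γ p) := by gcongr
      _ = Real.exp (6 * γ p) := by rw [← Real.exp_add]; congr 1; ring
      _ ≤ 1 + 2 * (6 * γ p) := by
        refine exp_le_one_add_two_mul (by have := hγ0 p; linarith) ?_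
        have := hγ8 p
        linarith [hγ0 p]
      _ = _ := by ring
  have hφint : ∀ p, Integrable (fun ω => Real.exp (θ * sampleSq T M w (p, ξ t ω) k)) P := by
    intro p
    simp only [sampleSq]
    split_ifs
    · exact (hcell p).1
    · simp
  have hφle : ∀ p, ∫ ω, Real.exp (θ * sampleSq T M w (p, ξ t ω) k) ∂P ≤
      1 + if p ∈ block k then 12 * γ p else 0 := by
    intro p
    simp only [sampleSq]
    split_ifs
    · exact (hcell p).2
    · simp
  have h := integrable_and_integral_of_indep (hX.measurable_X t) (hX.law_X t) (hX.indep_noise t)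
    (φ := fun p x => Real.exp (θ * sampleSq T M w (p, x) k))
    (fun p => by
      have := (measurable_sampleSq T M w k).comp (measurable_prodMk_left (x := p))
      exact (this.const_mul θ).exp) hφint
  refine ⟨h.1, h.2.le.trans ?_⟩
  calc ∑ p, w p * ∫ ω, Real.exp (θ * sampleSq T M w (p, ξ t ω) k) ∂P
      ≤ ∑ p, (w p + if p ∈ block k then 12 * θ * (B ^ 2 / (T ^ 2 * w₀)) else 0) := by
        refine Finset.sum_le_sum fun p _ => ?_
        refine (mul_le_mul_of_nonneg_left (hφle p) (hwpos p).le).trans ?_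
        rw [mul_add, mul_one]
        gcongr
        split_ifs
        · have hwp := hwpos p
          have e : w p * (12 * γ p) = 12 * θ * (B ^ 2 / (T ^ 2 * w p)) := by
            simp only [hγ]
            field_simp
          rw [e]
          have := hw p
          gcongr
        · simp
    _ = 1 + (block k).card * (12 * θ * (B ^ 2 / (T ^ 2 * w₀))) := by
        rw [Finset.sum_add_distrib, hw1, Finset.sum_ite_mem, Finset.univ_inter, Finset.sum_const,
          nsmul_eq_mul]
    _ ≤ 1 + (m + n : ℝ) * (12 * θ * (B ^ 2 / (T ^ 2 * w₀))) := by
        have : ((block k).card : ℝ) ≤ m + n := by exact_mod_cast card_block_le k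
        gcongr
    _ = _ := by ring

end OpNorm

end LowRank

namespace LowRank

/-! ### Tail bound for the operator norm by the moment method -/

section OpNormTail

variable {Ω : Type*} [MeasurableSpace Ω] {P : Measure Ω} [IsProbabilityMeasure P]
  {m n T : ℕ} {M : Matrix (Fin m) (Fin n) ℝ} {w : Fin m × Fin n → ℝ} {σ : ℝ≥0}
  {X : Fin T → Ω → Fin m × Fin n} {ξ : Fin T → Ω → ℝ} {B w₀ : ℝ}

/-- The inequality z ≤ exp z at z = θx/p, raised to the power p. -/
theorem pow_le_mul_exp {x θ : ℝ} (hx : 0 ≤ x) (hθ : 0 < θ) {p : ℕ} (hp : 0 < p) :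
    x ^ p ≤ (p / θ) ^ p * Real.exp (θ * x) := by
  have hp' : (0 : ℝ) < p := by exact_mod_cast hp
  have h1 : θ * x / p ≤ Real.exp (θ * x / p) :=
    (by linarith : θ * x / p ≤ θ * x / p + 1).trans (Real.add_one_le_exp _)
  have h2 : x ≤ p / θ * Real.exp (θ * x / p) := by
    calc x = p / θ * (θ * x / p) := by field_simp
      _ ≤ _ := by gcongr
  refine (pow_le_pow_left₀ hx h2 p).trans (le_of_eq ?_)
  rw [mul_pow, ← Real.exp_nat_mul]
  congr 2
  field_simp

/-- Markov's inequality for the trace of the 2(q+1)-th power of the dilated noise. One factor m + n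
is the dimension in the trace bound, the other a union over rows and columns. The exponent 26
collects 12 from the sums of squares, 13 from the deterministic variance and mean terms, and 1 for
the decay. -/
theorem opNorm_noise_tail (hX : IsSampling P w σ X ξ) (hT : 0 < T)
    (hM : ∀ p : Fin m × Fin n, |M p.1 p.2| ≤ B) (hσ : (σ : ℝ) ≤ B) (hB : 0 < B) (hw₀ : 0 < w₀)
    (hw : ∀ p, w₀ ≤ w p) (hw1 : ∑ p, w p = 1) (hN : 2 ≤ m + n) (q : ℕ)
    (hq : 8 * (q + 1 : ℝ) ≤ T * w₀ * (m + n)) :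
    P.real {ω | 2 * Real.exp 26 * (q + 1) * (B ^ 2 * (m + n) / (T * w₀)) ≤
      ‖empiricalReward M w (fun t => X t ω) (fun t => ξ t ω) - M‖ ^ 2} ≤
        (m + n : ℝ) ^ 2 * Real.exp (-(q + 1)) := by
  have hT' : (0 : ℝ) < T := by exact_mod_cast hT
  have hN' : (2 : ℝ) ≤ m + n := by exact_mod_cast hN
  have hN0 : (0 : ℝ) < m + n := by linarith
  set K := B ^ 2 * (m + n) / (T * w₀) with hK
  have hK0 : 0 < K := by positivity
  have : Nonempty (Fin m ⊕ Fin n) := by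
    rw [← Fintype.card_pos_iff, Fintype.card_sum, Fintype.card_fin, Fintype.card_fin]; omega
  set F := dil ((1 / T : ℝ) • M) with hF
  set v := 12 * (B ^ 2 * (m + n) / (T ^ 2 * w₀)) with hv
  have hv0 : 0 ≤ v := by positivity
  have hTv : T * v = 12 * K := by rw [hv, hK]; field_simp
  -- the squared norm of the mean
  have hmn : (m * n : ℝ) * w₀ ≤ 1 := by
    rw [← hw1]
    calc (m * n : ℝ) * w₀ = ∑ _p : Fin m × Fin n, w₀ := by
          simp [Finset.sum_const, Fintype.card_prod]
      _ ≤ _ := Finset.sum_le_sum fun p _ => hw p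
  have hFn : 2 * T * ‖F‖ ^ 2 ≤ K := by
    have h1 : ‖F‖ ^ 2 ≤ (1 / T : ℝ) ^ 2 * (m * n * B ^ 2) := by
      have h2 : ‖F‖ ≤ frob ((1 / T : ℝ) • M) := (norm_dil_le _).trans (l2_opNorm_le_frob _)
      refine (pow_le_pow_left₀ (norm_nonneg _) h2 2).trans ?_
      rw [frob_sq]
      calc ∑ i, ∑ j, ((1 / T : ℝ) • M) i j ^ 2 ≤ ∑ _i : Fin m, ∑ _j : Fin n,
            (1 / T : ℝ) ^ 2 * B ^ 2 := by
            refine Finset.sum_le_sum fun i _ => Finset.sum_le_sum fun j _ => ?_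
            rw [Matrix.smul_apply, smul_eq_mul, mul_pow]
            gcongr 1
            rw [← sq_abs]
            exact pow_le_pow_left₀ (abs_nonneg _) (hM (i, j)) 2
        _ = _ := by simp; ring
    calc 2 * T * ‖F‖ ^ 2 ≤ 2 * T * ((1 / T : ℝ) ^ 2 * (m * n * B ^ 2)) := by gcongr
      _ = 2 * B ^ 2 / (T * w₀) * (m * n * w₀) := by field_simp
      _ ≤ 2 * B ^ 2 / (T * w₀) * 1 := by gcongr
      _ = B ^ 2 * 2 / (T * w₀) := by ring
      _ ≤ K := by rw [hK]; gcongr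
  -- the sums of squares
  set D : (Fin m ⊕ Fin n) → Ω → ℝ := fun k ω => ∑ t, sampleSq T M w (X t ω, ξ t ω) k with hD
  have hζm : ∀ t, Measurable fun ω => (X t ω, ξ t ω) := fun t =>
    (hX.measurable_X t).prodMk (hX.measurable_noise t)
  have hsqm : ∀ t k, Measurable fun ω => sampleSq T M w (X t ω, ξ t ω) k := fun t k =>
    (measurable_sampleSq T M w k).comp (hζm t)
  have hsq0 : ∀ z k, 0 ≤ sampleSq T M w z k := fun z k => by
    simp only [sampleSq]; split_ifs <;> positivity
  have hDm : ∀ k, Measurable (D k) := fun k => Finset.measurable_sum _ fun t _ => hsqm t k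
  have hD0 : ∀ k ω, 0 ≤ D k ω := fun k ω => Finset.sum_nonneg fun t _ => hsq0 _ _
  have mmat := fun t => allMoments_sampleMat hX hT hM hw₀ hw t
  have msq : ∀ t k, AllMoments (fun ω => sampleSq T M w (X t ω, ξ t ω) k) P := fun t k => by
    have := ((mmat t).mul (mmat t)) k k
    simpa only [sampleMat_mul_self, Matrix.diagonal_apply_eq] using this
  have mD : ∀ k, AllMoments (D k) P := fun k => AllMoments.sum _ fun t _ => msq t k
  have hDexp : ∀ (k : Fin m ⊕ Fin n) (θ : ℝ), 0 ≤ θ → 8 * θ * B ^ 2 ≤ (T * w₀) ^ 2 →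
      Integrable (fun ω => Real.exp (θ * D k ω)) P ∧
        ∫ ω, Real.exp (θ * D k ω) ∂P ≤ Real.exp (12 * θ * K) := by
    intro k θ hθ hθB
    have hone := fun t => integral_exp_sampleSq_le hX hT hM hσ hw₀ hw hw1 t k hθ hθB
    have hind : iIndepFun (fun t ω => sampleSq T M w (X t ω, ξ t ω) k) P :=
      hX.indep_rounds.comp (fun _ z => sampleSq T M w z k) fun _ => measurable_sampleSq T M w k
    have e : D k = ∑ t, fun ω => sampleSq T M w (X t ω, ξ t ω) k := by
      funext ω; simp [hD]
    constructor
    · have := hind.integrable_exp_mul_sum (t := θ) (s := Finset.univ) (fun t => hsqm t k)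
        (fun t _ => (hone t).1)
      rwa [← e] at this
    · have h := hind.mgf_sum (t := θ) (fun t => hsqm t k) Finset.univ
      rw [← e] at h
      change mgf (D k) P θ ≤ _
      rw [h]
      calc ∏ t, mgf (fun ω => sampleSq T M w (X t ω, ξ t ω) k) P θ
          ≤ ∏ _t : Fin T, Real.exp (12 * θ * (B ^ 2 * (m + n) / (T ^ 2 * w₀))) := by
            refine Finset.prod_le_prod (fun t _ => mgf_nonneg) fun t _ => ?_
            refine ((hone t).2).trans ?_
            have := Real.add_one_le_exp (12 * θ * (B ^ 2 * (m + n) / (T ^ 2 * w₀)))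
            linarith
        _ = Real.exp (12 * θ * K) := by
            rw [Finset.prod_const, Finset.card_univ, Fintype.card_fin, ← Real.exp_nat_mul]
            congr 1
            rw [hK]; field_simp
  -- the mean square of one round
  have hmeansq : ∀ t k, ∫ ω, sampleSq T M w (X t ω, ξ t ω) k ∂P ≤ v := by
    intro t k
    set θ := (T * w₀) ^ 2 / (8 * B ^ 2) with hθ
    have hθ0 : 0 < θ := by positivity
    have h := integral_exp_sampleSq_le hX hT hM hσ hw₀ hw hw1 t k hθ0.le
      (by rw [hθ]; field_simp; exact le_refl _)
    have h1 : ∫ ω, (θ * sampleSq T M w (X t ω, ξ t ω) k + 1) ∂P ≤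
        ∫ ω, Real.exp (θ * sampleSq T M w (X t ω, ξ t ω) k) ∂P :=
      integral_mono (((msq t k).integrable.const_mul θ).add (integrable_const 1)) h.1
        fun ω => Real.add_one_le_exp _
    rw [integral_add ((msq t k).integrable.const_mul θ) (integrable_const 1),
      integral_const_mul] at h1
    simp only [integral_const, probReal_univ, smul_eq_mul, mul_one] at h1
    have h2 : θ * ∫ ω, sampleSq T M w (X t ω, ξ t ω) k ∂P ≤ θ * v := by
      rw [hv]; linarith [h.2]
    exact le_of_mul_le_mul_left h2 hθ0
  -- The largest row or column sum of squares. Its exponential is later bounded by the sum of the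
  -- exponentials over k.
  set d : Ω → ℝ := Finset.univ.sup' Finset.univ_nonempty D with hd
  have hdm : Measurable d := Finset.measurable_sup' _ fun k _ => hDm k
  have hdD : ∀ ω k, D k ω ≤ d ω := fun ω k => by
    rw [hd, Finset.sup'_apply]
    exact Finset.le_sup' (fun k => D k ω) (Finset.mem_univ k)
  have hdex : ∀ ω, ∃ k, d ω = D k ω := fun ω => by
    rw [hd, Finset.sup'_apply]
    obtain ⟨k, -, hk⟩ := Finset.exists_mem_eq_sup' (Finset.univ_nonempty) (fun k => D k ω)
    exact ⟨k, hk⟩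
  have hd0 : ∀ ω, 0 ≤ d ω := fun ω => by
    obtain ⟨k, hk⟩ := hdex ω
    rw [hk]; exact hD0 k ω
  have hdsum : ∀ ω, d ω ≤ ∑ k, D k ω := fun ω => by
    obtain ⟨k, hk⟩ := hdex ω
    rw [hk]
    exact Finset.single_le_sum (f := fun k => D k ω) (fun k _ => hD0 k ω) (Finset.mem_univ k)
  have md : AllMoments d P :=
    (AllMoments.sum Finset.univ fun k _ => mD k).mono hdm.aestronglyMeasurable fun ω => by
      rw [abs_of_nonneg (hd0 ω), abs_of_nonneg (Finset.sum_nonneg fun k _ => hD0 k ω)]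
      exact hdsum ω
  have hmom := integral_trace_pow_le hX.indep_rounds hζm (g := fun _ => sampleMat T M w)
    (y := fun _ => sampleSq T M w) (F := F) (fun _ k l => measurable_sampleMat T M w k l)
    (fun _ z => dil_transpose _) (fun _ z => sampleMat_mul_self T M w z) (dil_transpose _)
    (fun t k l => integral_sampleMat hX hT (fun p => hw₀.trans_le (hw p)) t k l) mmat hv0 hmeansq
    md hd0 hdD q
  have hsum : ∀ ω, ∑ t, (sampleMat T M w (X t ω, ξ t ω) - F) =
      dil (empiricalReward M w (fun t => X t ω) (fun t => ξ t ω) - M) := fun ω =>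
    sum_sampleMat_sub hT M w (fun t => X t ω) (fun t => ξ t ω)
  -- the exponential bound for the right-hand side
  set p : ℕ := q + 1 with hp
  have hp0 : 0 < p := Nat.succ_pos q
  have hpc : ((p : ℕ) : ℝ) = q + 1 := by rw [hp]; push_cast; ring
  have hp0' : (0 : ℝ) < p := by exact_mod_cast hp0
  rw [← hpc] at hq ⊢
  simp only [← hpc] at hmom
  -- At this θ, `pow_le_mul_exp` produces exactly K^p, and every multiple of K in the exponent
  -- becomes a multiple of p. The hypothesis `hq` makes θ admissible for the exponential moments.
  set θ := (p : ℝ) / K with hθ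
  have hθ0 : 0 < θ := by positivity
  have hθB : 8 * θ * B ^ 2 ≤ (T * w₀) ^ 2 := by
    have : 8 * θ * B ^ 2 = 8 * p * (T * w₀) / (m + n) := by rw [hθ, hK]; field_simp
    rw [this, div_le_iff₀ hN0]
    have h1 : 0 < T * w₀ := by positivity
    nlinarith
  have hθK : θ * K = p := by rw [hθ]; field_simp
  have hpθ : (p : ℝ) / θ = K := by rw [hθ]; field_simp
  have hrhs : ∫ ω, (2 * p * (d ω + T * v + 2 * T * ‖F‖ ^ 2)) ^ p ∂P ≤
      (m + n) * ((2 * p * K) ^ p * Real.exp (25 * p)) := by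
    have hpt : ∀ ω, (2 * p * (d ω + T * v + 2 * T * ‖F‖ ^ 2)) ^ p ≤
        ∑ k, (2 * p * K) ^ p * Real.exp (13 * p) * Real.exp (θ * D k ω) := by
      intro ω
      have h1 : d ω + T * v + 2 * T * ‖F‖ ^ 2 ≤ d ω + 13 * K := by rw [hTv]; linarith
      have h2 : (d ω + 13 * K) ^ p ≤ K ^ p * Real.exp (θ * (d ω + 13 * K)) := by
        have := pow_le_mul_exp (x := d ω + 13 * K) (by have := hd0 ω; positivity) hθ0 hp0
        rwa [hpθ] at this
      have h3 : 0 ≤ d ω + T * v + 2 * T * ‖F‖ ^ 2 := by have := hd0 ω; positivity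
      have h4 : Real.exp (θ * (d ω + 13 * K)) = Real.exp (13 * p) * Real.exp (θ * d ω) := by
        rw [← Real.exp_add, ← hθK]; congr 1; ring
      calc (2 * p * (d ω + T * v + 2 * T * ‖F‖ ^ 2)) ^ p
          ≤ (2 * p * (d ω + 13 * K)) ^ p := by gcongr
        _ = (2 * p) ^ p * (d ω + 13 * K) ^ p := by rw [mul_pow]
        _ ≤ (2 * p) ^ p * (K ^ p * Real.exp (θ * (d ω + 13 * K))) := by gcongr
        _ = (2 * p * K) ^ p * Real.exp (13 * p) * Real.exp (θ * d ω) := by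
            rw [h4, mul_pow (2 * (p : ℝ)) K]; ring
        _ ≤ _ := by
            obtain ⟨k, hk⟩ := hdex ω
            rw [hk]
            exact Finset.single_le_sum
              (f := fun k => (2 * p * K) ^ p * Real.exp (13 * p) * Real.exp (θ * D k ω))
              (fun k _ => by positivity) (Finset.mem_univ k)
    have hI := fun k => hDexp k θ hθ0.le hθB
    refine (integral_mono (((AllMoments.const _).mul ((md.add (AllMoments.const _)).add
      (AllMoments.const _))).pow p).integrable
      (integrable_finsetSum _ fun k _ => (hI k).1.const_mul _) hpt).trans ?_
    rw [integral_finsetSum _ fun k _ => (hI k).1.const_mul _]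
    have hk : ∀ k ∈ Finset.univ (α := Fin m ⊕ Fin n),
        ∫ ω, (2 * p * K) ^ p * Real.exp (13 * p) * Real.exp (θ * D k ω) ∂P ≤
        (2 * p * K) ^ p * Real.exp (25 * p) := by
      intro k _
      rw [integral_const_mul, mul_assoc]
      gcongr
      calc Real.exp (13 * p) * ∫ ω, Real.exp (θ * D k ω) ∂P
          ≤ Real.exp (13 * p) * Real.exp (12 * θ * K) := by gcongr; exact (hI k).2
        _ = Real.exp (25 * p) := by
            rw [← Real.exp_add, mul_assoc, hθK]; congr 1; ring
    refine (Finset.sum_le_sum hk).trans (le_of_eq ?_)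
    simp [Finset.sum_const, Fintype.card_sum]
  -- Markov's inequality
  set E : Ω → Matrix (Fin m) (Fin n) ℝ := fun ω =>
    empiricalReward M w (fun t => X t ω) (fun t => ξ t ω) - M with hE
  simp only [hsum] at hmom
  have hcard : (Fintype.card (Fin m ⊕ Fin n) : ℝ) = m + n := by
    simp [Fintype.card_sum]
  rw [hcard] at hmom
  have htot : ∫ ω, (dil (E ω) ^ (2 * p)).trace ∂P ≤
      (m + n) * ((m + n) * ((2 * p * K) ^ p * Real.exp (25 * p))) :=
    hmom.trans (by gcongr)
  set u := 2 * Real.exp 26 * p * K with hu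
  have hu0 : 0 < u := by positivity
  have mtr : AllMoments (fun ω => (dil (E ω) ^ (2 * p)).trace) P := by
    have mS : MatMoments (fun ω => ∑ t, (sampleMat T M w (X t ω, ξ t ω) - F)) P :=
      MatMoments.sum _ fun t _ i j => ((mmat t) i j).sub (AllMoments.const _)
    have := (mS.pow (2 * p)).trace
    simpa only [hsum] using this
  have hmk := mul_meas_ge_le_integral_of_nonneg (μ := P)
    (Filter.Eventually.of_forall fun ω => trace_pow_even_nonneg (dil_transpose (E ω)) p)
    mtr.integrable (u ^ p)
  have hsubset : {ω | u ≤ ‖E ω‖ ^ 2} ⊆ {ω | u ^ p ≤ (dil (E ω) ^ (2 * p)).trace} := by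
    intro ω hω
    have h1 : u ≤ ‖E ω‖ ^ 2 := hω
    change u ^ p ≤ (dil (E ω) ^ (2 * p)).trace
    calc u ^ p ≤ (‖E ω‖ ^ 2) ^ p := pow_le_pow_left₀ hu0.le h1 p
      _ = ‖E ω‖ ^ (2 * p) := by rw [← pow_mul]
      _ ≤ ‖dil (E ω)‖ ^ (2 * p) := pow_le_pow_left₀ (norm_nonneg _) (norm_le_norm_dil _) _
      _ ≤ _ := norm_pow_le_trace (dil_transpose _) p hp0.ne'
  have hmeas := measureReal_mono (μ := P) hsubset
  have hup : (2 * p * K) ^ p * Real.exp (25 * p) = u ^ p * Real.exp (-p) := by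
    have : u = (2 * p * K) * Real.exp 26 := by rw [hu]; ring
    rw [this, mul_pow (2 * p * K) (Real.exp 26), ← Real.exp_nat_mul,
      mul_assoc ((2 * p * K) ^ p), ← Real.exp_add]
    congr 2
    ring
  refine hmeas.trans ?_
  have hfin : u ^ p * P.real {ω | u ^ p ≤ (dil (E ω) ^ (2 * p)).trace} ≤
      u ^ p * ((m + n : ℝ) ^ 2 * Real.exp (-p)) := by
    refine (hmk.trans htot).trans (le_of_eq ?_)
    rw [hup]; ring
  exact le_of_mul_le_mul_left hfin (by positivity)

end OpNormTail

end LowRank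

namespace LowRank

/-! ### Resampling the rounds that fall into a given set -/

section Resample

open scoped ENNReal

variable {𝒴 : Type*} [MeasurableSpace 𝒴]

open Classical in
-- Off B nothing changes; on B the replaced point contributes ν(B) times the conditional probability
-- of s, that is ν(s ∩ B).
theorem measurePreserving_resample (ν : Measure 𝒴) [IsProbabilityMeasure ν] {B : Set 𝒴}
    (hB : MeasurableSet B) (hνB : ν B ≠ 0) :
    MeasurePreserving (fun a : 𝒴 × 𝒴 => if a.1 ∈ B then a.2 else a.1) (ν.prod (ν[|B])) ν := by
  have hm : Measurable (fun a : 𝒴 × 𝒴 => if a.1 ∈ B then a.2 else a.1) :=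
    Measurable.ite (measurable_fst hB) measurable_snd measurable_fst
  have : IsProbabilityMeasure (ν[|B]) := cond_isProbabilityMeasure hνB
  refine ⟨hm, ?_⟩
  ext s hs
  rw [Measure.map_apply hm hs]
  have e : (fun a : 𝒴 × 𝒴 => if a.1 ∈ B then a.2 else a.1) ⁻¹' s =
      ((s \ B) ×ˢ Set.univ) ∪ (B ×ˢ s) := by
    ext ⟨a, b⟩
    by_cases h : a ∈ B <;> simp [h]
  have hdisj : Disjoint ((s \ B) ×ˢ (Set.univ : Set 𝒴)) (B ×ˢ s) := by
    rw [Set.disjoint_left]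
    rintro ⟨a, b⟩ h1 h2
    exact h1.1.2 h2.1
  rw [e, measure_union hdisj (hB.prod hs), Measure.prod_prod, Measure.prod_prod, measure_univ,
    mul_one, cond_apply hB, ← mul_assoc, ENNReal.mul_inv_cancel hνB (measure_ne_top _ _), one_mul,
    add_comm, Set.inter_comm, measure_inter_add_sdiff s hB]

open Classical in
/-- To bound the probability of an event it suffices to bound it conditionally, when the rounds
in `B` are resampled from the conditional law given `B` and the others are kept. -/
theorem pi_le_of_resample {T : ℕ} (ν : Fin T → Measure 𝒴) [∀ t, IsProbabilityMeasure (ν t)]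
    {B : Set 𝒴} (hB : MeasurableSet B) (hνB : ∀ t, ν t B ≠ 0) {A : Set (Fin T → 𝒴)}
    (hA : MeasurableSet A) {η : ℝ≥0∞}
    (h : ∀ y : Fin T → 𝒴, Measure.pi (fun t => (ν t)[|B])
      {y' | (∀ t, y' t ∈ B) ∧ (fun t => if y t ∈ B then y' t else y t) ∈ A} ≤ η) :
    Measure.pi ν A ≤ η := by
  have hprob : ∀ t, IsProbabilityMeasure ((ν t)[|B]) := fun t => cond_isProbabilityMeasure (hνB t)
  have mp1 := measurePreserving_pi (fun t => (ν t).prod ((ν t)[|B])) ν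
    (fun t => measurePreserving_resample (ν t) hB (hνB t))
  have mp2 := (measurePreserving_arrowProdEquivProdArrow 𝒴 𝒴 (Fin T) ν
    (fun t => (ν t)[|B])).symm
  have mp := mp1.comp mp2
  rw [← mp.measure_preimage hA.nullMeasurableSet,
    Measure.prod_apply (mp.measurable hA)]
  calc _ ≤ ∫⁻ _y, η ∂(Measure.pi ν) := by
        refine lintegral_mono fun y => ?_
        -- The fresh draws lie in B almost surely, so the hypothesis may be restricted to such y'.
        have hnull : Measure.pi (fun t => (ν t)[|B]) {y' | ¬ ∀ t, y' t ∈ B} = 0 := by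
          have : {y' : Fin T → 𝒴 | ¬ ∀ t, y' t ∈ B} = ⋃ t, Function.eval t ⁻¹' Bᶜ := by
            ext y'; simp
          rw [this]
          refine measure_iUnion_null fun t => Measure.pi_eval_preimage_null _ ?_
          rw [cond_apply hB, Set.inter_compl_self, measure_empty, mul_zero]
        refine le_trans ?_ (h y)
        refine le_trans (measure_mono (t := {y' | (∀ t, y' t ∈ B) ∧
          (fun t => if y t ∈ B then y' t else y t) ∈ A} ∪ {y' | ¬ ∀ t, y' t ∈ B}) ?_) ?_
        · intro y' hy'
          by_cases hb : ∀ t, y' t ∈ B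
          · exact Or.inl ⟨hb, hy'⟩
          · exact Or.inr hb
        · refine (measure_union_le _ _).trans ?_
          rw [hnull, add_zero]
    _ = η := by rw [lintegral_const, measure_univ, mul_one]

end Resample

/-! ### Bernstein's inequality -/

section Bernstein

variable {Ω : Type*} [MeasurableSpace Ω] {P : Measure Ω} [IsProbabilityMeasure P]

/-- Chernoff's method in two regimes: the Gaussian optimum θ = √x / s when it respects θR ≤ 1, and
otherwise the endpoint θ = 1/R. -/
theorem bernstein_upper {Z : Ω → ℝ} {μ s R x : ℝ} (hs : 0 ≤ s) (hR : 0 < R) (hx : 0 ≤ x)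
    (hint : ∀ θ, 0 ≤ θ → θ * R ≤ 1 → Integrable (fun ω => Real.exp (θ * Z ω)) P)
    (hmgf : ∀ θ, 0 ≤ θ → θ * R ≤ 1 → mgf Z P θ ≤ Real.exp (θ * μ + θ ^ 2 * s ^ 2)) :
    P.real {ω | μ + (2 * s * √x + 2 * R * x) ≤ Z ω} ≤ Real.exp (-x) := by
  set u := 2 * s * √x + 2 * R * x with hu
  have key : ∀ θ, 0 ≤ θ → θ * R ≤ 1 → θ ^ 2 * s ^ 2 - θ * u ≤ -x →
      P.real {ω | μ + u ≤ Z ω} ≤ Real.exp (-x) := by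
    intro θ h0 h1 h2
    refine (measure_ge_le_exp_mul_mgf (μ + u) h0 (hint θ h0 h1)).trans ?_
    calc Real.exp (-θ * (μ + u)) * mgf Z P θ
        ≤ Real.exp (-θ * (μ + u)) * Real.exp (θ * μ + θ ^ 2 * s ^ 2) := by
          gcongr; exact hmgf θ h0 h1
      _ = Real.exp (θ ^ 2 * s ^ 2 - θ * u) := by rw [← Real.exp_add]; congr 1; ring
      _ ≤ _ := Real.exp_le_exp.2 h2
  have hsx : √x ^ 2 = x := Real.sq_sqrt hx
  have hsx0 := Real.sqrt_nonneg x
  rcases le_or_gt (R * √x) s with hc | hc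
  -- If s = 0, the case hypothesis R√x ≤ s forces x = 0, and θ = 0 suffices.
  · rcases hs.eq_or_lt with h0 | h0
    · have hx0 : √x = 0 := by
        rw [← h0] at hc
        by_contra hne
        have : 0 < R * √x := by positivity
        linarith
      have : x = 0 := by rw [← hsx, hx0]; ring
      refine key 0 le_rfl (by simp) (by simp [this])
    · refine key (√x / s) (by positivity) ?_ ?_
      · rw [div_mul_eq_mul_div, div_le_one h0]; linarith
      · have e : (√x / s) ^ 2 * s ^ 2 = x := by
          rw [div_pow, hsx]; field_simp
        have e2 : √x / s * u = 2 * x + 2 * (√x / s) * R * x := by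
          have : √x / s * (2 * s * √x) = 2 * √x ^ 2 := by field_simp
          rw [hu, mul_add, this, hsx]; ring
        have h3 : 0 ≤ 2 * (√x / s) * R * x := by positivity
        rw [e, e2]; linarith
  · refine key (1 / R) (by positivity) (by field_simp; exact le_refl _) ?_
    have e1 : (1 / R) ^ 2 * s ^ 2 ≤ x := by
      rw [← mul_pow, ← hsx]
      refine pow_le_pow_left₀ (by positivity) ?_ 2
      rw [one_div, inv_mul_le_iff₀ hR]; exact hc.le
    have e2 : 1 / R * u = 2 * (1 / R) * s * √x + 2 * x := by rw [hu]; field_simp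
    have h3 : 0 ≤ 2 * (1 / R) * s * √x := by positivity
    rw [e2]; linarith

theorem bernstein_abs {Z : Ω → ℝ} {μ s R x : ℝ} (hs : 0 ≤ s) (hR : 0 < R) (hx : 0 ≤ x)
    (hint : ∀ θ, |θ| * R ≤ 1 → Integrable (fun ω => Real.exp (θ * Z ω)) P)
    (hmgf : ∀ θ, |θ| * R ≤ 1 → mgf Z P θ ≤ Real.exp (θ * μ + θ ^ 2 * s ^ 2)) :
    P.real {ω | 2 * s * √x + 2 * R * x ≤ |Z ω - μ|} ≤ 2 * Real.exp (-x) := by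
  have h1 := bernstein_upper (P := P) (Z := Z) (μ := μ) hs hR hx
    (fun θ h0 h => hint θ (by rwa [abs_of_nonneg h0]))
    (fun θ h0 h => hmgf θ (by rwa [abs_of_nonneg h0]))
  have h2 := bernstein_upper (P := P) (Z := fun ω => - Z ω) (μ := -μ) hs hR hx
    (fun θ h0 h => by
      have := hint (-θ) (by rwa [abs_neg, abs_of_nonneg h0])
      simpa only [neg_mul, mul_neg] using this)
    (fun θ h0 h => by
      have := hmgf (-θ) (by rwa [abs_neg, abs_of_nonneg h0])
      simpa only [mgf, neg_mul, mul_neg, even_two.neg_pow] using this)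
  refine (measureReal_mono (μ := P) (fun ω hω => ?_) ).trans
    ((measureReal_union_le _ _).trans (add_le_add h1 h2)) |>.trans (by linarith)
  have hω' : 2 * s * √x + 2 * R * x ≤ |Z ω - μ| := hω
  rcases le_abs'.1 hω' with h | h
  · right
    change -μ + (2 * s * √x + 2 * R * x) ≤ - Z ω
    linarith
  · left
    change μ + (2 * s * √x + 2 * R * x) ≤ Z ω
    linarith

end Bernstein

end LowRank

namespace LowRank

/-! ### Conditional concentration of linear forms in one row or column -/

section LinearForm

variable {Ω : Type*} [MeasurableSpace Ω] {P : Measure Ω} [IsProbabilityMeasure P]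
  {m n T : ℕ} {M : Matrix (Fin m) (Fin n) ℝ} {w : Fin m × Fin n → ℝ} {σ : ℝ≥0}
  {X : Fin T → Ω → Fin m × Fin n} {ξ : Fin T → Ω → ℝ} {B w₀ : ℝ}

theorem bernstein_sum {Y : Fin T → Ω → ℝ} (hY : iIndepFun Y P) (hYm : ∀ t, Measurable (Y t))
    (S : Finset (Fin T)) {μ v s R x : ℝ} (hs : 0 ≤ s) (hR : 0 < R) (hx : 0 ≤ x)
    (hint : ∀ t θ, |θ| * R ≤ 1 → Integrable (fun ω => Real.exp (θ * Y t ω)) P)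
    (hmgf : ∀ t θ, |θ| * R ≤ 1 → mgf (Y t) P θ ≤ Real.exp (θ * μ + θ ^ 2 * v))
    (hsv : S.card * v ≤ s ^ 2) :
    P.real {ω | 2 * s * √x + 2 * R * x ≤ |∑ t ∈ S, Y t ω - S.card * μ|} ≤ 2 * Real.exp (-x) := by
  have := bernstein_abs (P := P) (Z := ∑ t ∈ S, Y t) (μ := S.card * μ) hs hR hx
    (fun θ hθ => hY.integrable_exp_mul_sum hYm fun t _ => hint t θ hθ) (fun θ hθ => by
      rw [hY.mgf_sum hYm S]
      calc ∏ t ∈ S, mgf (Y t) P θ ≤ ∏ _t ∈ S, Real.exp (θ * μ + θ ^ 2 * v) :=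
            Finset.prod_le_prod (fun t _ => mgf_nonneg) fun t _ => hmgf t θ hθ
        _ = Real.exp (θ * (S.card * μ) + θ ^ 2 * (S.card * v)) := by
            rw [Finset.prod_const, ← Real.exp_nat_mul]; congr 1; ring
        _ ≤ _ := by gcongr)
  simpa only [Finset.sum_apply] using this

/-- The law of one round of sampling. -/
noncomputable def roundLaw (P : Measure Ω) (X : Fin T → Ω → Fin m × Fin n) (ξ : Fin T → Ω → ℝ)
    (t : Fin T) : Measure ((Fin m × Fin n) × ℝ) :=
  P.map fun ω => (X t ω, ξ t ω)

omit [IsProbabilityMeasure P] in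
theorem IsSampling.measurable_round (hX : IsSampling P w σ X ξ) (t : Fin T) :
    Measurable fun ω => (X t ω, ξ t ω) :=
  (hX.measurable_X t).prodMk (hX.measurable_noise t)

theorem IsSampling.isProbabilityMeasure_roundLaw (hX : IsSampling P w σ X ξ) (t : Fin T) :
    IsProbabilityMeasure (roundLaw P X ξ t) :=
  Measure.isProbabilityMeasure_map (hX.measurable_round t).aemeasurable

theorem IsSampling.map_rounds (hX : IsSampling P w σ X ξ) :
    P.map (fun ω t => (X t ω, ξ t ω)) = Measure.pi (roundLaw P X ξ) :=
  (iIndepFun_iff_map_fun_eq_pi_map fun t => (hX.measurable_round t).aemeasurable).1 hX.indep_rounds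

/-- The set of observations whose cell lies in `D`. -/
def cellsIn (D : Finset (Fin m × Fin n)) : Set ((Fin m × Fin n) × ℝ) := {z | z.1 ∈ D}

theorem measurableSet_cellsIn (D : Finset (Fin m × Fin n)) : MeasurableSet (cellsIn D) :=
  measurable_fst (D.measurableSet)

theorem IsSampling.integral_ite (hX : IsSampling P w σ X ξ) (t : Fin T)
    (D : Finset (Fin m × Fin n)) {g : (Fin m × Fin n) × ℝ → ℝ} (hg : Measurable g)
    (hint : ∀ p, Integrable (fun ω => g (p, ξ t ω)) P) :
    Integrable ((cellsIn D).indicator g) (roundLaw P X ξ t) ∧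
      ∫ z, (cellsIn D).indicator g z ∂(roundLaw P X ξ t) =
        ∑ p ∈ D, w p * ∫ ω, g (p, ξ t ω) ∂P := by
  have h := integrable_and_integral_of_indep (hX.measurable_X t) (hX.law_X t) (hX.indep_noise t)
    (φ := fun p x => (cellsIn D).indicator g (p, x))
    (fun p => (hg.indicator (measurableSet_cellsIn D)).comp measurable_prodMk_left)
    (fun p => by
      by_cases hp : p ∈ D
      · simpa [Set.indicator, cellsIn, hp] using hint p
      · simp [Set.indicator, cellsIn, hp])
  have hm := (hg.indicator (measurableSet_cellsIn D)).aestronglyMeasurable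
    (μ := roundLaw P X ξ t)
  refine ⟨(integrable_map_measure hm (hX.measurable_round t).aemeasurable).2 h.1, ?_⟩
  rw [roundLaw, integral_map (hX.measurable_round t).aemeasurable hm, h.2,
    ← Finset.sum_subset (Finset.subset_univ D)]
  · refine Finset.sum_congr rfl fun p hp => ?_
    simp [Set.indicator, cellsIn, hp]
  · intro p _ hp
    simp [Set.indicator, cellsIn, hp]

theorem IsSampling.roundLaw_cellsIn (hX : IsSampling P w σ X ξ) (t : Fin T)
    (D : Finset (Fin m × Fin n)) : (roundLaw P X ξ t).real (cellsIn D) = ∑ p ∈ D, w p := by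
  have := (hX.integral_ite t D (g := fun _ => 1) measurable_const
    (fun _ => integrable_const _)).2
  rw [integral_indicator (measurableSet_cellsIn D)] at this
  simpa using this

theorem IsSampling.integral_cond (hX : IsSampling P w σ X ξ) (t : Fin T)
    (D : Finset (Fin m × Fin n)) {g : (Fin m × Fin n) × ℝ → ℝ} (hg : Measurable g)
    (hint : ∀ p, Integrable (fun ω => g (p, ξ t ω)) P) (hD : 0 < ∑ p ∈ D, w p) :
    Integrable g ((roundLaw P X ξ t)[|cellsIn D]) ∧
      ∫ z, g z ∂((roundLaw P X ξ t)[|cellsIn D]) =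
        (∑ p ∈ D, w p)⁻¹ * ∑ p ∈ D, w p * ∫ ω, g (p, ξ t ω) ∂P := by
  have h := hX.integral_ite t D hg hint
  have hr := hX.roundLaw_cellsIn t D
  have hne : roundLaw P X ξ t (cellsIn D) ≠ 0 := by
    intro h0
    rw [measureReal_def, h0] at hr
    simp only [ENNReal.toReal_zero] at hr
    linarith
  rw [ProbabilityTheory.cond]
  constructor
  · exact ((integrable_indicator_iff (measurableSet_cellsIn D)).1 h.1).smul_measure
      (ENNReal.inv_ne_top.2 hne)
  · rw [integral_smul_measure, ← integral_indicator (measurableSet_cellsIn D), h.2,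
      ENNReal.toReal_inv, ← measureReal_def, hr, smul_eq_mul]

/-- The contribution of one observation to the linear form with coefficients `b`. -/
noncomputable def linTerm (T : ℕ) (M : Matrix (Fin m) (Fin n) ℝ) (w b : Fin m × Fin n → ℝ)
    (z : (Fin m × Fin n) × ℝ) : ℝ :=
  (M z.1.1 z.1.2 + z.2) * (b z.1 / (T * w z.1))

theorem measurable_linTerm (T : ℕ) (M : Matrix (Fin m) (Fin n) ℝ) (w b : Fin m × Fin n → ℝ) :
    Measurable (linTerm T M w b) := by
  have h1 : Measurable fun p : Fin m × Fin n => M p.1 p.2 := measurable_of_finite _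
  have h2 : Measurable fun p : Fin m × Fin n => b p / (T * w p) := measurable_of_finite _
  exact ((h1.comp measurable_fst).add measurable_snd).mul (h2.comp measurable_fst)

/-- Conditionally on D, cell p has probability w_p / W, with W the total weight of D. The importance
weight 1/(T w_p) cancels w_p at first order, giving the mean; at second order one factor 1/w_p
survives and is bounded by 1/w₀. -/
theorem IsSampling.linTerm_mgf_le (hX : IsSampling P w σ X ξ) (hT : 0 < T)
    (hM : ∀ p : Fin m × Fin n, |M p.1 p.2| ≤ B) (hσ : (σ : ℝ) ≤ B) (hB : 0 < B) (hw₀ : 0 < w₀)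
    (hw : ∀ p, w₀ ≤ w p) {D : Finset (Fin m × Fin n)} (hD : 0 < ∑ p ∈ D, w p)
    {b : Fin m × Fin n → ℝ} {bm q θ : ℝ} (hb : ∀ p ∈ D, |b p| ≤ bm) (hq : ∑ p ∈ D, b p ^ 2 ≤ q ^ 2)
    (hθ : |θ| * (2 * B * bm / (T * w₀)) ≤ 1) (t : Fin T) :
    Integrable (fun z => Real.exp (θ * linTerm T M w b z)) ((roundLaw P X ξ t)[|cellsIn D]) ∧
      mgf (linTerm T M w b) ((roundLaw P X ξ t)[|cellsIn D]) θ ≤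
        Real.exp (θ * ((∑ p ∈ D, M p.1 p.2 * b p) / (T * ∑ p ∈ D, w p)) +
          θ ^ 2 * (3 * B ^ 2 * q ^ 2 / (T ^ 2 * w₀ * ∑ p ∈ D, w p))) := by
  have hT' : (0 : ℝ) < T := by exact_mod_cast hT
  have hexp : ∀ p : Fin m × Fin n, ∀ y : ℝ, Real.exp (θ * linTerm T M w b (p, y)) =
      Real.exp (θ * (M p.1 p.2 * (b p / (T * w p)))) * Real.exp (θ * (b p / (T * w p)) * y) := by
    intro p y
    rw [← Real.exp_add, linTerm]; congr 1; ring
  have h := hX.integral_cond t D (g := fun z => Real.exp (θ * linTerm T M w b z))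
    ((measurable_linTerm T M w b).const_mul θ).exp
    (fun p => by
      simp only [hexp]
      exact ((hX.subgaussian t).integrable_exp_mul _).const_mul _) hD
  refine ⟨h.1, ?_⟩
  rw [mgf, h.2]
  set W := ∑ p ∈ D, w p with hW
  have hterm : ∀ p ∈ D, w p * ∫ ω, Real.exp (θ * linTerm T M w b (p, ξ t ω)) ∂P ≤
      w p + θ * (M p.1 p.2 * b p) / T + 3 * θ ^ 2 * B ^ 2 * b p ^ 2 / (T ^ 2 * w₀) := by
    intro p hp
    have hwp : 0 < w p := hw₀.trans_le (hw p)
    simp only [hexp]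
    rw [integral_const_mul]
    -- The number y bounds both the deterministic part of the exponent and the subgaussian scale of
    -- the noise part, as `exp_add_sq_le` requires.
    set y := |θ| * |b p| / (T * w p) * B with hy
    have hy0 : 0 ≤ y := by positivity
    have hyhalf : y ≤ 1 / 2 := by
      have h1 : y ≤ |θ| * bm / (T * w₀) * B := by
        rw [hy]
        have hbm := hb p hp
        have hbm0 : 0 ≤ bm := (abs_nonneg _).trans hbm
        have hwp' := hw p
        gcongr
      have h2 : |θ| * (2 * B * bm / (T * w₀)) = 2 * (|θ| * bm / (T * w₀) * B) := by ring
      linarith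
    have hmg : ∫ ω, Real.exp (θ * (b p / (T * w p)) * ξ t ω) ∂P ≤ Real.exp (y ^ 2 / 2) := by
      refine ((hX.subgaussian t).mgf_le _).trans (Real.exp_le_exp.2 ?_)
      have e : y ^ 2 = B ^ 2 * (θ * (b p / (T * w p))) ^ 2 := by
        rw [hy]
        have h3 : (|θ| * |b p| / (T * w p) * B) ^ 2 =
          B ^ 2 * (|θ| ^ 2 * |b p| ^ 2 / (T * w p) ^ 2) := by ring
        rw [h3, sq_abs, sq_abs]; ring
      rw [e]
      have : ((σ ^ 2 : ℝ≥0) : ℝ) ≤ B ^ 2 := by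
        push_cast
        exact pow_le_pow_left₀ (by positivity) hσ 2
      gcongr
    have hxy : |θ * (M p.1 p.2 * (b p / (T * w p)))| ≤ y := by
      rw [abs_mul, abs_mul, abs_div, abs_of_pos (show 0 < T * w p by positivity), hy]
      have := hM p
      calc |θ| * (|M p.1 p.2| * (|b p| / (T * w p)))
          ≤ |θ| * (B * (|b p| / (T * w p))) := by gcongr
        _ = _ := by ring
    calc w p * (Real.exp (θ * (M p.1 p.2 * (b p / (T * w p)))) *
          ∫ ω, Real.exp (θ * (b p / (T * w p)) * ξ t ω) ∂P)
        ≤ w p * (Real.exp (θ * (M p.1 p.2 * (b p / (T * w p)))) * Real.exp (y ^ 2 / 2)) := by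
          gcongr
      _ ≤ w p * (1 + θ * (M p.1 p.2 * (b p / (T * w p))) + 3 * y ^ 2) := by
          rw [← Real.exp_add]
          gcongr
          exact exp_add_sq_le hxy hyhalf
      _ = w p + θ * (M p.1 p.2 * b p) / T + 3 * θ ^ 2 * B ^ 2 * b p ^ 2 / (T ^ 2 * w p) := by
          have e : y ^ 2 = θ ^ 2 * b p ^ 2 / (T * w p) ^ 2 * B ^ 2 := by
            rw [hy, ← sq_abs θ, ← sq_abs (b p)]; ring
          rw [e]; field_simp
      _ ≤ _ := by
          have := hw p
          gcongr
  have hsum := Finset.sum_le_sum hterm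
  rw [Finset.sum_add_distrib, Finset.sum_add_distrib, ← hW, ← Finset.sum_div, ← Finset.sum_div,
    ← Finset.mul_sum, ← Finset.mul_sum] at hsum
  calc W⁻¹ * ∑ p ∈ D, w p * ∫ ω, Real.exp (θ * linTerm T M w b (p, ξ t ω)) ∂P
      ≤ W⁻¹ * (W + θ * (∑ p ∈ D, M p.1 p.2 * b p) / T +
          3 * θ ^ 2 * B ^ 2 * (q ^ 2) / (T ^ 2 * w₀)) := by
        refine mul_le_mul_of_nonneg_left (hsum.trans ?_) (by positivity)
        gcongr
    _ = θ * ((∑ p ∈ D, M p.1 p.2 * b p) / (T * W)) +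
          θ ^ 2 * (3 * B ^ 2 * q ^ 2 / (T ^ 2 * w₀ * W)) + 1 := by
        field_simp
        ring
    _ ≤ _ := Real.add_one_le_exp _

theorem sqrt_six_le : √6 ≤ 5 / 2 := by
  rw [Real.sqrt_le_left (by norm_num)]; norm_num

/-- Concentration of a linear form of the observations falling into `D`, conditionally on the
rounds in which they do so. -/
theorem IsSampling.linTerm_tail (hX : IsSampling P w σ X ξ) (hT : 0 < T)
    (hM : ∀ p : Fin m × Fin n, |M p.1 p.2| ≤ B) (hσ : (σ : ℝ) ≤ B) (hB : 0 < B) (hw₀ : 0 < w₀)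
    (hw : ∀ p, w₀ ≤ w p) {D : Finset (Fin m × Fin n)} (hD : D.Nonempty)
    {b : Fin m × Fin n → ℝ} {bm q x : ℝ} (hbm : 0 < bm) (hq0 : 0 ≤ q) (hx : 0 ≤ x)
    (hb : ∀ p ∈ D, |b p| ≤ bm) (hq : ∑ p ∈ D, b p ^ 2 ≤ q ^ 2)
    (hxD : 16 * x ≤ T * ∑ p ∈ D, w p) (S : Finset (Fin T))
    (hS : |(S.card : ℝ) - T * ∑ p ∈ D, w p| ≤ 2 * √(T * ∑ p ∈ D, w p) * √x + 2 * x) :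
    (Measure.pi fun t => (roundLaw P X ξ t)[|cellsIn D]).real
      {y | 8 * B * √(x / (T * w₀)) * q + 4 * B * x / (T * w₀) * bm ≤
        |∑ t ∈ S, linTerm T M w b (y t) - ∑ p ∈ D, M p.1 p.2 * b p|} ≤ 2 * Real.exp (-x) := by
  have hT' : (0 : ℝ) < T := by exact_mod_cast hT
  set W := ∑ p ∈ D, w p with hW
  have hcard : D.card * w₀ ≤ W := by
    rw [hW, ← nsmul_eq_mul]
    exact Finset.card_nsmul_le_sum _ _ _ fun p _ => hw p
  have hc0 : (0 : ℝ) < D.card := by exact_mod_cast hD.card_pos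
  have hW0 : 0 < W := lt_of_lt_of_le (by positivity) hcard
  have hprob : ∀ t, IsProbabilityMeasure ((roundLaw P X ξ t)[|cellsIn D]) := by
    intro t
    have := hX.isProbabilityMeasure_roundLaw t
    refine cond_isProbabilityMeasure fun h0 => ?_
    have hr := hX.roundLaw_cellsIn t D
    rw [measureReal_def, h0] at hr
    simp only [ENNReal.toReal_zero] at hr
    linarith
  -- the number of rounds
  have hsx : √x ≤ √(T * W) / 4 := by
    rw [le_div_iff₀ (by norm_num), ← Real.sqrt_sq (show (0:ℝ) ≤ 4 by norm_num), ← Real.sqrt_mul hx]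
    exact Real.sqrt_le_sqrt (by linarith)
  have hTW : √(T * W) ^ 2 = T * W := Real.sq_sqrt (by positivity)
  have hxx : √x ^ 2 = x := Real.sq_sqrt hx
  have hsx0 := Real.sqrt_nonneg x
  -- Since 16x ≤ TW, the allowed deviation is at most TW/2 + TW/8.
  have hSle : (S.card : ℝ) ≤ 2 * (T * W) := by
    have := (abs_le.1 hS).2
    nlinarith
  -- The square of s is 2TW times the variance proxy 3B²q²/(T²w₀W) of one round.
  set s := √6 * B * q / √(T * w₀) with hs
  have hs0 : 0 ≤ s := by positivity
  have hR0 : 0 < 2 * B * bm / (T * w₀) := by positivity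
  set f := linTerm T M w b with hf
  have hfm : Measurable f := measurable_linTerm T M w b
  have hmg := fun t θ (hθ : |θ| * (2 * B * bm / (T * w₀)) ≤ 1) =>
    hX.linTerm_mgf_le hT hM hσ hB hw₀ hw hW0 hb hq hθ t
  have hev := fun t => measurePreserving_eval (fun t => (roundLaw P X ξ t)[|cellsIn D]) t
  have key := bernstein_sum (P := Measure.pi fun t => (roundLaw P X ξ t)[|cellsIn D])
    (Y := fun t y => f (y t)) (iIndepFun_pi fun t => hfm.aemeasurable)
    (fun t => hfm.comp (measurable_pi_apply t)) S
    (μ := (∑ p ∈ D, M p.1 p.2 * b p) / (T * W)) (v := 3 * B ^ 2 * q ^ 2 / (T ^ 2 * w₀ * W))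
    hs0 hR0 hx
    (fun t θ hθ => (hev t).integrable_comp_of_integrable (hmg t θ hθ).1)
    (fun t θ hθ => by
      refine le_trans (le_of_eq ?_) (hmg t θ hθ).2
      rw [mgf, mgf, ← (hev t).map_eq, integral_map (measurable_pi_apply t).aemeasurable
        (hfm.const_mul θ).exp.aestronglyMeasurable])
    (by
      have e : s ^ 2 = 6 * B ^ 2 * q ^ 2 / (T * w₀) := by
        rw [hs, div_pow, mul_pow, mul_pow, Real.sq_sqrt (by norm_num), Real.sq_sqrt (by positivity)]
      rw [e]
      calc (S.card : ℝ) * (3 * B ^ 2 * q ^ 2 / (T ^ 2 * w₀ * W))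
          ≤ 2 * (T * W) * (3 * B ^ 2 * q ^ 2 / (T ^ 2 * w₀ * W)) := by gcongr
        _ = _ := by field_simp; ring)
  refine (measureReal_mono fun y hy => ?_).trans key
  have hy' : 8 * B * √(x / (T * w₀)) * q + 4 * B * x / (T * w₀) * bm ≤
    |∑ t ∈ S, f (y t) - ∑ p ∈ D, M p.1 p.2 * b p| := hy
  change 2 * s * √x + 2 * (2 * B * bm / (T * w₀)) * x ≤
    |∑ t ∈ S, f (y t) - S.card * ((∑ p ∈ D, M p.1 p.2 * b p) / (T * W))|
  set c := ∑ p ∈ D, M p.1 p.2 * b p with hc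
  set a := √(x / (T * w₀)) with ha
  -- the error from replacing the number of rounds by its mean
  have hMb : |c| ≤ B * √D.card * q := by
    refine abs_le_of_sq_le_sq ?_ (by positivity)
    calc c ^ 2 ≤ (∑ p ∈ D, M p.1 p.2 ^ 2) * ∑ p ∈ D, b p ^ 2 :=
          Finset.sum_mul_sq_le_sq_mul_sq _ _ _
      _ ≤ (∑ _p ∈ D, B ^ 2) * q ^ 2 := by
          refine mul_le_mul (Finset.sum_le_sum fun p _ => ?_) hq (by positivity) (by positivity)
          exact sq_le_sq' (by linarith [(abs_le.1 (hM p)).1]) (abs_le.1 (hM p)).2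
      _ = _ := by
          rw [Finset.sum_const, nsmul_eq_mul, mul_pow, mul_pow, Real.sq_sqrt hc0.le]; ring
  have hdev : |(S.card : ℝ) / (T * W) - 1| ≤ 5 / 2 * (√x / √(T * W)) := by
    have e : (S.card : ℝ) / (T * W) - 1 = (S.card - T * W) / (T * W) := by field_simp
    rw [e, abs_div, abs_of_pos (show 0 < T * W by positivity), div_le_iff₀ (by positivity)]
    refine hS.trans ?_
    have e2 : 5 / 2 * (√x / √(T * W)) * (T * W) = 5 / 2 * √x * √(T * W) := by
      nth_rewrite 2 [← hTW]
      field_simp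
    rw [e2]
    nlinarith
  -- D has at most W / w₀ cells, so the √|D| of Cauchy–Schwarz is compensated by the relative
  -- fluctuation √(x/(TW)) of the count.
  have hdc : √x / √(T * W) * √D.card ≤ a := by
    rw [ha, Real.sqrt_div hx, div_mul_eq_mul_div, div_le_div_iff₀ (by positivity) (by positivity),
      mul_assoc, ← Real.sqrt_mul hc0.le]
    refine mul_le_mul_of_nonneg_left (Real.sqrt_le_sqrt ?_) hsx0
    linarith [mul_le_mul_of_nonneg_left hcard hT'.le]
  have h2 : |(S.card : ℝ) * (c / (T * W)) - c| ≤ 5 / 2 * B * a * q := by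
    have e : (S.card : ℝ) * (c / (T * W)) - c = (S.card / (T * W) - 1) * c := by ring
    rw [e, abs_mul]
    calc |(S.card : ℝ) / (T * W) - 1| * |c| ≤
          (5 / 2 * (√x / √(T * W))) * (B * √D.card * q) := by gcongr
      _ = 5 / 2 * B * (√x / √(T * W) * √D.card) * q := by ring
      _ ≤ _ := by gcongr
  have h1 : 2 * s * √x ≤ 5 * B * a * q := by
    have e : 2 * s * √x = 2 * √6 * B * a * q := by
      rw [hs, ha, Real.sqrt_div hx]; ring
    rw [e]
    have := sqrt_six_le
    have : 2 * √6 ≤ 5 := by linarith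
    gcongr
  have h3 : |∑ t ∈ S, f (y t) - c| ≤
      |∑ t ∈ S, f (y t) - S.card * (c / (T * W))| + |(S.card : ℝ) * (c / (T * W)) - c| :=
    abs_sub_le _ _ _
  have e4 : 2 * (2 * B * bm / (T * w₀)) * x = 4 * B * x / (T * w₀) * bm := by ring
  -- The variance part of Bernstein gives 5 B a q and the random count 5/2 B a q; the coefficient 8
  -- leaves slack.
  have h5 : 0 ≤ B * a * q := by positivity
  rw [e4]
  linarith

/-- The number of rounds in which `D` is sampled. -/
theorem IsSampling.card_tail (hX : IsSampling P w σ X ξ) {D : Finset (Fin m × Fin n)} {x : ℝ}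
    (hx : 0 ≤ x) (hD : 0 ≤ ∑ p ∈ D, w p) :
    P.real {ω | 2 * √(T * ∑ p ∈ D, w p) * √x + 2 * x ≤
      |((Finset.univ.filter fun t => X t ω ∈ D).card : ℝ) - T * ∑ p ∈ D, w p|} ≤
        2 * Real.exp (-x) := by
  set W := ∑ p ∈ D, w p with hW
  let g : Fin m × Fin n → ℝ := fun p => if p ∈ D then 1 else 0
  have hg : Measurable g := measurable_of_finite _
  have hY : iIndepFun (fun t ω => g (X t ω)) P :=
    hX.indep_rounds.comp (fun _ z => g z.1) fun _ => hg.comp measurable_fst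
  have hmg : ∀ (t : Fin T) (θ : ℝ), |θ| * 1 ≤ 1 →
      Integrable (fun ω => Real.exp (θ * g (X t ω))) P ∧
      mgf (fun ω => g (X t ω)) P θ ≤ Real.exp (θ * W + θ ^ 2 * W) := by
    intro t θ hθ
    have h := integrable_and_integral_of_indep (hX.measurable_X t) (hX.law_X t) (hX.indep_noise t)
      (φ := fun p _ => Real.exp (θ * g p)) (fun p => measurable_const)
      (fun p => integrable_const _)
    refine ⟨h.1, ?_⟩
    rw [mgf, h.2]
    have hsum1 : ∑ p, w p = 1 := by
      have := (integrable_and_integral_of_indep (hX.measurable_X t) (hX.law_X t) (hX.indep_noise t)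
        (φ := fun _ _ => 1) (fun p => measurable_const) (fun p => integrable_const _)).2
      simpa using this.symm
    have e : ∑ p, w p * ∫ _ω, Real.exp (θ * g p) ∂P = 1 + (Real.exp θ - 1) * W := by
      have : ∀ p, w p * ∫ _ω, Real.exp (θ * g p) ∂P =
          w p + (Real.exp θ - 1) * (if p ∈ D then w p else 0) := by
        intro p
        by_cases hp : p ∈ D
        · simp [g, hp]; ring
        · simp [g, hp]
      rw [Finset.sum_congr rfl fun p _ => this p, Finset.sum_add_distrib, hsum1, ← Finset.mul_sum,
        Finset.sum_ite_mem, Finset.univ_inter]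
    rw [e]
    have hθ' : Real.exp θ - 1 ≤ θ + θ ^ 2 := by
      have := Real.abs_exp_sub_one_sub_id_le (x := θ) (by linarith)
      linarith [(abs_le.1 this).2]
    calc 1 + (Real.exp θ - 1) * W ≤ 1 + (θ + θ ^ 2) * W := by gcongr
      _ = (θ * W + θ ^ 2 * W) + 1 := by ring
      _ ≤ _ := Real.add_one_le_exp _
  have key := bernstein_sum hY (fun t => hg.comp (hX.measurable_X t)) Finset.univ (R := 1)
    (Real.sqrt_nonneg (T * W)) one_pos hx (fun t θ hθ => (hmg t θ hθ).1)
    (fun t θ hθ => (hmg t θ hθ).2) (by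
      rw [Real.sq_sqrt (by positivity), Finset.card_univ, Fintype.card_fin])
  refine le_trans (le_of_eq ?_) key
  congr 2
  ext ω
  have : (((Finset.univ.filter fun t => X t ω ∈ D).card : ℕ) : ℝ) = ∑ t, g (X t ω) := by
    simp [g]
  simp only [this, mul_one, Finset.card_univ, Fintype.card_fin]

end LinearForm

end LowRank

namespace LowRank

/-! ### Leave-one-out concentration of the rows of the noise -/

section RowCoef

variable {m n T : ℕ}

/-- The coefficients by which `Q` pairs with the row or column of the noise indexed by `i`. -/
def coef (Q : Matrix (Fin m ⊕ Fin n) (Fin m ⊕ Fin n) ℝ) (k : Fin m ⊕ Fin n) :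
    Fin m ⊕ Fin n → Fin m × Fin n → ℝ
  | Sum.inl _ => fun p => Q (Sum.inr p.2) k
  | Sum.inr _ => fun p => Q (Sum.inl p.1) k

theorem sum_block_inl (i : Fin m) (f : Fin m × Fin n → ℝ) :
    ∑ p ∈ block (Sum.inl i : Fin m ⊕ Fin n), f p = ∑ j, f (i, j) := by
  rw [block, Finset.sum_filter, Fintype.sum_prod_type, Finset.sum_eq_single i] <;>
    simp +contextual

theorem sum_block_inr (j : Fin n) (f : Fin m × Fin n → ℝ) :
    ∑ p ∈ block (Sum.inr j : Fin m ⊕ Fin n), f p = ∑ i, f (i, j) := by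
  rw [block, Finset.sum_filter, Fintype.sum_prod_type_right, Finset.sum_eq_single j] <;>
    simp +contextual

theorem dil_mul_apply (A : Matrix (Fin m) (Fin n) ℝ)
    (Q : Matrix (Fin m ⊕ Fin n) (Fin m ⊕ Fin n) ℝ) (i k : Fin m ⊕ Fin n) :
    (dil A * Q) i k = ∑ p ∈ block i, A p.1 p.2 * coef Q k i p := by
  rw [Matrix.mul_apply, Fintype.sum_sum_type]
  rcases i with i | j
  · rw [sum_block_inl]; simp [dil, coef]
  · rw [sum_block_inr]; simp [dil, coef]

theorem sum_coef_sq_le (Q : Matrix (Fin m ⊕ Fin n) (Fin m ⊕ Fin n) ℝ) (hQ : Qᵀ = Q)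
    (i k : Fin m ⊕ Fin n) : ∑ p ∈ block i, coef Q k i p ^ 2 ≤ rowNorm Q k ^ 2 := by
  have hs : ∀ l, Q k l = Q l k := fun l => by
    conv_lhs => rw [← hQ]
    rfl
  rw [rowNorm_sq, Fintype.sum_sum_type]
  simp only [hs]
  rcases i with i | j
  · rw [sum_block_inl]
    exact le_add_of_nonneg_left (Finset.sum_nonneg fun _ _ => sq_nonneg _)
  · rw [sum_block_inr]
    exact le_add_of_nonneg_right (Finset.sum_nonneg fun _ _ => sq_nonneg _)

theorem abs_coef_le (Q : Matrix (Fin m ⊕ Fin n) (Fin m ⊕ Fin n) ℝ) (i k : Fin m ⊕ Fin n)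
    (p : Fin m × Fin n) : |coef Q k i p| ≤ ‖fun l => Q l k‖ := by
  rcases i with i | j
  · exact norm_le_pi_norm (fun l => Q l k) (Sum.inr p.2)
  · exact norm_le_pi_norm (fun l => Q l k) (Sum.inl p.1)

theorem erase_apply {ι : Type*} [Fintype ι] [DecidableEq ι] (i : ι) (E : Matrix ι ι ℝ) (k l : ι) :
    erase i E k l = if k = i ∨ l = i then 0 else E k l := by
  rw [erase, Matrix.mul_diagonal, Matrix.diagonal_mul]
  by_cases h1 : k = i <;> by_cases h2 : l = i <;> simp [h1, h2]

theorem erase_dil_congr {A A' : Matrix (Fin m) (Fin n) ℝ} (i : Fin m ⊕ Fin n)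
    (h : ∀ p ∉ block i, A p.1 p.2 = A' p.1 p.2) : erase i (dil A) = erase i (dil A') := by
  ext k l
  rw [erase_apply, erase_apply]
  split_ifs with hkl
  · rfl
  · push Not at hkl
    rcases k with k | k <;> rcases l with l | l
    · simp [dil]
    · refine h (k, l) ?_
      rcases i with i | i
      · rw [mem_block_inl]; simpa using hkl.1
      · rw [mem_block_inr]; simpa using hkl.2
    · refine h (l, k) ?_
      rcases i with i | i
      · rw [mem_block_inl]; simpa using hkl.2
      · rw [mem_block_inr]; simpa using hkl.1
    · simp [dil]

/-- The empirical reward matrix as a function of the observations. -/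
noncomputable def empirical (M : Matrix (Fin m) (Fin n) ℝ) (w : Fin m × Fin n → ℝ)
    (y : Fin T → (Fin m × Fin n) × ℝ) : Matrix (Fin m) (Fin n) ℝ :=
  empiricalReward M w (fun t => (y t).1) (fun t => (y t).2)

theorem sum_empirical_mul (M : Matrix (Fin m) (Fin n) ℝ) (w b : Fin m × Fin n → ℝ)
    (y : Fin T → (Fin m × Fin n) × ℝ) (D : Finset (Fin m × Fin n)) :
    ∑ p ∈ D, empirical M w y p.1 p.2 * b p =
      ∑ t ∈ Finset.univ.filter (fun t => (y t).1 ∈ D), linTerm T M w b (y t) := by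
  simp only [empirical, empiricalReward, Matrix.of_apply, Finset.mul_sum, Finset.sum_mul]
  rw [Finset.sum_comm, Finset.sum_filter]
  refine Finset.sum_congr rfl fun t _ => ?_
  have : ∀ p ∈ D, 1 / ((T : ℝ) * w (p.1, p.2)) *
      (if (y t).1 = (p.1, p.2) then M (y t).1.1 (y t).1.2 + (y t).2 else 0) * b p =
      if (y t).1 = p then linTerm T M w b (y t) else 0 := by
    intro p _
    by_cases h : (y t).1 = p
    · simp [h, linTerm]; ring
    · simp [h]
  rw [Finset.sum_congr rfl this, Finset.sum_ite_eq]

/-- Observations moved within D do not touch the entries outside D. With `erase_dil_congr`, this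
keeps the leave-one-out matrix fixed under resampling. -/
theorem empirical_congr (M : Matrix (Fin m) (Fin n) ℝ) (w : Fin m × Fin n → ℝ)
    {y y' : Fin T → (Fin m × Fin n) × ℝ} {D : Finset (Fin m × Fin n)}
    (h : ∀ t, y' t = y t ∨ ((y t).1 ∈ D ∧ (y' t).1 ∈ D)) {p : Fin m × Fin n} (hp : p ∉ D) :
    empirical M w y' p.1 p.2 = empirical M w y p.1 p.2 := by
  simp only [empirical, empiricalReward, Matrix.of_apply]
  congr 1
  refine Finset.sum_congr rfl fun t _ => ?_
  rcases h t with h | ⟨h1, h2⟩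
  · rw [h]
  · rw [if_neg, if_neg]
    · intro h; rw [h] at h1; exact hp h1
    · intro h; rw [h] at h2; exact hp h2

theorem measurable_empirical (M : Matrix (Fin m) (Fin n) ℝ) (w : Fin m × Fin n → ℝ) :
    Measurable fun (y : Fin T → (Fin m × Fin n) × ℝ) (i : Fin m) (j : Fin n) =>
      empirical M w y i j := by
  refine measurable_pi_iff.2 fun i => measurable_pi_iff.2 fun j => ?_
  simp only [empirical, empiricalReward, Matrix.of_apply]
  refine (Finset.measurable_sum _ fun t _ => ?_).const_mul _
  have h1 : Measurable fun y : Fin T → (Fin m × Fin n) × ℝ => (y t).1 :=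
    measurable_fst.comp (measurable_pi_apply t)
  have h2 : Measurable fun y : Fin T → (Fin m × Fin n) × ℝ => (y t).2 :=
    measurable_snd.comp (measurable_pi_apply t)
  have h3 : Measurable fun p : Fin m × Fin n => M p.1 p.2 := measurable_of_finite _
  exact Measurable.ite (h1 (measurableSet_singleton (i, j))) ((h3.comp h1).add h2) measurable_const

end RowCoef

/-! ### Measurability of the leave-one-out event -/

section Closed

theorem isClosed_exists_mem_of_isCompact {𝒳 𝒴 : Type*} [TopologicalSpace 𝒳] [TopologicalSpace 𝒴]
    {K : Set 𝒳} (hK : IsCompact K) {F : Set (𝒳 × 𝒴)} (hF : IsClosed F) :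
    IsClosed {y | ∃ x ∈ K, (x, y) ∈ F} := by
  have : CompactSpace K := isCompact_iff_compactSpace.1 hK
  have hc : IsClosed {z : K × 𝒴 | ((z.1 : 𝒳), z.2) ∈ F} :=
    hF.preimage ((continuous_subtype_val.comp continuous_fst).prodMk continuous_snd)
  convert isClosedMap_snd_of_compactSpace _ hc using 1
  ext y
  constructor
  · rintro ⟨x, hx, h⟩; exact ⟨(⟨x, hx⟩, y), h, rfl⟩
  · rintro ⟨⟨⟨x, hx⟩, y'⟩, h, rfl⟩; exact ⟨x, hx, h⟩

variable {m n : ℕ}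

/-- The matrices `A` for which a spectral projection of `M`, perturbed by `A - M` outside the row
and column `i`, correlates with the row `i` of `A - M`. -/
def badSet (M : Matrix (Fin m) (Fin n) ℝ) (i : Fin m ⊕ Fin n) (a b α β η : ℝ) :
    Set (Matrix (Fin m) (Fin n) ℝ) :=
  {A | ∃ Q W k, GapProj (dil M + erase i (dil (A - M))) Q W a b ∧
    α * rowNorm Q k + β * ‖fun l => Q l k‖ + η ≤ |(dil (A - M) * Q) i k|}

/-- The quantified Q and W lie in balls of radius 1 and 1/b, and all conditions on them are closed;
a closed set projected along a compact factor is closed. This avoids a measurable choice of the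
projection. -/
theorem isClosed_badSet (M : Matrix (Fin m) (Fin n) ℝ) (i : Fin m ⊕ Fin n) {a b : ℝ}
    (hb : 0 < b) (α β η : ℝ) :
    IsClosed {A : Fin m → Fin n → ℝ | Matrix.of A ∈ badSet M i a b α β η} := by
  have hun : {A : Fin m → Fin n → ℝ | Matrix.of A ∈ badSet M i a b α β η} =
      ⋃ k, {A : Fin m → Fin n → ℝ | ∃ z ∈ Metric.closedBall
        (0 : Matrix (Fin m ⊕ Fin n) (Fin m ⊕ Fin n) ℝ) 1 ×ˢ Metric.closedBall
        (0 : Matrix (Fin m ⊕ Fin n) (Fin m ⊕ Fin n) ℝ) b⁻¹,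
        (z, A) ∈ {q : (Matrix (Fin m ⊕ Fin n) (Fin m ⊕ Fin n) ℝ ×
            Matrix (Fin m ⊕ Fin n) (Fin m ⊕ Fin n) ℝ) × (Fin m → Fin n → ℝ) |
          GapProj (dil M + erase i (dil (Matrix.of q.2 - M))) q.1.1 q.1.2 a b ∧
          α * rowNorm q.1.1 k + β * ‖fun l => q.1.1 l k‖ + η ≤
            |(dil (Matrix.of q.2 - M) * q.1.1) i k|}} := by
    ext A
    simp only [badSet, Set.mem_iUnion]
    constructor
    · rintro ⟨Q, W, k, h, h2⟩
      refine ⟨k, (Q, W), ⟨?_, ?_⟩, h, h2⟩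
      · rw [mem_closedBall_zero_iff]; exact h.norm_le_one
      · rw [mem_closedBall_zero_iff, ← one_div, le_div_iff₀ hb, mul_comm]
        exact h.inv_norm
    · rintro ⟨k, ⟨Q, W⟩, -, h, h2⟩
      exact ⟨Q, W, k, h, h2⟩
  rw [hun]
  refine isClosed_iUnion_of_finite fun k => isClosed_exists_mem_of_isCompact
    ((isCompact_closedBall _ _).prod (isCompact_closedBall _ _)) ?_
  have cQ : Continuous fun q : (Matrix (Fin m ⊕ Fin n) (Fin m ⊕ Fin n) ℝ ×
      Matrix (Fin m ⊕ Fin n) (Fin m ⊕ Fin n) ℝ) × (Fin m → Fin n → ℝ) => q.1.1 := by fun_prop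
  have cW : Continuous fun q : (Matrix (Fin m ⊕ Fin n) (Fin m ⊕ Fin n) ℝ ×
      Matrix (Fin m ⊕ Fin n) (Fin m ⊕ Fin n) ℝ) × (Fin m → Fin n → ℝ) => q.1.2 := by fun_prop
  have cD : Continuous fun q : (Matrix (Fin m ⊕ Fin n) (Fin m ⊕ Fin n) ℝ ×
      Matrix (Fin m ⊕ Fin n) (Fin m ⊕ Fin n) ℝ) × (Fin m → Fin n → ℝ) =>
      dil (Matrix.of q.2 - M) := by
    have c1 : Continuous fun q : (Matrix (Fin m ⊕ Fin n) (Fin m ⊕ Fin n) ℝ ×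
      Matrix (Fin m ⊕ Fin n) (Fin m ⊕ Fin n) ℝ) × (Fin m → Fin n → ℝ) =>
      (Matrix.of q.2 - M : Matrix (Fin m) (Fin n) ℝ) :=
      (continuous_snd : Continuous fun q : (Matrix (Fin m ⊕ Fin n) (Fin m ⊕ Fin n) ℝ ×
      Matrix (Fin m ⊕ Fin n) (Fin m ⊕ Fin n) ℝ) × (Fin m → Fin n → ℝ) => q.2).sub continuous_const
    exact Continuous.matrix_fromBlocks continuous_const c1 c1.matrix_transpose continuous_const
  have cH : Continuous fun q : (Matrix (Fin m ⊕ Fin n) (Fin m ⊕ Fin n) ℝ ×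
      Matrix (Fin m ⊕ Fin n) (Fin m ⊕ Fin n) ℝ) × (Fin m → Fin n → ℝ) =>
      dil M + erase i (dil (Matrix.of q.2 - M)) :=
    continuous_const.add ((continuous_const.matrix_mul cD).matrix_mul continuous_const)
  have hG : {q : (Matrix (Fin m ⊕ Fin n) (Fin m ⊕ Fin n) ℝ ×
      Matrix (Fin m ⊕ Fin n) (Fin m ⊕ Fin n) ℝ) × (Fin m → Fin n → ℝ) |
      GapProj (dil M + erase i (dil (Matrix.of q.2 - M))) q.1.1 q.1.2 a b ∧
          α * rowNorm q.1.1 k + β * ‖fun l => q.1.1 l k‖ + η ≤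
            |(dil (Matrix.of q.2 - M) * q.1.1) i k|} =
      {q | q.1.1ᵀ = q.1.1} ∩ {q | q.1.1 * q.1.1 = q.1.1} ∩
      {q | (dil M + erase i (dil (Matrix.of q.2 - M))) * q.1.1 =
        q.1.1 * (dil M + erase i (dil (Matrix.of q.2 - M)))} ∩
      {q | ‖(dil M + erase i (dil (Matrix.of q.2 - M))) * (1 - q.1.1)‖ ≤ a} ∩
      {q | (dil M + erase i (dil (Matrix.of q.2 - M))) * q.1.2 = q.1.1} ∩
      {q | q.1.1 * q.1.2 = q.1.2} ∩ {q | b * ‖q.1.2‖ ≤ 1} ∩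
      {q | α * rowNorm q.1.1 k + β * ‖fun l => q.1.1 l k‖ + η ≤
            |(dil (Matrix.of q.2 - M) * q.1.1) i k|} := by
    ext q
    constructor
    · rintro ⟨h, h2⟩
      exact ⟨⟨⟨⟨⟨⟨⟨h.symm, h.idem⟩, h.comm⟩, h.off⟩, h.mul_inv⟩, h.proj_inv⟩, h.inv_norm⟩, h2⟩
    · rintro ⟨⟨⟨⟨⟨⟨⟨h1, h2⟩, h3⟩, h4⟩, h5⟩, h6⟩, h7⟩, h8⟩
      exact ⟨⟨h1, h2, h3, h4, h5, h6, h7⟩, h8⟩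
  rw [hG]
  refine (((((((?_ : IsClosed _).inter ?_).inter ?_).inter ?_).inter ?_).inter ?_).inter ?_).inter ?_
  · exact isClosed_eq cQ.matrix_transpose cQ
  · exact isClosed_eq (cQ.matrix_mul cQ) cQ
  · exact isClosed_eq (cH.matrix_mul cQ) (cQ.matrix_mul cH)
  · exact isClosed_le (cH.matrix_mul (continuous_const.sub cQ)).norm continuous_const
  · exact isClosed_eq (cH.matrix_mul cW) cQ
  · exact isClosed_eq (cQ.matrix_mul cW) cW
  · exact isClosed_le (cW.norm.const_mul b) continuous_const
  · have cr : Continuous fun q : (Matrix (Fin m ⊕ Fin n) (Fin m ⊕ Fin n) ℝ ×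
        Matrix (Fin m ⊕ Fin n) (Fin m ⊕ Fin n) ℝ) × (Fin m → Fin n → ℝ) => rowNorm q.1.1 k := by
      refine Real.continuous_sqrt.comp (continuous_finsetSum _ fun l _ => ?_)
      exact (cQ.matrix_elem k l).pow 2
    refine isClosed_le (((cr.const_mul α).add (Continuous.const_mul (Continuous.norm ?_) β)).add
      continuous_const) ((cD.matrix_mul cQ).matrix_elem i k).abs
    exact continuous_pi fun l => cQ.matrix_elem l k

end Closed

end LowRank

namespace LowRank

/-! ### Concentration of a noise row against its leave-one-out projection -/

section RowTail

open scoped ENNReal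

variable {Ω : Type*} [MeasurableSpace Ω] {P : Measure Ω} [IsProbabilityMeasure P]
  {m n T : ℕ} {M : Matrix (Fin m) (Fin n) ℝ} {w : Fin m × Fin n → ℝ} {σ : ℝ≥0}
  {X : Fin T → Ω → Fin m × Fin n} {ξ : Fin T → Ω → ℝ} {B w₀ : ℝ}

/-- The sequences of observations for which the number of rounds in `D` is close to its mean. -/
def cardGood (w : Fin m × Fin n → ℝ) (D : Finset (Fin m × Fin n)) (x : ℝ) :
    Set (Fin T → (Fin m × Fin n) × ℝ) :=
  {y | |((Finset.univ.filter fun t => (y t).1 ∈ D).card : ℝ) - T * ∑ p ∈ D, w p| ≤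
    2 * √(T * ∑ p ∈ D, w p) * √x + 2 * x}

theorem measurableSet_cardGood (w : Fin m × Fin n → ℝ) (D : Finset (Fin m × Fin n)) (x : ℝ) :
    MeasurableSet (cardGood (T := T) w D x) := by
  have h : Measurable fun y : Fin T → (Fin m × Fin n) × ℝ => fun t => (y t).1 :=
    measurable_pi_iff.2 fun t => measurable_fst.comp (measurable_pi_apply t)
  exact h (Set.Finite.measurableSet (Set.toFinite {z : Fin T → Fin m × Fin n |
    |((Finset.univ.filter fun t => z t ∈ D).card : ℝ) - T * ∑ p ∈ D, w p| ≤
      2 * √(T * ∑ p ∈ D, w p) * √x + 2 * x}))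

/-- Freeze which rounds hit block i, and all contents of the other rounds. The erased matrix, and by
uniqueness its projection Q, are then deterministic, so `IsSampling.linTerm_tail` applies to each
column of Q; the columns give the factor m + n. -/
theorem IsSampling.pi_badSet_le (hX : IsSampling P w σ X ξ) (hT : 0 < T)
    (hM : ∀ p : Fin m × Fin n, |M p.1 p.2| ≤ B) (hσ : (σ : ℝ) ≤ B) (hB : 0 < B) (hw₀ : 0 < w₀)
    (hw : ∀ p, w₀ ≤ w p) (i : Fin m ⊕ Fin n) (hne : (block i).Nonempty) {a b x η : ℝ}
    (hb : 0 < b) (hab : a < b) (hx : 0 < x) (hxD : 16 * x ≤ T * ∑ p ∈ block i, w p) (hη : 0 < η) :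
    Measure.pi (roundLaw P X ξ) (cardGood w (block i) x ∩
      {y | empirical M w y ∈
        badSet M i a b (8 * B * √(x / (T * w₀))) (4 * B * x / (T * w₀)) η}) ≤
      ENNReal.ofReal ((m + n) * (2 * Real.exp (-x))) := by
  classical
  have hT' : (0 : ℝ) < T := by exact_mod_cast hT
  have hprob := hX.isProbabilityMeasure_roundLaw
  have hW0 : 0 < ∑ p ∈ block i, w p := Finset.sum_pos (fun p _ => hw₀.trans_le (hw p)) hne
  have hνB : ∀ t, roundLaw P X ξ t (cellsIn (block i)) ≠ 0 := by
    intro t h0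
    have hr := hX.roundLaw_cellsIn t (block i)
    rw [measureReal_def, h0] at hr
    simp only [ENNReal.toReal_zero] at hr
    linarith
  have hprob' : ∀ t, IsProbabilityMeasure ((roundLaw P X ξ t)[|cellsIn (block i)]) :=
    fun t => cond_isProbabilityMeasure (hνB t)
  have hmeas : MeasurableSet {y : Fin T → (Fin m × Fin n) × ℝ | empirical M w y ∈
      badSet M i a b (8 * B * √(x / (T * w₀))) (4 * B * x / (T * w₀)) η} :=
    measurable_empirical M w (isClosed_badSet M i hb _ _ η).measurableSet
  refine pi_le_of_resample _ (measurableSet_cellsIn (block i)) hνB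
    ((measurableSet_cardGood w _ x).inter hmeas) fun y => ?_
  set S : Finset (Fin T) := Finset.univ.filter fun t => (y t).1 ∈ block i with hS
  -- resampling does not change the rounds in the block, nor the matrix outside the block
  have hres : ∀ y' : Fin T → (Fin m × Fin n) × ℝ, (∀ t, y' t ∈ cellsIn (block i)) →
      (∀ t, ((if y t ∈ cellsIn (block i) then y' t else y t).1 ∈ block i ↔ t ∈ S)) ∧
      erase i (dil (empirical M w (fun t => if y t ∈ cellsIn (block i) then y' t else y t) - M)) =
        erase i (dil (empirical M w y - M)) := by
    intro y' hy'
    constructor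
    · intro t
      by_cases h : y t ∈ cellsIn (block i)
      · have h1 : (y' t).1 ∈ block i := hy' t
        have h2 : (y t).1 ∈ block i := h
        simp [h, h1, h2, hS]
      · have h2 : (y t).1 ∉ block i := h
        simp [h, h2, hS]
    · refine erase_dil_congr i fun p hp => ?_
      rw [Matrix.sub_apply, Matrix.sub_apply, empirical_congr M w (fun t => ?_) hp]
      by_cases h : y t ∈ cellsIn (block i)
      · right; rw [if_pos h]; exact ⟨h, hy' t⟩
      · left; rw [if_neg h]
  by_cases hc : |(S.card : ℝ) - T * ∑ p ∈ block i, w p| ≤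
      2 * √(T * ∑ p ∈ block i, w p) * √x + 2 * x
  swap
  -- Resampling preserves the number of rounds in the block, so a bad count for y makes the event
  -- empty.
  · refine (measure_mono_null (t := ∅) ?_ measure_empty).trans_le zero_le
    rintro y' ⟨hy', hcg, -⟩
    refine hc ?_
    have : (Finset.univ.filter fun t =>
        (if y t ∈ cellsIn (block i) then y' t else y t).1 ∈ block i) = S := by
      ext t
      rw [Finset.mem_filter, (hres y' hy').1 t]
      simp
    rw [← this]
    exact hcg
  -- If the frozen matrix has no gap projection, the event is empty; otherwise Q is fixed before the
  -- resampling.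
  by_cases hQ : ∃ Q W, GapProj (dil M + erase i (dil (empirical M w y - M))) Q W a b
  swap
  · refine (measure_mono_null (t := ∅) ?_ measure_empty).trans_le zero_le
    rintro y' ⟨hy', -, Q, W, k, h, -⟩
    rw [(hres y' hy').2] at h
    exact hQ ⟨Q, W, h⟩
  obtain ⟨Q, W, hQW⟩ := hQ
  set β := 4 * B * x / (T * w₀) with hβ
  have hβ0 : 0 < β := by positivity
  -- The extra η / β makes the coefficient bound strictly positive, and multiplied by β it is
  -- exactly the slack η.
  have htail := fun k => hX.linTerm_tail hT hM hσ hB hw₀ hw hne (b := coef Q k i)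
    (bm := ‖fun l => Q l k‖ + η / β) (by positivity) (rowNorm_nonneg Q k) hx.le
    (fun p _ => (abs_coef_le Q i k p).trans (le_add_of_nonneg_right (by positivity)))
    (sum_coef_sq_le Q hQW.symm i k) hxD S hc
  rw [← ofReal_measureReal]
  refine ENNReal.ofReal_le_ofReal ?_
  calc _ ≤ (Measure.pi fun t => (roundLaw P X ξ t)[|cellsIn (block i)]).real
        (⋃ k, {y' | 8 * B * √(x / (T * w₀)) * rowNorm Q k + β * (‖fun l => Q l k‖ + η / β) ≤
          |∑ t ∈ S, linTerm T M w (coef Q k i) (y' t) -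
            ∑ p ∈ block i, M p.1 p.2 * coef Q k i p|}) := by
        refine measureReal_mono ?_
        rintro y' ⟨hy', -, Q', W', k, h, hbad⟩
        rw [(hres y' hy').2] at h
        obtain rfl := h.unique hQW hab
        refine Set.mem_iUnion.2 ⟨k, ?_⟩
        change (_ : ℝ) ≤ _
        have e : β * (‖fun l => Q' l k‖ + η / β) = β * ‖fun l => Q' l k‖ + η := by
          field_simp
        rw [e, ← add_assoc]
        refine hbad.trans (le_of_eq ?_)
        rw [dil_mul_apply]
        simp only [Matrix.sub_apply, sub_mul, Finset.sum_sub_distrib]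
        rw [sum_empirical_mul]
        have : (Finset.univ.filter fun t =>
            (if y t ∈ cellsIn (block i) then y' t else y t).1 ∈ block i) = S := by
          ext t
          rw [Finset.mem_filter, (hres y' hy').1 t]
          simp
        rw [this]
        congr 2
        refine Finset.sum_congr rfl fun t ht => ?_
        have h2 : y t ∈ cellsIn (block i) := (Finset.mem_filter.1 ht).2
        rw [if_pos h2]
    _ ≤ ∑ _k : Fin m ⊕ Fin n, 2 * Real.exp (-x) :=
        (measureReal_iUnion_fintype_le _).trans (Finset.sum_le_sum fun k _ => htail k)
    _ = _ := by simp [Finset.sum_const, Fintype.card_sum]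

/-- The strict inequality is the increasing union, over slacks 1/(j + 1), of the closed events
already bounded. The event of an atypical count is added. -/
theorem IsSampling.row_tail (hX : IsSampling P w σ X ξ) (hT : 0 < T)
    (hM : ∀ p : Fin m × Fin n, |M p.1 p.2| ≤ B) (hσ : (σ : ℝ) ≤ B) (hB : 0 < B) (hw₀ : 0 < w₀)
    (hw : ∀ p, w₀ ≤ w p) (i : Fin m ⊕ Fin n) (hne : (block i).Nonempty) {a b x : ℝ}
    (hb : 0 < b) (hab : a < b) (hx : 0 < x) (hxD : 16 * x ≤ T * ∑ p ∈ block i, w p) :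
    P.real {ω | ∃ Q W k, GapProj (dil M + erase i
        (dil (empiricalReward M w (fun t => X t ω) (fun t => ξ t ω) - M))) Q W a b ∧
      8 * B * √(x / (T * w₀)) * rowNorm Q k + 4 * B * x / (T * w₀) * ‖fun l => Q l k‖ <
        |(dil (empiricalReward M w (fun t => X t ω) (fun t => ξ t ω) - M) * Q) i k|} ≤
      (m + n + 1) * (2 * Real.exp (-x)) := by
  set α := 8 * B * √(x / (T * w₀)) with hα
  set β := 4 * B * x / (T * w₀) with hβ
  have hcard := hX.card_tail (D := block i) hx.le
    (Finset.sum_nonneg fun p _ => (hw₀.trans_le (hw p)).le)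
  set A : ℕ → Set (Fin T → (Fin m × Fin n) × ℝ) := fun j => cardGood w (block i) x ∩
      {y | empirical M w y ∈ badSet M i a b α β (1 / ((j : ℝ) + 1))} with hA
  have hmono : Monotone A := by
    intro j k hjk
    refine Set.inter_subset_inter_right _ ?_
    rintro y ⟨Q, W, l, h, h2⟩
    exact ⟨Q, W, l, h, le_trans (by gcongr) h2⟩
  have hAle : P.real ((fun ω t => (X t ω, ξ t ω)) ⁻¹' ⋃ j, A j) ≤
      (m + n) * (2 * Real.exp (-x)) := by
    refine ENNReal.toReal_le_of_le_ofReal (by positivity) ?_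
    refine (Measure.le_map_apply (measurable_pi_iff.2 hX.measurable_round).aemeasurable _).trans ?_
    rw [hX.map_rounds, hmono.measure_iUnion]
    exact iSup_le fun j => hX.pi_badSet_le hT hM hσ hB hw₀ hw i hne hb hab hx hxD (by positivity)
  refine (measureReal_mono (s₂ := {ω | 2 * √(T * ∑ p ∈ block i, w p) * √x + 2 * x ≤
      |((Finset.univ.filter fun t => X t ω ∈ block i).card : ℝ) - T * ∑ p ∈ block i, w p|} ∪
      (fun ω t => (X t ω, ξ t ω)) ⁻¹' ⋃ j, A j) ?_).trans
    ((measureReal_union_le _ _).trans ((add_le_add hcard hAle).trans (le_of_eq (by ring))))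
  rintro ω ⟨Q, W, k, h, hlt⟩
  rcases le_total (2 * √(T * ∑ p ∈ block i, w p) * √x + 2 * x)
    |((Finset.univ.filter fun t => X t ω ∈ block i).card : ℝ) - T * ∑ p ∈ block i, w p| with hc | hc
  · exact Or.inl hc
  · right
    obtain ⟨j, hj⟩ := exists_nat_one_div_lt (sub_pos.2 hlt)
    have h3 : α * rowNorm Q k + β * ‖fun l => Q l k‖ + 1 / ((j : ℝ) + 1) ≤
        |(dil (empiricalReward M w (fun t => X t ω) (fun t => ξ t ω) - M) * Q) i k| := by linarith
    exact Set.mem_iUnion.2 ⟨j, hc, Q, W, k, h, h3⟩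

end RowTail

end LowRank

namespace LowRank

/-! ### Incoherence and singular values -/

section Incoherence

variable {m n r : ℕ}

theorem rowNorm_le_twoToInf (A : Matrix (Fin m) (Fin n) ℝ) (i : Fin m) :
    rowNorm A i ≤ twoToInf A :=
  le_ciSup (f := fun i => √(∑ j, A i j ^ 2)) (Set.finite_range _).bddAbove i

theorem twoToInf_le {A : Matrix (Fin m) (Fin n) ℝ} (hm : 0 < m) {C : ℝ}
    (h : ∀ i, rowNorm A i ≤ C) : twoToInf A ≤ C := by
  have : Nonempty (Fin m) := ⟨⟨0, hm⟩⟩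
  exact ciSup_le h

theorem abs_le_maxNorm (A : Matrix (Fin m) (Fin n) ℝ) (p : Fin m × Fin n) :
    |A p.1 p.2| ≤ maxNorm A :=
  le_ciSup (f := fun p : Fin m × Fin n => |A p.1 p.2|) (Set.finite_range _).bddAbove p

theorem rowNorm_sq_eq_of_proj {ι : Type*} [Fintype ι] {P : Matrix ι ι ℝ} (hs : Pᵀ = P)
    (hi : P * P = P) (i : ι) : rowNorm P i ^ 2 = P i i := by
  have h1 : (P * Pᵀ) i i = P i i := by rw [hs, hi]
  rw [rowNorm_sq, ← h1, Matrix.mul_apply]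
  exact Finset.sum_congr rfl fun j _ => by rw [Matrix.transpose_apply, sq]

theorem mul_transpose_self_apply {ι κ : Type*} [Fintype κ] (U : Matrix ι κ ℝ) (i : ι) :
    (U * Uᵀ) i i = rowNorm U i ^ 2 := by
  rw [rowNorm_sq, Matrix.mul_apply]
  exact Finset.sum_congr rfl fun j _ => by rw [Matrix.transpose_apply, sq]

theorem sum_rowNorm_sq_of_orthonormal {U : Matrix (Fin m) (Fin r) ℝ} (hU : Uᵀ * U = 1) :
    ∑ i, rowNorm U i ^ 2 = r := by
  simp only [← mul_transpose_self_apply]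
  change (U * Uᵀ).trace = r
  rw [Matrix.trace_mul_comm, hU]
  simp

/-- The squared row norms sum to r, so the largest is at least the average r/m; hence μ ≥ 1. -/
theorem one_le_sqrt_mul_twoToInf {U : Matrix (Fin m) (Fin r) ℝ} (hU : Uᵀ * U = 1) (hr : 0 < r) :
    1 ≤ √((m : ℝ) / r) * twoToInf U := by
  have hr' : (0 : ℝ) < r := by exact_mod_cast hr
  have h0 : 0 ≤ twoToInf U := Real.iSup_nonneg fun i => Real.sqrt_nonneg _
  have h1 : (r : ℝ) ≤ m * twoToInf U ^ 2 := by
    rw [← sum_rowNorm_sq_of_orthonormal hU]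
    calc ∑ i, rowNorm U i ^ 2 ≤ ∑ _i : Fin m, twoToInf U ^ 2 :=
          Finset.sum_le_sum fun i _ => pow_le_pow_left₀ (rowNorm_nonneg _ _)
            (rowNorm_le_twoToInf U i) 2
      _ = _ := by simp
  refine (sq_le_sq₀ zero_le_one (by positivity)).1 ?_
  rw [mul_pow, Real.sq_sqrt (by positivity), one_pow, div_mul_eq_mul_div, le_div_iff₀ hr', one_mul]
  exact h1

theorem rowNorm_le_of_incoherence {U : Matrix (Fin m) (Fin r) ℝ} {μ d : ℝ} (hr : 0 < r)
    (hd : 0 < d) (hdm : d ≤ m) (hμ : √((m : ℝ) / r) * twoToInf U ≤ μ) (i : Fin m) :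
    rowNorm U i ≤ μ * √(r / d) := by
  have hr' : (0 : ℝ) < r := by exact_mod_cast hr
  have h0 : 0 ≤ twoToInf U := (rowNorm_nonneg U i).trans (rowNorm_le_twoToInf U i)
  have e : √((d : ℝ) / r) * √(r / d) = 1 := by
    rw [← Real.sqrt_mul (by positivity), div_mul_div_comm, mul_comm d, div_self (by positivity),
      Real.sqrt_one]
  calc rowNorm U i ≤ twoToInf U := rowNorm_le_twoToInf U i
    _ = √((d : ℝ) / r) * twoToInf U * √(r / d) := by rw [mul_right_comm, e, one_mul]
    _ ≤ √((m : ℝ) / r) * twoToInf U * √(r / d) := by gcongr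
    _ ≤ _ := by gcongr

theorem frameProj_transpose (U : Matrix (Fin m) (Fin r) ℝ) (V : Matrix (Fin n) (Fin r) ℝ) :
    (frameProj U V)ᵀ = frameProj U V := by
  simp [frameProj, Matrix.fromBlocks_transpose, Matrix.transpose_mul]

theorem frameProj_mul_self {U : Matrix (Fin m) (Fin r) ℝ} {V : Matrix (Fin n) (Fin r) ℝ}
    (hU : Uᵀ * U = 1) (hV : Vᵀ * V = 1) : frameProj U V * frameProj U V = frameProj U V := by
  have h1 : U * Uᵀ * (U * Uᵀ) = U * Uᵀ := by
    rw [Matrix.mul_assoc, ← Matrix.mul_assoc Uᵀ, hU, Matrix.one_mul]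
  have h2 : V * Vᵀ * (V * Vᵀ) = V * Vᵀ := by
    rw [Matrix.mul_assoc, ← Matrix.mul_assoc Vᵀ, hV, Matrix.one_mul]
  simp [frameProj, Matrix.fromBlocks_multiply, h1, h2]

theorem frob_frameProj {U : Matrix (Fin m) (Fin r) ℝ} {V : Matrix (Fin n) (Fin r) ℝ}
    (hU : Uᵀ * U = 1) (hV : Vᵀ * V = 1) : frob (frameProj U V) = √(2 * r) := by
  have h : frob (frameProj U V) ^ 2 = 2 * r := by
    rw [frob_sq_eq_sum_rowNorm]
    simp only [rowNorm_sq_eq_of_proj (frameProj_transpose U V) (frameProj_mul_self hU hV)]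
    rw [Fintype.sum_sum_type]
    simp only [frameProj, Matrix.fromBlocks_apply₁₁, Matrix.fromBlocks_apply₂₂,
      mul_transpose_self_apply]
    rw [sum_rowNorm_sq_of_orthonormal hU, sum_rowNorm_sq_of_orthonormal hV]; ring
  rw [← h, Real.sqrt_sq (frob_nonneg _)]

theorem rowNorm_frameProj_le {U : Matrix (Fin m) (Fin r) ℝ} {V : Matrix (Fin n) (Fin r) ℝ}
    (hU : Uᵀ * U = 1) (hV : Vᵀ * V = 1) {p : ℝ} (hp : 0 ≤ p) (hUp : ∀ i, rowNorm U i ≤ p)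
    (hVp : ∀ i, rowNorm V i ≤ p) (i : Fin m ⊕ Fin n) : rowNorm (frameProj U V) i ≤ p := by
  refine (sq_le_sq₀ (rowNorm_nonneg _ _) hp).1 ?_
  rw [rowNorm_sq_eq_of_proj (frameProj_transpose U V) (frameProj_mul_self hU hV)]
  rcases i with i | i
  · rw [frameProj, Matrix.fromBlocks_apply₁₁, mul_transpose_self_apply]
    exact pow_le_pow_left₀ (rowNorm_nonneg _ _) (hUp i) 2
  · rw [frameProj, Matrix.fromBlocks_apply₂₂, mul_transpose_self_apply]
    exact pow_le_pow_left₀ (rowNorm_nonneg _ _) (hVp i) 2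

theorem rowNorm_frameProj_sub_inl (U U' : Matrix (Fin m) (Fin r) ℝ) (V V' : Matrix (Fin n) (Fin r) ℝ)
    (i : Fin m) : rowNorm (frameProj U V - frameProj U' V') (Sum.inl i) =
      rowNorm (U' * U'ᵀ - U * Uᵀ) i := by
  rw [← rowNorm_neg (U' * U'ᵀ - U * Uᵀ), neg_sub]
  simp [rowNorm, frameProj]

theorem rowNorm_frameProj_sub_inr (U U' : Matrix (Fin m) (Fin r) ℝ) (V V' : Matrix (Fin n) (Fin r) ℝ)
    (i : Fin n) : rowNorm (frameProj U V - frameProj U' V') (Sum.inr i) =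
      rowNorm (V' * V'ᵀ - V * Vᵀ) i := by
  rw [← rowNorm_neg (V' * V'ᵀ - V * Vᵀ), neg_sub]
  simp [rowNorm, frameProj]

variable {M : Matrix (Fin m) (Fin n) ℝ} {U : Matrix (Fin m) (Fin r) ℝ} {s : Fin r → ℝ}
  {V : Matrix (Fin n) (Fin r) ℝ}

theorem IsSVD.pos_of_rank (h : IsSVD M U s V) (hrank : M.rank = r) (k : Fin r) : 0 < s k := by
  refine lt_of_le_of_ne (h.nonneg k) fun hk => ?_
  have h1 : M.rank ≤ (Matrix.diagonal s).rank := by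
    rw [h.eq]
    exact (Matrix.rank_mul_le_left _ _).trans (Matrix.rank_mul_le_right _ _)
  rw [hrank, Matrix.rank_diagonal] at h1
  have h2 : Fintype.card {i // s i ≠ 0} < Fintype.card (Fin r) :=
    Fintype.card_subtype_lt (x := k) (by simpa using hk.symm)
  rw [Fintype.card_fin] at h2
  omega

/-- The Frobenius norm of M dominates that of its singular values. This links the smallest singular
value to the size of the entries and shows that M cannot vanish. -/
theorem IsSVD.rank_mul_sq_le (h : IsSVD M U s V) {b B : ℝ} (hb : 0 ≤ b) (hs : ∀ k, b ≤ s k)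
    (hM : ∀ p : Fin m × Fin n, |M p.1 p.2| ≤ B) : r * b ^ 2 ≤ m * n * B ^ 2 := by
  have h1 : Matrix.diagonal s = Uᵀ * (M * V) := by
    rw [h.eq, Matrix.mul_assoc _ Vᵀ, h.orthonormal_right, Matrix.mul_one, ← Matrix.mul_assoc,
      h.orthonormal_left, Matrix.one_mul]
  have hU : ‖Uᵀ‖ ≤ 1 := by
    rw [l2_opNorm_transpose]; exact norm_le_one_of_orthonormal h.orthonormal_left
  have hV := norm_le_one_of_orthonormal h.orthonormal_right
  have h2 : frob (Matrix.diagonal s) ≤ frob M := by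
    rw [h1]
    refine (frob_mul_le' _ _).trans ?_
    calc ‖Uᵀ‖ * frob (M * V) ≤ 1 * (frob M * 1) := by
          refine mul_le_mul hU ((frob_mul_le M V).trans ?_) (frob_nonneg _) zero_le_one
          exact mul_le_mul_of_nonneg_left hV (frob_nonneg _)
      _ = _ := by ring
  have h3 := pow_le_pow_left₀ (frob_nonneg _) h2 2
  rw [frob_sq, frob_sq] at h3
  calc r * b ^ 2 = ∑ _k : Fin r, b ^ 2 := by simp
    _ ≤ ∑ k, s k ^ 2 := Finset.sum_le_sum fun k _ => pow_le_pow_left₀ hb (hs k) 2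
    _ = ∑ i, ∑ j, Matrix.diagonal s i j ^ 2 := by
        refine Finset.sum_congr rfl fun i _ => ?_
        rw [Finset.sum_eq_single i]
        · simp
        · intro j _ hj; simp [Matrix.diagonal_apply_ne' _ hj]
        · simp
    _ ≤ _ := h3
    _ ≤ ∑ _i : Fin m, ∑ _j : Fin n, B ^ 2 := by
        refine Finset.sum_le_sum fun i _ => Finset.sum_le_sum fun j _ => ?_
        exact sq_le_sq' (by linarith [(abs_le.1 (hM (i, j))).1]) (abs_le.1 (hM (i, j))).2
    _ = _ := by simp; ring

end Incoherence

/-! ### Combination of the operator-norm and row events -/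

section SpectralTail

variable {Ω : Type*} [MeasurableSpace Ω] {P : Measure Ω} [IsProbabilityMeasure P]
  {m n r T : ℕ} {M : Matrix (Fin m) (Fin n) ℝ} {w : Fin m × Fin n → ℝ} {σ : ℝ≥0}
  {X : Fin T → Ω → Fin m × Fin n} {ξ : Fin T → Ω → ℝ} {B w₀ : ℝ}

theorem block_nonempty (hm : 0 < m) (hn : 0 < n) (i : Fin m ⊕ Fin n) : (block i).Nonempty := by
  rcases i with i | j
  · exact ⟨(i, ⟨0, hn⟩), (mem_block_inl _ _).2 rfl⟩
  · exact ⟨(⟨0, hm⟩, j), (mem_block_inr _ _).2 rfl⟩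

/-- The rows of the estimated spectral projections, outside an event of small probability. -/
theorem IsSampling.spectral_tail (hX : IsSampling P w σ X ξ) (hT : 0 < T)
    (hM : ∀ p : Fin m × Fin n, |M p.1 p.2| ≤ B) (hσ : (σ : ℝ) ≤ B) (hB : 0 < B) (hw₀ : 0 < w₀)
    (hw : ∀ p, w₀ ≤ w p) (hw1 : ∑ p, w p = 1) (hm : 0 < m) (hn : 0 < n)
    {U : Matrix (Fin m) (Fin r) ℝ} {s : Fin r → ℝ} {V : Matrix (Fin n) (Fin r) ℝ}
    (hSVD : IsSVD M U s V) {b : ℝ} (hb : 0 < b) (hs : ∀ k, b ≤ s k) (q : ℕ)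
    (hq : 8 * (q + 1 : ℝ) ≤ T * w₀ * (m + n)) {x ε p : ℝ} (hx : 0 < x)
    (hxD : ∀ i : Fin m ⊕ Fin n, 16 * x ≤ T * ∑ p ∈ block i, w p) (hε : 0 ≤ ε)
    (hεq : 2 * Real.exp 26 * (q + 1) * (B ^ 2 * (m + n) / (T * w₀)) ≤ ε ^ 2) (hεb : 20 * ε ≤ b)
    (hp : ∀ i, rowNorm (frameProj U V) i ≤ p)
    (hβ : 28 * √(2 * r) * (4 * B * x / (T * w₀)) ≤ b) :
    ∃ bad : Set Ω, P.real bad ≤ (m + n : ℝ) ^ 2 * Real.exp (-(q + 1)) +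
        (m + n) * ((m + n + 1) * (2 * Real.exp (-x))) ∧
      ∀ ω ∉ bad, ∀ (Uhat : Matrix (Fin m) (Fin r) ℝ) (Vhat : Matrix (Fin n) (Fin r) ℝ),
        IsSpectralEstimate (empiricalReward M w (fun t => X t ω) (fun t => ξ t ω)) Uhat Vhat →
        ∀ i, rowNorm (frameProj Uhat Vhat - frameProj U V) i ≤
          (7 * ε * p + 8 * √(2 * r) * (8 * B * √(x / (T * w₀)) +
            2 * (4 * B * x / (T * w₀)) * p)) / b := by
  have hT' : (0 : ℝ) < T := by exact_mod_cast hT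
  set A : Ω → Matrix (Fin m) (Fin n) ℝ := fun ω =>
    empiricalReward M w (fun t => X t ω) (fun t => ξ t ω) with hA
  set α := 8 * B * √(x / (T * w₀)) with hα
  set β := 4 * B * x / (T * w₀) with hβdef
  have h1 := opNorm_noise_tail hX hT hM hσ hB hw₀ hw hw1 (by omega) q hq
  have h2 := fun i => hX.row_tail hT hM hσ hB hw₀ hw i (block_nonempty hm hn i) (a := ε)
    (b := b - ε) (by linarith) (by linarith) hx (hxD i)
  refine ⟨{ω | 2 * Real.exp 26 * (q + 1) * (B ^ 2 * (m + n) / (T * w₀)) ≤ ‖A ω - M‖ ^ 2} ∪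
    ⋃ i, {ω | ∃ Q W k, GapProj (dil M + erase i (dil (A ω - M))) Q W ε (b - ε) ∧
      α * rowNorm Q k + β * ‖fun l => Q l k‖ < |(dil (A ω - M) * Q) i k|}, ?_, ?_⟩
  · refine (measureReal_union_le _ _).trans (add_le_add h1 ?_)
    refine (measureReal_iUnion_fintype_le _).trans ((Finset.sum_le_sum fun i _ => h2 i).trans ?_)
    simp [Finset.sum_const, Fintype.card_sum]
  · intro ω hω Uhat Vhat hest i
    have hω1 : ¬ 2 * Real.exp 26 * (q + 1) * (B ^ 2 * (m + n) / (T * w₀)) ≤ ‖A ω - M‖ ^ 2 :=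
      fun h => hω (Or.inl h)
    have hE : ‖A ω - M‖ ≤ ε :=
      (sq_le_sq₀ (norm_nonneg _) hε).1 ((not_le.1 hω1).le.trans hεq)
    have hdil : ‖dil (A ω - M)‖ ≤ ε := (norm_dil_le _).trans hE
    have hgap := gapProj_dil (A := M) (R := 0) (a := 0) hb hSVD.orthonormal_left
      hSVD.orthonormal_right hs (by rw [add_zero]; exact hSVD.eq) (by simp) (by simp) (by simp)
    obtain ⟨W', hW'⟩ := hest.gapProj hSVD hs hE (by linarith)
    have hsum : dil (A ω) = dil M + dil (A ω - M) := by rw [← dil_add, add_sub_cancel]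
    rw [hsum] at hW'
    have hex : ∀ i, ∃ Q R, GapProj (dil M + erase i (dil (A ω - M))) Q R ε (b - ε) := by
      intro i
      refine GapProj.exists_of_perturbation (by linarith) (dil_transpose M) ?_ hgap
        ((norm_erase_le i _).trans hdil)
      rw [erase, Matrix.transpose_mul, Matrix.transpose_mul, Matrix.diagonal_transpose,
        dil_transpose, Matrix.mul_assoc]
    choose Q R hQR using hex
    have key := rowNorm_sub_le_of_leaveOneOut (α := α) (β := β) hb hεb (by positivity)
      (by positivity) hdil hgap hW' hQR hp (by
        intro i k C hC
        have hn : ¬ α * rowNorm (Q i) k + β * ‖fun l => Q i l k‖ <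
            |(dil (A ω - M) * Q i) i k| := fun h =>
          hω (Or.inr (Set.mem_iUnion.2 ⟨i, Q i, R i, k, hQR i, h⟩))
        refine (not_lt.1 hn).trans ?_
        have hC0 : 0 ≤ C := (abs_nonneg _).trans (hC i)
        have : ‖fun l => Q i l k‖ ≤ C := (pi_norm_le_iff_of_nonneg hC0).2 hC
        have hβ0 : 0 ≤ β := by positivity
        gcongr)
      (by rw [frob_frameProj hSVD.orthonormal_left hSVD.orthonormal_right]; exact hβ) i
    rwa [frob_frameProj hSVD.orthonormal_left hSVD.orthonormal_right] at key

end SpectralTail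

end LowRank

namespace LowRank

/-! ### Choice of the parameters -/

section Parameters

theorem le_mul_sqrt_of_sq_le {a K y : ℝ} (hK : 0 ≤ K) (hy : 0 ≤ y) (h : a ^ 2 ≤ K ^ 2 * y) :
    a ≤ K * √y := by
  refine le_of_abs_le (abs_le_of_sq_le_sq ?_ (by positivity))
  rwa [mul_pow, Real.sq_sqrt hy]

variable {L b G N d r ℓ c : ℝ}

/-- Eliminates the singular value from the sample-size condition: with G = Tω_min and d = m ∧ n,
each row or column receives on average at least a multiple of rℓ³ observations. -/
theorem mul_le_of_sample_size (hb : 0 < b) (hd : 0 < d) (hℓ : 1 / 2 ≤ ℓ)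
    (hc : 0 < c) (hG : c * (L ^ 2 * N * ℓ ^ 3) ≤ G * b ^ 2) (hr : r * b ^ 2 ≤ L ^ 2 * N * d) :
    c * r * ℓ ^ 3 ≤ G * d := by
  have hℓ0 : 0 < ℓ := by linarith
  have h1 : c * ℓ ^ 3 * (r * b ^ 2) ≤ c * ℓ ^ 3 * (L ^ 2 * N * d) := by gcongr
  have h2 : d * (c * (L ^ 2 * N * ℓ ^ 3)) ≤ d * (G * b ^ 2) := by gcongr
  have h3 : c * r * ℓ ^ 3 * b ^ 2 ≤ G * d * b ^ 2 := by nlinarith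
  exact le_of_mul_le_mul_right h3 (by positivity)

/-- Ensures `20 * ε ≤ b`. After ℓ ≤ 4ℓ³, it amounts to 400 · 80 ≤ 10⁵. -/
theorem noise_level_le (hL : 0 < L) (hG0 : 0 < G) (hN : 0 < N)
    (hℓ : 1 / 2 ≤ ℓ) (hb : 0 < b)
    (hG : 10 ^ 5 * Real.exp 26 * (L ^ 2 * N * ℓ ^ 3) ≤ G * b ^ 2) :
    20 * √(20 * Real.exp 26 * ℓ * (L ^ 2 * N / G)) ≤ b := by
  have hℓ0 : 0 < ℓ := by linarith
  have h1 : ℓ ≤ 4 * ℓ ^ 3 := by nlinarith [mul_pos hℓ0 hℓ0]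
  have h2 : √(20 * Real.exp 26 * ℓ * (L ^ 2 * N / G)) ≤ b / 20 := by
    rw [Real.sqrt_le_left (by positivity)]
    rw [mul_div_assoc', div_le_iff₀ hG0]
    have h3 : 20 * Real.exp 26 * ℓ * (L ^ 2 * N) ≤ 20 * Real.exp 26 * (4 * ℓ ^ 3) * (L ^ 2 * N) := by
      gcongr
    have h4 : 0 ≤ Real.exp 26 * (L ^ 2 * N * ℓ ^ 3) := by positivity
    nlinarith
  linarith

/-- Ensures the absorption hypothesis on β. The square of the claim comes from multiplying the two
forms of the sample-size condition, one carrying r and the other L². -/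
theorem entry_level_le (hL : 0 < L) (hb : 0 < b) (hd : 0 < d) (hdN : d ≤ N) (hr0 : 0 ≤ r)
    (hG0 : 0 < G) (hℓ : 1 / 2 ≤ ℓ) (hc : 10 ^ 4 ≤ c)
    (hG : c * (L ^ 2 * N * ℓ ^ 3) ≤ G * b ^ 2) (hr : c * r * ℓ ^ 3 ≤ G * d) :
    28 * √(2 * r) * (4 * L * (8 * ℓ) / G) ≤ b := by
  have hℓ0 : 0 < ℓ := by linarith
  have hc0 : 0 < c := by linarith
  have hN : 0 < N := hd.trans_le hdN
  refine le_of_abs_le (abs_le_of_sq_le_sq ?_ hb.le)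
  have e : (28 * √(2 * r) * (4 * L * (8 * ℓ) / G)) ^ 2 =
      896 ^ 2 * (2 * r) * (L ^ 2 * ℓ ^ 2) / G ^ 2 := by
    have : (28 * √(2 * r) * (4 * L * (8 * ℓ) / G)) ^ 2 =
      896 ^ 2 * √(2 * r) ^ 2 * (L ^ 2 * ℓ ^ 2) / G ^ 2 := by ring
    rw [this, Real.sq_sqrt (by positivity)]
  rw [e, div_le_iff₀ (by positivity)]
  have h1 : (c * r * ℓ ^ 3) * (c * (L ^ 2 * N * ℓ ^ 3)) ≤ (G * d) * (G * b ^ 2) := by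
    gcongr
  have h2 : (c * r * ℓ ^ 3) * (c * (L ^ 2 * d * ℓ ^ 3)) ≤ (c * r * ℓ ^ 3) * (c * (L ^ 2 * N * ℓ ^ 3)) := by
    gcongr
  have h3 : d * (c ^ 2 * ℓ ^ 6 * (r * L ^ 2)) ≤ d * (b ^ 2 * G ^ 2) := by nlinarith
  have h4 := le_of_mul_le_mul_left h3 hd
  refine le_trans ?_ h4
  have h5 : (1 / 2) ^ 4 * ℓ ^ 2 ≤ ℓ ^ 6 := by
    have : (1 / 2 : ℝ) ^ 4 ≤ ℓ ^ 4 := by gcongr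
    calc (1 / 2) ^ 4 * ℓ ^ 2 ≤ ℓ ^ 4 * ℓ ^ 2 := by gcongr
      _ = ℓ ^ 6 := by ring
  have h6 : (10 ^ 4 : ℝ) ^ 2 ≤ c ^ 2 := by gcongr
  calc 896 ^ 2 * (2 * r) * (L ^ 2 * ℓ ^ 2) = (2 * 896 ^ 2) * ℓ ^ 2 * (r * L ^ 2) := by ring
    _ ≤ ((10 ^ 4) ^ 2 * (1 / 2) ^ 4) * ℓ ^ 2 * (r * L ^ 2) := by
        refine mul_le_mul_of_nonneg_right (mul_le_mul_of_nonneg_right ?_ (by positivity))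
          (by positivity)
        norm_num
    _ = (10 ^ 4) ^ 2 * ((1 / 2) ^ 4 * ℓ ^ 2) * (r * L ^ 2) := by ring
    _ ≤ c ^ 2 * ℓ ^ 6 * (r * L ^ 2) := by gcongr

/-- Each of the three terms is compared with the target by squaring: the operator-norm term needs
only ℓ ≤ 4ℓ³, the Gaussian term of Bernstein also d ≤ N and μ ≥ 1, and its range term uses cr ℓ³ ≤
Gd. The numerical parts 512 and 1024 fit in 2000. -/
theorem error_bound_le {μ κ : ℝ} (hL : 0 < L) (hb : 0 < b) (hd : 0 < d) (hdN : d ≤ N) (hr0 : 0 ≤ r)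
    (hG0 : 0 < G) (hℓ : 1 / 2 ≤ ℓ) (hc : 10 ^ 4 ≤ c) (hμ : 1 ≤ μ) (hκ : 1 ≤ κ)
    (hr : c * r * ℓ ^ 3 ≤ G * d) :
    (7 * √(20 * Real.exp 26 * ℓ * (L ^ 2 * N / G)) * (μ * √(r / d)) +
      8 * √(2 * r) * (8 * L * √(8 * ℓ / G) + 2 * (4 * L * (8 * ℓ) / G) * (μ * √(r / d)))) / b ≤
      (70 * Real.exp 13 + 2000) * (L / b) * √(μ ^ 2 * κ ^ 2 * r * N / (G * d) * ℓ ^ 3) := by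
  have hℓ0 : 0 < ℓ := by linarith
  have hc0 : 0 < c := by linarith
  have hN : 0 < N := hd.trans_le hdN
  have hμ0 : 0 < μ := by linarith
  have hκ0 : 0 < κ := by linarith
  have hℓ3 : ℓ ≤ 4 * ℓ ^ 3 := by nlinarith [mul_pos hℓ0 hℓ0]
  set y := r * N / (G * d) * ℓ ^ 3 with hy
  have hy0 : 0 ≤ y := by positivity
  have e0 : √(μ ^ 2 * κ ^ 2 * r * N / (G * d) * ℓ ^ 3) = μ * κ * √y := by
    have : μ ^ 2 * κ ^ 2 * r * N / (G * d) * ℓ ^ 3 = (μ * κ) ^ 2 * y := by rw [hy]; ring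
    rw [this, Real.sqrt_mul (by positivity), Real.sqrt_sq (by positivity)]
  have t1 : 7 * √(20 * Real.exp 26 * ℓ * (L ^ 2 * N / G)) * √(r / d) ≤
      (70 * Real.exp 13 * L) * √y := by
    refine le_mul_sqrt_of_sq_le (by positivity) hy0 ?_
    rw [mul_pow, mul_pow, Real.sq_sqrt (by positivity), Real.sq_sqrt (by positivity)]
    have ee : Real.exp 13 ^ 2 = Real.exp 26 := by rw [← Real.exp_nat_mul]; norm_num
    have e1 : (70 * Real.exp 13 * L) ^ 2 * y = 4900 * Real.exp 26 * L ^ 2 * y := by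
      rw [← ee]; ring
    have e2 : 7 ^ 2 * (20 * Real.exp 26 * ℓ * (L ^ 2 * N / G)) * (r / d) =
        980 * Real.exp 26 * L ^ 2 * (r * N / (G * d) * ℓ) := by
      field_simp; ring
    rw [e1, e2]
    calc 980 * Real.exp 26 * L ^ 2 * (r * N / (G * d) * ℓ)
        ≤ 980 * Real.exp 26 * L ^ 2 * (r * N / (G * d) * (4 * ℓ ^ 3)) := by gcongr
      _ = 3920 * Real.exp 26 * L ^ 2 * y := by rw [hy]; ring
      _ ≤ _ := by gcongr; norm_num
  have t2 : 8 * √(2 * r) * (8 * L * √(8 * ℓ / G)) ≤ (512 * L) * √y := by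
    refine le_mul_sqrt_of_sq_le (by positivity) hy0 ?_
    rw [mul_pow, mul_pow, mul_pow _ √(8 * ℓ / G), Real.sq_sqrt (by positivity),
      Real.sq_sqrt (by positivity)]
    have h1 : r * (ℓ / G) ≤ 4 * y := by
      have e3 : r * (ℓ / G) = r * d / (G * d) * ℓ := by field_simp
      rw [e3]
      calc r * d / (G * d) * ℓ ≤ r * N / (G * d) * (4 * ℓ ^ 3) := by gcongr
        _ = _ := by rw [hy]; ring
    have e4 : 8 ^ 2 * (2 * r) * ((8 * L) ^ 2 * (8 * ℓ / G)) = 65536 * L ^ 2 * (r * (ℓ / G)) := by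
      ring
    rw [e4]
    calc 65536 * L ^ 2 * (r * (ℓ / G)) ≤ 65536 * L ^ 2 * (4 * y) := by gcongr
      _ = _ := by ring
  have t3 : 8 * √(2 * r) * (2 * (4 * L * (8 * ℓ) / G) * √(r / d)) ≤ (1024 * L) * √y := by
    refine le_mul_sqrt_of_sq_le (by positivity) hy0 ?_
    rw [mul_pow, mul_pow, mul_pow _ √(r / d), Real.sq_sqrt (by positivity),
      Real.sq_sqrt (by positivity)]
    have e5 : 8 ^ 2 * (2 * r) * ((2 * (4 * L * (8 * ℓ) / G)) ^ 2 * (r / d)) =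
        524288 * L ^ 2 * (r ^ 2 * ℓ ^ 2 / (G ^ 2 * d)) := by field_simp; ring
    have h1 : r ^ 2 * ℓ ^ 2 / (G ^ 2 * d) ≤ y := by
      have e6 : y = r * ℓ ^ 2 * (G * N * ℓ) / (G ^ 2 * d) := by rw [hy]; field_simp
      have e7 : r ^ 2 * ℓ ^ 2 = r * ℓ ^ 2 * r := by ring
      rw [e6, e7]
      gcongr
      have h2 : 1 ≤ c * ℓ ^ 3 := by
        have : (1 / 2 : ℝ) ^ 3 ≤ ℓ ^ 3 := by gcongr
        nlinarith
      have h4 : 1 ≤ c * ℓ ^ 4 := by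
        have : (1 / 2 : ℝ) ^ 4 ≤ ℓ ^ 4 := by gcongr
        nlinarith
      calc r ≤ (c * ℓ ^ 4) * r := le_mul_of_one_le_left hr0 h4
        _ = (c * r * ℓ ^ 3) * ℓ := by ring
        _ ≤ (G * d) * ℓ := by gcongr
        _ ≤ _ := by gcongr
    rw [e5]
    calc 524288 * L ^ 2 * (r ^ 2 * ℓ ^ 2 / (G ^ 2 * d)) ≤ 524288 * L ^ 2 * y := by gcongr
      _ ≤ 1048576 * L ^ 2 * y := by gcongr; norm_num
      _ = _ := by ring
  have hsy := Real.sqrt_nonneg y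
  rw [e0, div_le_iff₀ hb]
  have e9 : (70 * Real.exp 13 + 2000) * (L / b) * (μ * κ * √y) * b =
      κ * ((70 * Real.exp 13 + 2000) * L * μ * √y) := by field_simp
  rw [e9]
  refine le_trans ?_ (le_mul_of_one_le_left (by positivity) hκ)
  have u1 := mul_le_mul_of_nonneg_left t1 hμ0.le
  have u2 := t2.trans (le_mul_of_one_le_left (by positivity) hμ)
  have u3 := mul_le_mul_of_nonneg_left t3 hμ0.le
  have hpos : 0 ≤ L * μ * √y := by positivity
  nlinarith

/-- With z = exp(-ℓ) = δ/(NT), the total is at most 5 (Nz)² z⁶, where Nz ≤ δ and z ≤ 1/2. The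
exponent 8 in 8ℓ thus leaves six powers of z for the constant. -/
theorem failure_prob_le {N T δ ℓ p : ℝ} (hN : 2 ≤ N) (hT : 1 ≤ T) (hδ0 : 0 < δ) (hδ1 : δ < 1)
    (hℓ : ℓ = Real.log (N * T / δ)) (hp : 8 * ℓ ≤ p) :
    N ^ 2 * Real.exp (-p) + N * ((N + 1) * (2 * Real.exp (-(8 * ℓ)))) ≤ δ := by
  have hN0 : 0 < N := by linarith
  have hT0 : 0 < T := by linarith
  set z := Real.exp (-ℓ) with hz
  have hz0 : 0 < z := Real.exp_pos _
  have hzeq : z = δ / (N * T) := by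
    rw [hz, hℓ, Real.exp_neg, Real.exp_log (by positivity), inv_div]
  have hNz : N * z ≤ δ := by
    rw [hzeq, mul_div_assoc', div_le_iff₀ (by positivity)]
    nlinarith [mul_nonneg (mul_nonneg hN0.le hδ0.le) (sub_nonneg.2 hT)]
  have hz2 : z ≤ 1 / 2 := by nlinarith
  have h8 : Real.exp (-(8 * ℓ)) = z ^ 8 := by
    rw [hz, ← Real.exp_nat_mul]; congr 1; push_cast; ring
  have h1 : Real.exp (-p) ≤ z ^ 8 := by rw [← h8]; exact Real.exp_le_exp.2 (by linarith)
  rw [h8]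
  have h6 : z ^ 6 ≤ (1 / 2) ^ 6 := pow_le_pow_left₀ hz0.le hz2 6
  have hs : (N * z) ^ 2 ≤ δ := by
    have : (N * z) ^ 2 ≤ δ ^ 2 := pow_le_pow_left₀ (by positivity) hNz 2
    nlinarith
  calc N ^ 2 * Real.exp (-p) + N * ((N + 1) * (2 * z ^ 8))
      ≤ N ^ 2 * z ^ 8 + N * ((N + N) * (2 * z ^ 8)) := by gcongr; linarith
    _ = 5 * (N * z) ^ 2 * z ^ 6 := by ring
    _ ≤ 5 * δ * (1 / 2) ^ 6 := by gcongr
    _ ≤ δ := by linarith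

end Parameters

end LowRank

namespace LowRank

/-! ### Parameter choices and the final bound -/

section Assembly

variable {Ω : Type*} [MeasurableSpace Ω] {P : Measure Ω} [IsProbabilityMeasure P]
  {m n r T : ℕ} {M : Matrix (Fin m) (Fin n) ℝ} {w : Fin m × Fin n → ℝ} {σ : ℝ≥0}
  {X : Fin T → Ω → Fin m × Fin n} {ξ : Fin T → Ω → ℝ}

set_option maxHeartbeats 1000000 in
/-- The row-wise error of the spectral estimates, in terms of bounds on the parameters of the
problem. -/
theorem IsSampling.twoToInf_spectral_error_le (hX : IsSampling P w σ X ξ) (hT : 0 < T)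
    (hr : 0 < r) (hm : 0 < m) (hn : 0 < n) {L b w₀ κ μ ℓ δ : ℝ}
    (hML : ∀ p : Fin m × Fin n, |M p.1 p.2| ≤ L) (hσL : (σ : ℝ) ≤ L) (hL : 0 < L) (hw₀ : 0 < w₀)
    (hw : ∀ p, w₀ ≤ w p) (hw1 : ∑ p, w p = 1)
    {U : Matrix (Fin m) (Fin r) ℝ} {s : Fin r → ℝ} {V : Matrix (Fin n) (Fin r) ℝ}
    (hM : IsSVD M U s V) (hb : 0 < b) (hs : ∀ k, b ≤ s k) (hκ : 1 ≤ κ)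
    (hμU : √((m : ℝ) / r) * twoToInf U ≤ μ) (hμV : √((n : ℝ) / r) * twoToInf V ≤ μ)
    {Uhat : Ω → Matrix (Fin m) (Fin r) ℝ} {Vhat : Ω → Matrix (Fin n) (Fin r) ℝ}
    (hest : ∀ ω, IsSpectralEstimate
      (empiricalReward M w (fun t => X t ω) (fun t => ξ t ω)) (Uhat ω) (Vhat ω))
    (hδ0 : 0 < δ) (hδ1 : δ < 1) (hℓeq : ℓ = Real.log (((m : ℝ) + n) * T / δ))
    (hTc : (T : ℝ) ≥ 10 ^ 5 * Real.exp 26 * (L ^ 2 * ((m : ℝ) + n) / (b ^ 2 * w₀)) * ℓ ^ 3) :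
    ∃ E : Set Ω, MeasurableSet E ∧ 1 - δ ≤ P.real E ∧ ∀ ω ∈ E,
      max (twoToInf (U * Uᵀ - Uhat ω * (Uhat ω)ᵀ)) (twoToInf (V * Vᵀ - Vhat ω * (Vhat ω)ᵀ)) ≤
        (70 * Real.exp 13 + 2000) * (L / b) *
          √(μ ^ 2 * κ ^ 2 * r * ((m : ℝ) + n) / (T * w₀ * min (m : ℝ) n) * ℓ ^ 3) := by
  have hT1 : (1 : ℝ) ≤ T := by exact_mod_cast hT
  have hT' : (0 : ℝ) < T := by linarith
  have hm1 : (1 : ℝ) ≤ m := by exact_mod_cast hm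
  have hn1 : (1 : ℝ) ≤ n := by exact_mod_cast hn
  have hr1 : (1 : ℝ) ≤ r := by exact_mod_cast hr
  have hrb := hM.rank_mul_sq_le hb.le hs hML
  -- dimensions
  set d : ℝ := min (m : ℝ) n with hd
  have hd1 : 1 ≤ d := le_min hm1 hn1
  have hdm : d ≤ m := min_le_left _ _
  have hdn : d ≤ n := min_le_right _ _
  have hmnd : (m * n : ℝ) ≤ (m + n) * d := by
    rcases min_choice (m : ℝ) n with h | h <;> rw [hd, h] <;> nlinarith
  have hrL : r * b ^ 2 ≤ L ^ 2 * (m + n) * d := by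
    refine hrb.trans ?_
    calc (m * n : ℝ) * L ^ 2 ≤ (m + n) * d * L ^ 2 := by gcongr
      _ = _ := by ring
  -- the logarithmic factor
  have hℓ : 1 / 2 ≤ ℓ := by
    -- A lower bound on ℓ allows a single power of ℓ to be replaced by a multiple of ℓ³.
    have h1 : (2 : ℝ) ≤ (m + n) * T / δ := by
      rw [le_div_iff₀ hδ0]; nlinarith
    have h2 : Real.log 2 ≤ ℓ := by
      rw [hℓeq]; exact Real.log_le_log (by norm_num) h1
    linarith [Real.log_two_gt_d9]
  have hℓ0 : 0 < ℓ := by linarith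
  -- the sample size
  set G : ℝ := T * w₀ with hG
  have hG0 : 0 < G := by positivity
  have hGc : 10 ^ 5 * Real.exp 26 * (L ^ 2 * (m + n) * ℓ ^ 3) ≤ G * b ^ 2 := by
    have e : 10 ^ 5 * Real.exp 26 * (L ^ 2 * ((m : ℝ) + n) / (b ^ 2 * w₀)) * ℓ ^ 3 =
        10 ^ 5 * Real.exp 26 * (L ^ 2 * (m + n) * ℓ ^ 3) / (b ^ 2 * w₀) := by ring
    have h1 := hTc
    rw [ge_iff_le, e, div_le_iff₀ (by positivity)] at h1
    refine h1.trans (le_of_eq ?_)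
    rw [hG]; ring
  have hc : (10 : ℝ) ^ 4 ≤ 10 ^ 5 * Real.exp 26 := by
    have : 1 ≤ Real.exp 26 := Real.one_le_exp (by norm_num)
    nlinarith
  have hcG := mul_le_of_sample_size hb (by linarith : 0 < d) hℓ (by positivity) hGc hrL
  have hGd : 512 * ℓ ≤ G * d := by
    refine le_trans ?_ hcG
    have h3 : ℓ ≤ 4 * ℓ ^ 3 := by nlinarith [mul_pos hℓ0 hℓ0]
    have h4 : (10 : ℝ) ^ 4 * 1 ≤ 10 ^ 5 * Real.exp 26 * r := by gcongr
    calc 512 * ℓ ≤ 512 * (4 * ℓ ^ 3) := by gcongr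
      _ ≤ (10 : ℝ) ^ 4 * 1 * ℓ ^ 3 := by nlinarith [pow_pos hℓ0 3]
      _ ≤ _ := by gcongr
  -- incoherence
  have hμ : 1 ≤ μ := (one_le_sqrt_mul_twoToInf hM.orthonormal_left hr).trans hμU
  have hproj := rowNorm_frameProj_le hM.orthonormal_left hM.orthonormal_right
    (p := μ * √(r / d)) (by positivity)
    (rowNorm_le_of_incoherence hr (by linarith) hdm hμU)
    (rowNorm_le_of_incoherence hr (by linarith) hdn hμV)
  -- The moment order is ⌊8ℓ⌋ + 1: at least 8ℓ for the failure probability, at most 10ℓ because 1 ≤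
  -- 2ℓ.
  have hq1 : 8 * ℓ ≤ (⌊8 * ℓ⌋₊ : ℝ) + 1 := (Nat.lt_floor_add_one _).le
  have hq2 : (⌊8 * ℓ⌋₊ : ℝ) + 1 ≤ 10 * ℓ := by
    have := Nat.floor_le (show 0 ≤ 8 * ℓ by positivity)
    linarith
  clear_value G d
  have hGN : G * d ≤ G * (m + n) := by gcongr; linarith
  obtain ⟨bad, hbad, hgood⟩ := hX.spectral_tail hT hML hσL hL hw₀ hw hw1 hm hn hM hb hs
    ⌊8 * ℓ⌋₊ (by rw [← hG]; linarith) (x := 8 * ℓ)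
    (ε := √(20 * Real.exp 26 * ℓ * (L ^ 2 * (m + n) / G))) (by positivity)
    (fun i => by
      -- A row has n cells and a column m, so each block is hit at least G * d times on average.
      have h1 : d ≤ (block i).card := by
        have : ((block i).card : ℝ) = ∑ _p ∈ block i, (1 : ℝ) := by simp
        rw [this]
        rcases i with i | j
        · rw [sum_block_inl]; simpa using hdn
        · rw [sum_block_inr]; simpa using hdm
      have h2 : (block i).card * w₀ ≤ ∑ p ∈ block i, w p := by
        rw [← nsmul_eq_mul]
        exact Finset.card_nsmul_le_sum _ _ _ fun p _ => hw p
      calc 16 * (8 * ℓ) ≤ G * d := by linarith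
        _ = T * (d * w₀) := by rw [hG]; ring
        _ ≤ T * ∑ p ∈ block i, w p := by
            gcongr
            exact (mul_le_mul_of_nonneg_right h1 hw₀.le).trans h2)
    (Real.sqrt_nonneg _)
    (by
      rw [Real.sq_sqrt (by positivity)]
      have h0 : 0 ≤ L ^ 2 * ((m : ℝ) + n) / G := by positivity
      calc 2 * Real.exp 26 * ((⌊8 * ℓ⌋₊ : ℝ) + 1) * (L ^ 2 * (m + n) / (T * w₀))
          ≤ 2 * Real.exp 26 * (10 * ℓ) * (L ^ 2 * (m + n) / (T * w₀)) := by gcongr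
        _ = _ := by rw [hG]; ring)
    (noise_level_le hL hG0 (by linarith) hℓ hb hGc) hproj
    (by
      rw [← hG]
      exact entry_level_le hL hb (by linarith) (by linarith) (by linarith) hG0 hℓ hc hGc
        hcG)
  have hbadδ : P.real bad ≤ δ := hbad.trans
    (failure_prob_le (by linarith) hT1 hδ0 hδ1 hℓeq hq1)
  -- The bad set need not be measurable; its measurable hull has the same probability.
  refine ⟨(toMeasurable P bad)ᶜ, (measurableSet_toMeasurable P bad).compl, ?_, ?_⟩
  · rw [probReal_compl_eq_one_sub (measurableSet_toMeasurable P bad), measureReal_def,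
      measure_toMeasurable, ← measureReal_def]
    linarith
  · intro ω hω
    have hω' : ω ∉ bad := fun h => hω (subset_toMeasurable P bad h)
    have hrow : ∀ i, rowNorm
        (frameProj (Uhat ω) (Vhat ω) - frameProj U V) i ≤
        (70 * Real.exp 13 + 2000) * (L / b) *
          √(μ ^ 2 * κ ^ 2 * r * (m + n) / (G * d) * ℓ ^ 3) := by
      intro i
      refine (hgood ω hω' _ _ (hest ω) i).trans ?_
      rw [← hG]
      exact error_bound_le hL hb (by linarith) (by linarith) (by linarith) hG0 hℓ hc hμ hκ
        hcG
    refine max_le (twoToInf_le hm fun i => ?_) (twoToInf_le hn fun i => ?_)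
    · rw [← rowNorm_frameProj_sub_inl (Uhat ω) U (Vhat ω) V]
      exact hrow _
    · rw [← rowNorm_frameProj_sub_inr (Uhat ω) U (Vhat ω) V]
      exact hrow _

end Assembly

end LowRank

theorem mainTheorem1 :
    ∃ C c : ℝ, 0 < C ∧ 0 < c ∧
      ∀ {Ω : Type*} [MeasurableSpace Ω] (P : Measure Ω) [IsProbabilityMeasure P]
        (m n r T : ℕ) (hr : 0 < r) (_hT : 0 < T)
        -- the reward matrix, of rank `r`, with its singular value decomposition
        (M : Matrix (Fin m) (Fin n) ℝ) (U : Matrix (Fin m) (Fin r) ℝ) (s : Fin r → ℝ)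
        (V : Matrix (Fin n) (Fin r) ℝ) (_hrank : M.rank = r) (_hM : LowRank.IsSVD M U s V)
        -- the sampling distribution and the observations
        (w : Fin m × Fin n → ℝ) (_hw : ∀ p, 0 < w p) (_hw1 : ∑ p, w p = 1)
        (σ : ℝ≥0) (X : Fin T → Ω → Fin m × Fin n) (ξ : Fin T → Ω → ℝ)
        (_hX : LowRank.IsSampling P w σ X ξ)
        -- the spectral estimates
        (Uhat : Ω → Matrix (Fin m) (Fin r) ℝ) (Vhat : Ω → Matrix (Fin n) (Fin r) ℝ)
        (_hest : ∀ ω, LowRank.IsSpectralEstimate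
          (LowRank.empiricalReward M w (fun t => X t ω) (fun t => ξ t ω)) (Uhat ω) (Vhat ω))
        (δ : ℝ) (_hδ0 : 0 < δ) (_hδ1 : δ < 1),
        let σ₁ : ℝ := s ⟨0, hr⟩
        let σᵣ : ℝ := s ⟨r - 1, Nat.sub_lt hr Nat.one_pos⟩
        let κ : ℝ := σ₁ / σᵣ
        let μ : ℝ := LowRank.incoherence U V
        let L : ℝ := max (LowRank.maxNorm M) (σ : ℝ)
        let ωmin : ℝ := LowRank.wmin w
        let ℓ : ℝ := Real.log (((m : ℝ) + n) * T / δ)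
        (T : ℝ) ≥ c * (L ^ 2 * ((m : ℝ) + n) / (σᵣ ^ 2 * ωmin)) * ℓ ^ 3 →
        ∃ E : Set Ω, MeasurableSet E ∧ 1 - δ ≤ P.real E ∧ ∀ ω ∈ E,
          max (LowRank.twoToInf (U * Uᵀ - Uhat ω * (Uhat ω)ᵀ))
              (LowRank.twoToInf (V * Vᵀ - Vhat ω * (Vhat ω)ᵀ)) ≤
            C * (L / σᵣ) *
              Real.sqrt (μ ^ 2 * κ ^ 2 * r * ((m : ℝ) + n) / (T * ωmin * min (m : ℝ) n) * ℓ ^ 3) := by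
  refine ⟨70 * Real.exp 13 + 2000, 10 ^ 5 * Real.exp 26, by positivity, by positivity, ?_⟩
  intro Ω _ P _ m n r T hr hT M U s V hrank hM w hw hw1 σ X ξ hX Uhat Vhat hest δ hδ0 hδ1
    σ₁ σᵣ κ μ L ωmin ℓ hTc
  have hm : 0 < m := by
    have := M.rank_le_height
    omega
  have hn : 0 < n := by
    have := M.rank_le_width
    omega
  have : Nonempty (Fin m × Fin n) := ⟨(⟨0, hm⟩, ⟨0, hn⟩)⟩
  -- singular values
  have hσᵣ : 0 < σᵣ := hM.pos_of_rank hrank _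
  have hs : ∀ k, σᵣ ≤ s k := fun k => hM.antitone (Fin.mk_le_mk.2 (by omega))
  have hκ : 1 ≤ κ := (one_le_div hσᵣ).2 (hs _)
  -- sampling probabilities
  have hwle : ∀ p, ωmin ≤ w p := fun p => ciInf_le (Set.finite_range w).bddBelow p
  have hωmin : 0 < ωmin := by
    obtain ⟨p, hp⟩ := exists_eq_ciInf_of_finite (f := w)
    change 0 < ⨅ p, w p
    rw [← hp]; exact hw p
  -- the size of the observations
  have hML : ∀ p : Fin m × Fin n, |M p.1 p.2| ≤ L := fun p =>
    (LowRank.abs_le_maxNorm M p).trans (le_max_left _ _)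
  have hσL : (σ : ℝ) ≤ L := le_max_right _ _
  have hrb := hM.rank_mul_sq_le hσᵣ.le hs hML
  -- If L were 0, then M would vanish, contradicting r * σᵣ² > 0.
  have hL : 0 < L := by
    refine lt_of_le_of_ne (σ.2.trans hσL) fun h0 => ?_
    rw [← h0] at hrb
    have hr' : (0 : ℝ) < r := by exact_mod_cast hr
    have : 0 < r * σᵣ ^ 2 := by positivity
    nlinarith
  exact hX.twoToInf_spectral_error_le hT hr hm hn hML hσL hL hωmin hwle hw1 hM hσᵣ hs hκ
    (le_max_left _ _) (le_max_right _ _) hest hδ0 hδ1 rfl hTc
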